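/- **Setting.** For $N\ge 0$ let $U(\mathfrak{gl}_N)$ be the universal enveloping algebra over $\mathbb{C}$ with generators $E_{ij}$, $1\le i,j\le N$, and coproduct $\Delta(X)=X\otimes 1+1\otimes X$ for $X\in\mathfrak{gl}_N$. For $t\ge 0$ let $\kappa_t(U)=e^{t\,\mathrm{Tr}(U-\mathrm{Id})}$, and let $\langle\cdot\rangle_t$ be the linear functional on $U(\mathfrak{gl}_N)$ with $\langle A_1\cdots A_k\rangle_t=\partial_{s_1}\cdots\partial_{s_k}\kappa_t(e^{s_1A_1}\cdots e^{s_kA_k})\big|_{s_1=\cdots=s_k=0}$ for $A_i\in\mathfrak{gl}_N$ (that is, $\langle X\rangle_t=D(X)\kappa_t(\mathrm{Id})$, where $D$ is the action by left-invariant differential operators). Let $P_t=(\mathrm{id}\otimes\langle\cdot\rangle_t)\circ\Delta$. For $k\ge 1$ put $$\Psi_k=\Psi_{k,N}=\sum_{m=1}^N\sum_{\pi} E(\pi),$$ where $\pi$ runs over the closed paths $m=v_0\to v_1\to\cdots\to v_k=m$ with all $v_i\in\{1,\dots,m\}$, and $E(\pi)=r(\pi)\,X_{v_0v_1}X_{v_1v_2}\cdots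 X_{v_{k-1}v_k}$ with $r(\pi)\ge 1$ the length of the first return to $m$, $X_{ij}=E_{ij}$ for $i\ne j$ and $X_{ii}=E_{ii}-m+1$. For a partition $\rho=(\rho_1\ge\cdots\ge\rho_l)$ (possibly empty) put $\Psi_\rho=\Psi_{\rho_1}\cdots\Psi_{\rho_l}$ and $\mathrm{wt}(\rho)=\rho_1+\cdots+\rho_l+l$. Below, $N=\lfloor\eta L\rfloor$ and $L\to\infty$ through the positive reals. **Proposition.** (1) For all $\eta,\tau>0$ and every partition $\rho$, $\langle\Psi_{\rho,N}\rangle_{\tau L}=O(L^{\mathrm{wt}(\rho)})$. Moreover, for each odd $k\geq 1$ there is a real number $r_k$, not depending on $\eta,\tau,\rho$, such that $$\langle\Psi_{\rho,N}\rangle_{\tau L}=\Theta(L^{\mathrm{wt}(\rho)})$$ for all $\rho$ and all $\eta,\tau>0$ with $\tau/\eta\ne r_k$ for every odd part $k$ of $\rho$. (In particular this holds for all $\eta,\tau>0$ if all parts of $\rho$ are even.) (2) For all $\eta,\tau>0$ and $k\ge1$ there are real constants $c'_{k,\rho}(\tau,\eta)$ such that $$P_{\tau L}\Psi_{k,N}=\sum_{\rho:\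 \mathrm{wt}(\rho)\le k+1}\bigl(c'_{k,\rho}(\tau,\eta)+o(1)\bigr)L^{k+1-\mathrm{wt}(\rho)}\,\Psi_{\rho,N}\qquad (L>0),$$ where the $o(1)$ are real functions of $L$ that tend to $0$ as $L\to\infty$. (3) For all $\eta>0$, $\tau_1>\tau_0\ge 0$ and $k\ge 1$ there are real constants $c_{kj}(\tau_1,\tau_0,\eta)$, $1\le j\le k$, such that for every $m\ge 1$ the limits below exist and $$\lim_{L\to\infty}\left\langle\frac{\Psi_m-\langle\Psi_m\rangle_{\tau_0L}}{L^m}\cdot\frac{P_{(\tau_1-\tau_0)L}\Psi_k-\langle P_{(\tau_1-\tau_0)L}\Psi_k\rangle_{\tau_0L}}{L^k}\right\rangle_{\tau_0L} =\sum_{j=1}^k c_{kj}(\tau_1,\tau_0,\eta)\lim_{L\to\infty}\left\langle\frac{\Psi_m-\langle\Psi_m\rangle_{\tau_0L}}{L^m}\cdot\frac{\Psi_j-\langle\Psi_j\rangle_{\tau_0L}}{L^j}\right\rangle_{\tau_0L}.$$ -/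

import Mathlib

open scoped TensorProduct

noncomputable section

namespace GLWalk

section Algebra

attribute [local instance 100] LieRing.ofAssociativeRing

/-- The universal enveloping algebra `U(gl_N)` over `ℂ`. -/
abbrev Ugl (N : ℕ) : Type := UniversalEnvelopingAlgebra ℂ (Matrix (Fin N) (Fin N) ℂ)

/-- The canonical map of `gl_N` into `U(gl_N)`. -/
def toU (N : ℕ) : Matrix (Fin N) (Fin N) ℂ →ₗ⁅ℂ⁆ Ugl N :=
  UniversalEnvelopingAlgebra.ι ℂ

/-- The generators `E_{ij}`; indices run over `0, …, N - 1`. -/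
def gen (N : ℕ) (i j : Fin N) : Ugl N := toU N (Matrix.single i j 1)

/-- The coproduct: the algebra morphism with `X ↦ X ⊗ 1 + 1 ⊗ X` for `X` in `gl_N`. -/
def coproduct (N : ℕ) : Ugl N →ₐ[ℂ] Ugl N ⊗[ℂ] Ugl N :=
  UniversalEnvelopingAlgebra.lift ℂ
    { toFun := fun A => toU N A ⊗ₜ[ℂ] 1 + 1 ⊗ₜ[ℂ] toU N A
      map_add' := fun A B => by
        rw [map_add, TensorProduct.add_tmul, TensorProduct.tmul_add]; abel
      map_smul' := fun c A => by
        rw [map_smul, ← TensorProduct.smul_tmul', TensorProduct.tmul_smul, RingHom.id_apply,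
          smul_add]
      map_lie' := fun {A B} => by
        rw [LieHom.map_lie]
        simp only [LieRing.of_associative_ring_bracket, mul_add, add_mul,
          Algebra.TensorProduct.tmul_mul_tmul, one_mul, mul_one, TensorProduct.sub_tmul,
          TensorProduct.tmul_sub]
        abel }

end Algebra

section State

attribute [local instance 100] LieRing.ofAssociativeRing
attribute [local instance] Matrix.linftyOpNormedRing Matrix.linftyOpNormedAlgebra

/-- The entire (holomorphic) functions on the space of complex `N × N` matrices. -/
def Hol (N : ℕ) : Submodule ℂ (Matrix (Fin N) (Fin N) ℂ → ℂ) where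
  carrier := {f | ContDiff ℂ (⊤ : ℕ∞) f}
  add_mem' {f g} hf hg := by
    have hf' : ContDiff ℂ (⊤ : ℕ∞) f := hf
    have hg' : ContDiff ℂ (⊤ : ℕ∞) g := hg
    exact hf'.add hg'
  zero_mem' := by
    have h : ContDiff ℂ (⊤ : ℕ∞) (fun _ : Matrix (Fin N) (Fin N) ℂ => (0 : ℂ)) := contDiff_const
    exact h
  smul_mem' c f hf := by
    have hf' : ContDiff ℂ (⊤ : ℕ∞) f := hf
    exact contDiff_const.smul hf'

theorem hol_contDiff {N : ℕ} (f : Hol N) : ContDiff ℂ (⊤ : ℕ∞) f.1 := f.2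

theorem hol_differentiable {N : ℕ} (f : Hol N) : Differentiable ℂ f.1 :=
  (hol_contDiff f).differentiable (by simp)

/-- The left-invariant derivation attached to `A`:
`(D_A f)(U) = d/ds f(U e^{sA})` at `s = 0`, which is the derivative of `f` at `U` along `U A`. -/
def leftDeriv (N : ℕ) (A : Matrix (Fin N) (Fin N) ℂ) : Hol N →ₗ[ℂ] Hol N where
  toFun f := ⟨fun U => fderiv ℂ f.1 U (U * A), by
    have h : ContDiff ℂ (⊤ : ℕ∞) (fun U => fderiv ℂ f.1 U (U * A)) :=
      ((hol_contDiff f).fderiv_right (m := (⊤ : ℕ∞)) (by norm_cast)).clm_apply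
        (contDiff_id.mul contDiff_const)
    exact h⟩
  map_add' f g := by
    ext U
    have hf : DifferentiableAt ℂ f.1 U := (hol_differentiable f) U
    have hg : DifferentiableAt ℂ g.1 U := (hol_differentiable g) U
    change fderiv ℂ (f.1 + g.1) U (U * A) = _
    exact DFunLike.congr_fun (fderiv_add hf hg) (U * A)
  map_smul' c f := by
    ext U
    have hf : DifferentiableAt ℂ f.1 U := (hol_differentiable f) U
    change fderiv ℂ (c • f.1) U (U * A) = _
    exact DFunLike.congr_fun (fderiv_const_smul hf c) (U * A)

/-- `leftDeriv` is indeed the derivative of `s ↦ f(U e^{sA})` at `s = 0`. -/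
theorem leftDeriv_eq_deriv (N : ℕ) (A U : Matrix (Fin N) (Fin N) ℂ) (f : Hol N) :
    (leftDeriv N A f).1 U = deriv (fun s : ℂ => f.1 (U * NormedSpace.exp (s • A))) 0 := by
  have hf : DifferentiableAt ℂ f.1 (U * NormedSpace.exp ((0 : ℂ) • A)) :=
    (hol_differentiable f) _
  have h1 : HasDerivAt (fun s : ℂ => U * NormedSpace.exp (s • A)) (U * A) 0 := by
    have := (hasDerivAt_exp_smul_const (𝕂 := ℂ) A (0 : ℂ)).const_mul U
    simp only [zero_smul, NormedSpace.exp_zero, one_mul] at this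
    exact this
  have h2 := hf.hasFDerivAt.comp_hasDerivAt (0 : ℂ) h1
  have h3 := h2.deriv
  simp only [zero_smul, NormedSpace.exp_zero, mul_one] at h3
  exact h3.symm

theorem leftDeriv_comp (N : ℕ) (A B U : Matrix (Fin N) (Fin N) ℂ) (f : Hol N) :
    (leftDeriv N A (leftDeriv N B f)).1 U =
      fderiv ℂ (fderiv ℂ f.1) U (U * A) (U * B) + fderiv ℂ f.1 U (U * A * B) := by
  have hd : DifferentiableAt ℂ (fderiv ℂ f.1) U :=
    ((hol_contDiff f).fderiv_right (m := 1) (by norm_cast)).differentiable (by simp) U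
  have hm : HasFDerivAt (fun V : Matrix (Fin N) (Fin N) ℂ => V * B)
      ((ContinuousLinearMap.mul ℂ (Matrix (Fin N) (Fin N) ℂ)).flip B) U :=
    ((ContinuousLinearMap.mul ℂ (Matrix (Fin N) (Fin N) ℂ)).flip B).hasFDerivAt
  change fderiv ℂ (fun V => fderiv ℂ f.1 V (V * B)) U (U * A) = _
  refine (DFunLike.congr_fun (hd.hasFDerivAt.clm_apply hm).fderiv (U * A)).trans ?_
  exact add_comm _ _

/-- The canonical algebra morphism `D` from `U(gl_N)` to left-invariant differential operators,
so that `D(A₁ ⋯ A_k) f (U) = ∂_{s₁} ⋯ ∂_{s_k} f(U e^{s₁A₁} ⋯ e^{s_kA_k})` at `s = 0`. -/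
def diffOp (N : ℕ) : Ugl N →ₐ[ℂ] Module.End ℂ (Hol N) :=
  UniversalEnvelopingAlgebra.lift ℂ
    { toFun := leftDeriv N
      map_add' := fun A B => by
        ext f U
        change fderiv ℂ f.1 U (U * (A + B)) = fderiv ℂ f.1 U (U * A) + fderiv ℂ f.1 U (U * B)
        rw [mul_add, map_add]
      map_smul' := fun c A => by
        ext f U
        change fderiv ℂ f.1 U (U * (c • A)) = c • fderiv ℂ f.1 U (U * A)
        rw [mul_smul_comm, map_smul]
      map_lie' := fun {A B} => by
        ext f U
        have hs : fderiv ℂ (fderiv ℂ f.1) U (U * A) (U * B) =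
            fderiv ℂ (fderiv ℂ f.1) U (U * B) (U * A) :=
          ((hol_contDiff f).contDiffAt.isSymmSndFDerivAt
            (by simp only [minSmoothness_of_isRCLikeNormedField]; norm_cast)).eq _ _
        rw [LieRing.of_associative_ring_bracket, LieRing.of_associative_ring_bracket]
        change fderiv ℂ f.1 U (U * (A * B - B * A)) =
          (leftDeriv N A (leftDeriv N B f)).1 U - (leftDeriv N B (leftDeriv N A f)).1 U
        rw [leftDeriv_comp, leftDeriv_comp, hs, mul_sub, map_sub,
          ← mul_assoc, ← mul_assoc]
        ring }

/-- The function `κ_t(U) = exp(t Tr(U - Id))`. -/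
def kappa (N : ℕ) (t : ℝ) : Hol N :=
  ⟨fun U => Complex.exp (t * (U - 1).trace), by
    have h : ContDiff ℂ (⊤ : ℕ∞) (fun U : Matrix (Fin N) (Fin N) ℂ => U.trace) :=
      (LinearMap.toContinuousLinearMap (Matrix.traceLinearMap (Fin N) ℂ ℂ)).contDiff
    exact (contDiff_const.mul (h.comp (contDiff_id.sub contDiff_const))).cexp⟩

/-- The state `⟨X⟩_t = (D(X) κ_t)(Id)`. -/
def state (N : ℕ) (t : ℝ) : Ugl N →ₗ[ℂ] ℂ where
  toFun X := (diffOp N X (kappa N t)).1 1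
  map_add' X Y := by rw [map_add]; rfl
  map_smul' c X := by rw [map_smul]; rfl

end State

/-- The Markov operator `P_t = (id ⊗ ⟨·⟩_t) ∘ Δ` on `U(gl_N)`. -/
def markov (N : ℕ) (t : ℝ) : Ugl N →ₗ[ℂ] Ugl N :=
  (TensorProduct.rid ℂ (Ugl N)).toLinearMap ∘ₗ
    (state N t).lTensor (Ugl N) ∘ₗ (coproduct N).toLinearMap

/-- The closed paths `v 0 → v 1 → ⋯ → v k` of length `k` from the vertex `m` to itself
whose vertices are all at most `m`. -/
def paths {N : ℕ} (k : ℕ) (m : Fin N) : Finset (Fin (k + 1) → Fin N) :=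
  Finset.univ.filter fun v => v 0 = m ∧ v (Fin.last k) = m ∧ ∀ i, v i ≤ m

/-- The length of the first return of a path to its starting point. -/
def firstReturn {N k : ℕ} (v : Fin (k + 1) → Fin N) : ℕ :=
  sInf {j : ℕ | 1 ≤ j ∧ ∃ h : j < k + 1, v ⟨j, h⟩ = v 0}

/-- The label of the edge `(i, j)` of a path based at `m`: it is `E_{ij}` if `i ≠ j`, and
`E_{ii} - m` if `i = j` (that is, `E_{ii} - m + 1` when vertices are numbered from `1`). -/
def edge {N : ℕ} (m i j : Fin N) : Ugl N :=
  if i = j then gen N i i - algebraMap ℂ (Ugl N) ((m : ℕ) : ℂ) else gen N i j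

/-- The element `E(π)`: the first return length times the ordered product of the labels. -/
def pathElem {N k : ℕ} (v : Fin (k + 1) → Fin N) : Ugl N :=
  (firstReturn v : ℂ) • (List.ofFn fun i : Fin k => edge (v 0) (v i.castSucc) (v i.succ)).prod

/-- The element `Ψ_k` of `U(gl_N)` (for `k ≥ 1`). -/
def psi (N k : ℕ) : Ugl N := ∑ m : Fin N, ∑ v ∈ paths k m, pathElem v

/-- The element `Ψ_ρ = Ψ_{ρ₁} ⋯ Ψ_{ρ_l}`, for the parts `ρ₁ ≥ ⋯ ≥ ρ_l` of the partition `ρ`. -/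
def psiPart (N : ℕ) {n : ℕ} (ρ : n.Partition) : Ugl N :=
  ((ρ.parts.sort (· ≥ ·)).map (psi N)).prod

/-- The weight `|ρ| + l(ρ)` of a partition. -/
def wt {n : ℕ} (ρ : n.Partition) : ℕ := n + ρ.parts.card

/-- The covariance `⟨(X - ⟨X⟩_t) (Y - ⟨Y⟩_t)⟩_t`. -/
def cov (N : ℕ) (t : ℝ) (X Y : Ugl N) : ℂ :=
  state N t ((X - algebraMap ℂ (Ugl N) (state N t X)) *
    (Y - algebraMap ℂ (Ugl N) (state N t Y)))

end GLWalk

end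

/-!
The expectations of products of the `Ψ_k` are computed by an explicit "symbolic" semigroup acting on
polynomials in commuting variables, for which the powers of `L` can be read off from a grading.

*The state as an exponential.* Let `δ = (id ⊗ π) ∘ Δ : U(gl_N) → Mat_N(U(gl_N))` (`delta`), where `π`
is the natural representation, and let `G X = Tr δ(X) - N X` (`genOp`). Differentiating
`exp (t Tr (U - Id))` gives `⟨X A⟩_t = t ⟨Tr (δ(X) A)⟩_t` for `A` in `gl_N` (`isStateRec_state`), and
this recursion is solved by the finite sums `⟨X⟩_t = ∑ t ^ n / n! ε(G ^ n X)`, where `ε` is the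
counit. Similarly `P_t = ∑ t ^ n / n! G ^ n` (`exists_state_eq_sum`, `exists_markov_eq_sum`).

*The action of `G` on the `Ψ_k`.* Let `Ω` be the transpose of the matrix `E` of generators, and `F` the
generating series of the traces of the powers of `Ω`. The resolvents of `E - N` and of `Ω` are
proportional (`resolvent_eq_mul`), and cutting a matrix down to its corners expresses the first-return
sums over paths by the logarithmic derivative of `F`. The result is `euler_traceSeries_genMat`: the
Euler derivative of `F` is `F` times the difference of `Ψ = N + ∑ Ψ_k u ^ k` and its binomial transform,
a unit translation in the variable `1 / u`. Hence the `Ψ_k` are central, the traces of the powers of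
`Ω` are polynomials in them, and comparing with `δ(F)`, which is known from the resolvents, yields
`δ(Ψ_k) = Ψ_k + (Ω + 1) ^ k - Ω ^ k` (`delta_psiExt`).

*Weights.* So `G` is given by an operator `symbGen` on polynomials in symbols `X k` for `Ψ_k`, where
`X 0` stands for `N`. Give `X k` the weight `k + 1` and the time the weight one. The operator lowers the
weight by one, its carré du champ by three, and the next defect by five. Therefore covariances lower
the weight by two (`symbCov_mem_polyFilt`), and the covariance is a derivation in each variable up to
terms which lower it by four (`symbCum_mem_polyFilt`). The counit takes `Ψ_k` to
`∑_{m < N} (-m) ^ k`, so a polynomial of weight at most `d`, divided by `L ^ d`, has a limit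
(`tendsto_timeVal`).

*Conclusion.* Expectations are asymptotically multiplicative, so the order of `⟨Ψ_ρ⟩` reduces to the
limit `profile k` of the normalized `⟨Ψ_k⟩`. Since `G` preserves sums of products of generators, the
coefficients of `⟨Ψ_k⟩_t` in positive degree are nonnegative, and that of `t ^ k` is at least `N`. So
the profile is strictly increasing: it is positive for even `k`, and has at most one zero for odd `k`.
The expansion of `P_t Ψ_k` is read off from the weights (`exists_markov_psi_eq_sum`), and the
derivation property reduces covariances with `P_t Ψ_k` to those with the `Ψ_j`
(`exists_tendsto_symbCov`).
-/

noncomputable section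

namespace GLWalk

/-! ### Resolvents of covariant and contravariant matrices -/

section Resolvent

variable {ι B : Type*} [Fintype ι] [DecidableEq ι] [Ring B]

theorem scalar_mul_apply' (a : B) (M : Matrix ι ι B) (i j : ι) :
    (Matrix.scalar ι a * M) i j = a * M i j := by simp

theorem mul_scalar_apply' (a : B) (M : Matrix ι ι B) (i j : ι) :
    (M * Matrix.scalar ι a) i j = M i j * a := by simp

theorem single_one_mul_apply (M : Matrix ι ι B) (i j k l : ι) :
    (Matrix.single i j (1 : B) * M) k l = if i = k then M j l else 0 := by
  rw [Matrix.mul_apply]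
  simp only [Matrix.single_apply, ite_mul, one_mul, zero_mul]
  split_ifs with h <;> simp [h]

theorem mul_single_one_apply (M : Matrix ι ι B) (i j k l : ι) :
    (M * Matrix.single i j (1 : B)) k l = if j = l then M k i else 0 := by
  rw [Matrix.mul_apply]
  simp only [Matrix.single_apply, mul_ite, mul_one, mul_zero]
  split_ifs with h <;> simp [h]

/-- `M` transforms under the adjoint action of the `E i j` like the matrix of the generators of
`gl`. -/
def Covariant (E M : Matrix ι ι B) : Prop :=
  ∀ i j k l, E i j * M k l - M k l * E i j =
    (if j = k then M i l else 0) - (if i = l then M k j else 0)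

/-- `M` transforms under the adjoint action of the `E i j` like the transpose of the matrix of the
generators of `gl`. -/
def Contravariant (E M : Matrix ι ι B) : Prop :=
  ∀ i j k l, E i j * M k l - M k l * E i j =
    (if j = l then M k i else 0) - (if i = k then M j l else 0)

theorem covariant_iff {E M : Matrix ι ι B} :
    Covariant E M ↔ ∀ i j, Commute (Matrix.scalar ι (E i j) - Matrix.single j i 1) M := by
  refine forall₂_congr fun i j => ?_
  rw [commute_iff_eq, sub_mul, mul_sub, sub_eq_sub_iff_sub_eq_sub, ← Matrix.ext_iff]
  refine forall₂_congr fun k l => ?_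
  rw [Matrix.sub_apply, Matrix.sub_apply, scalar_mul_apply', mul_scalar_apply',
    single_one_mul_apply, mul_single_one_apply]

theorem contravariant_iff {E M : Matrix ι ι B} :
    Contravariant E M ↔ ∀ i j, Commute (Matrix.scalar ι (E i j) + Matrix.single i j 1) M := by
  refine forall₂_congr fun i j => ?_
  have : ∀ a b c d : Matrix ι ι B, a + b = c + d ↔ a - c = d - b := fun a b c d =>
    ⟨fun h => by rw [sub_eq_iff_eq_add, sub_add_eq_add_sub, add_comm d, ← h]; abel,
      fun h => by rw [sub_eq_iff_eq_add] at h; rw [h]; abel⟩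
  rw [commute_iff_eq, add_mul, mul_add, this, ← Matrix.ext_iff]
  refine forall₂_congr fun k l => ?_
  rw [Matrix.sub_apply, Matrix.sub_apply, scalar_mul_apply', mul_scalar_apply',
    single_one_mul_apply, mul_single_one_apply]

omit [Fintype ι] in
theorem Covariant.transpose {E M : Matrix ι ι B} (h : Covariant E M) :
    Contravariant E M.transpose := fun i j k l => h i j l k

theorem commute_inverse {R : Type*} [Ring R] {s W V : R} (h1 : W * V = 1) (h2 : V * W = 1)
    (h : Commute s W) : Commute s V := by
  have : s * V = V * (W * s) * V := by rw [← mul_assoc, h2, one_mul]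
  rw [commute_iff_eq, this, ← h.eq, mul_assoc, mul_assoc, h1, mul_one]

/-- The matrix `1 + c u - u E`, which is `u` times `y + c - E` for `y = 1 / u`. -/
def shiftMat (u : B) (c : ℕ) (E : Matrix ι ι B) : Matrix ι ι B :=
  Matrix.scalar ι (1 + c * u) - Matrix.scalar ι u * E

theorem shiftMat_apply (u : B) (c : ℕ) (E : Matrix ι ι B) (i j : ι) :
    shiftMat u c E i j = (if i = j then 1 + c * u else 0) - u * E i j := by
  simp [shiftMat, Matrix.diagonal_apply]

theorem shiftMat_mul_apply (u : B) (c : ℕ) (E M : Matrix ι ι B) (i k : ι) :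
    (shiftMat u c E * M) i k = (1 + c * u) * M i k - u * ∑ j, E i j * M j k := by
  simp [Matrix.mul_apply, shiftMat_apply, sub_mul, Finset.mul_sum, mul_assoc]

theorem mul_shiftMat_apply {u : B} (hu : ∀ b, Commute u b) (c : ℕ) (E M : Matrix ι ι B)
    (i k : ι) :
    (M * shiftMat u c E) i k = (1 + c * u) * M i k - u * ∑ j, M i j * E j k := by
  have hc : Commute (1 + c * u) (M i k) :=
    ((Commute.one_left _).add_left ((Nat.cast_commute c _).mul_left (hu _)))
  have h2 : ∀ j, M i j * (u * E j k) = u * (M i j * E j k) := fun j => by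
    rw [← mul_assoc, ← (hu (M i j)).eq, mul_assoc]
  simp [Matrix.mul_apply, shiftMat_apply, mul_sub, Finset.mul_sum, h2, hc.eq]

theorem commute_shiftMat {u : B} (hu : ∀ b, Commute u b) (c : ℕ) {E s : Matrix ι ι B}
    (h : Commute s E) : Commute s (shiftMat u c E) := by
  have h1 : Commute s (Matrix.scalar ι u) := (Matrix.scalar_commute u hu s).symm
  have h2 : Commute s (Matrix.scalar ι (1 + c * u)) :=
    (Matrix.scalar_commute _ (fun b =>
      (Commute.one_left b).add_left ((Nat.cast_commute c b).mul_left (hu b))) s).symm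
  exact h2.sub_right (h1.mul_right h)

theorem Covariant.inverse {u : B} (hu : ∀ b, Commute u b) {c : ℕ} {E R : Matrix ι ι B}
    (hE : Covariant E E) (h1 : shiftMat u c E * R = 1) (h2 : R * shiftMat u c E = 1) :
    Covariant E R :=
  covariant_iff.2 fun i j =>
    commute_inverse h1 h2 (commute_shiftMat hu c (covariant_iff.1 hE i j))

theorem Covariant.inverse_transpose {u : B} (hu : ∀ b, Commute u b) {c : ℕ} {E R : Matrix ι ι B}
    (hE : Covariant E E) (h1 : shiftMat u c E.transpose * R = 1)
    (h2 : R * shiftMat u c E.transpose = 1) : Contravariant E R :=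
  contravariant_iff.2 fun i j =>
    commute_inverse h1 h2 (commute_shiftMat hu c (contravariant_iff.1 hE.transpose i j))

theorem Covariant.commute_trace {E R : Matrix ι ι B} (h : Covariant E R) (i j : ι) :
    Commute (E i j) R.trace := by
  rw [commute_iff_eq, ← sub_eq_zero, Matrix.trace, Finset.mul_sum, Finset.sum_mul,
    ← Finset.sum_sub_distrib]
  simp [h i j]

/-- If `f` commutes with the generators, it commutes with the entries of a resolvent. -/
theorem commute_resolvent {u f : B} (hu : ∀ b, Commute u b) {c : ℕ} {E R : Matrix ι ι B}
    (h1 : shiftMat u c E * R = 1) (h2 : R * shiftMat u c E = 1)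
    (hf : ∀ i j, Commute f (E i j)) (i j : ι) : Commute f (R i j) := by
  have h : Commute (Matrix.scalar ι f) E := by
    rw [commute_iff_eq]; ext i j; simpa using (hf i j).eq
  have := commute_inverse h1 h2 (commute_shiftMat hu c h)
  have := congrFun (congrFun this.eq i) j
  simpa [commute_iff_eq] using this

/-- The two resolvents of the matrix of generators and of its transpose are proportional. -/
theorem resolvent_eq_mul {u : B} (hu : ∀ b, Commute u b) {E R Q : Matrix ι ι B}
    (hE : Covariant E E)
    (h1 : shiftMat u (Fintype.card ι) E * R = 1) (h2 : R * shiftMat u (Fintype.card ι) E = 1)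
    (q2 : Q * shiftMat u 0 E.transpose = 1) (k l : ι) :
    R l k = Q k l * (1 - u * R.trace) := by
  have hR := hE.inverse hu h1 h2
  -- Covariance of `R` moves `E j k` to the right of `R`, where `R` is an inverse; the commutators
  -- add up to the shift by `card ι` and to the trace.
  have key : shiftMat u 0 E.transpose * R.transpose = Matrix.scalar ι (1 - u * R.trace) := by
    ext k l
    rw [shiftMat_mul_apply]
    have e1 : ∀ j, E.transpose k j * R.transpose j l =
        R l j * E j k + ((if k = l then R j j else 0) - R l k) := fun j => by
      have := hR j k l j
      simp only [if_true, sub_eq_iff_eq_add] at this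
      simp only [Matrix.transpose_apply, this]
      abel
    have e2 := congrFun (congrFun h2 l) k
    rw [mul_shiftMat_apply hu] at e2
    have e3 : u * ∑ j, R l j * E j k = (1 + Fintype.card ι * u) * R l k -
        (1 : Matrix ι ι B) l k := by rw [← e2]; abel
    simp only [e1, Finset.sum_add_distrib, mul_add, e3, Finset.sum_sub_distrib, mul_sub]
    have e4 : u * ((Fintype.card ι : B) * R l k) = Fintype.card ι * u * R l k := by
      rw [← mul_assoc, (hu (Fintype.card ι : B)).eq]
    by_cases h : k = l
    · subst h
      simp [Matrix.trace, add_mul, e4]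
      abel
    · simp [h, Ne.symm h, add_mul, e4]
  have : R.transpose = Q * Matrix.scalar ι (1 - u * R.trace) := by
    rw [← key, ← mul_assoc, q2, one_mul]
  have := congrFun (congrFun this k) l
  simpa using this

/-- `1 - u Tr R` and `1 + u Tr Q` are inverse to each other. -/
theorem trace_resolvent_mul {u : B} (hu : ∀ b, Commute u b) {E R Q : Matrix ι ι B}
    (hE : Covariant E E)
    (h1 : shiftMat u (Fintype.card ι) E * R = 1) (h2 : R * shiftMat u (Fintype.card ι) E = 1)
    (q2 : Q * shiftMat u 0 E.transpose = 1) :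
    (1 + u * Q.trace) * (1 - u * R.trace) = 1 := by
  have : R.trace = Q.trace * (1 - u * R.trace) := by
    simp only [Matrix.trace, Matrix.diag_apply, Finset.sum_mul]
    exact Finset.sum_congr rfl fun i _ => resolvent_eq_mul hu hE h1 h2 q2 i i
  rw [add_mul, one_mul, mul_assoc, ← this]
  abel

/-- Effect on `1 - u Tr R` of a ring morphism that translates the generators by matrix units: the
resolvent undergoes a rank one perturbation. -/
theorem map_trace_resolvent {u F : B} (hu : ∀ b, Commute u b) {E R Q : Matrix ι ι B}
    (hE : Covariant E E)
    (h1 : shiftMat u (Fintype.card ι) E * R = 1) (h2 : R * shiftMat u (Fintype.card ι) E = 1)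
    (q1 : shiftMat u 0 E.transpose * Q = 1)
    (q2 : Q * shiftMat u 0 E.transpose = 1) (hF : F * (1 - u * R.trace) = 1)
    (hFE : ∀ i j, Commute F (E i j))
    (δ : B →+* Matrix ι ι B) (hδu : δ u = Matrix.scalar ι u)
    (hδE : ∀ i j, δ (E i j) = Matrix.scalar ι (E i j) + Matrix.single i j 1) :
    δ (1 - u * R.trace) =
      Matrix.scalar ι (1 - u * R.trace) * (1 - Matrix.scalar ι u * Matrix.scalar ι u * (Q * Q)) := by
  set f := 1 - u * R.trace with hf
  have hR := hE.inverse hu h1 h2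
  have hfE : ∀ i j, Commute f (E i j) := fun i j =>
    (Commute.one_left _).sub_left ((hu _).mul_left (hR.commute_trace i j).symm)
  have hfQ : ∀ i j, Commute f (Q i j) := fun i j =>
    commute_resolvent hu q1 q2 (fun i j => hfE j i) i j
  have hFR : ∀ i j, Commute F (R i j) := commute_resolvent hu h1 h2 hFE
  have hRQ : ∀ k l, R l k = Q k l * f := resolvent_eq_mul hu hE h1 h2 q2
  -- The candidate for the image of `R`, given by the formula for the inverse of a rank one
  -- perturbation of `W`.
  set K : Matrix ι ι (Matrix ι ι B) := Matrix.of fun j k =>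
    Matrix.of fun a b => (if a = b then R j k else 0) + u * (F * (R j a * R b k)) with hK
  have hKa : ∀ j k a b, K j k a b =
      (if a = b then R j k else 0) + u * (F * (R j a * R b k)) := fun _ _ _ _ => rfl
  set W := shiftMat u (Fintype.card ι) E with hW
  have hcu : ∀ b, Commute (1 + Fintype.card ι * u) b := fun b =>
      (Commute.one_left b).add_left ((Nat.cast_commute _ b).mul_left (hu b))
  have hWδ : ∀ i j, δ (W i j) =
      Matrix.scalar ι (W i j) - Matrix.scalar ι u * Matrix.single i j 1 := fun i j => by
    rw [hW, shiftMat_apply, map_sub, map_mul, hδu, hδE]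
    have : δ (if i = j then 1 + Fintype.card ι * u else 0) =
        Matrix.scalar ι (if i = j then 1 + Fintype.card ι * u else 0) := by
      split_ifs
      · rw [map_add, map_one, map_mul, map_natCast, hδu, map_add, map_one, map_mul, map_natCast]
      · rw [map_zero, map_zero]
    rw [this, map_sub, map_mul, mul_add]
    abel
  -- `δ R` is the two-sided inverse of `δ W`, so a right inverse of `δ W` must be equal to it.
  have hWK : (W.map δ) * K = 1 := by
    ext i k a b
    have e1 : ((W.map δ) * K) i k a b = ∑ j, ((W i j) * K j k a b -
        u * (if i = a then K j k j b else 0)) := by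
      rw [Matrix.mul_apply, Matrix.sum_apply]
      refine Finset.sum_congr rfl fun j _ => ?_
      rw [Matrix.map_apply, hWδ, sub_mul, Matrix.sub_apply, mul_assoc]
      rw [scalar_mul_apply', scalar_mul_apply', single_one_mul_apply]
    have e2 : ∀ m : ι, ∑ j, W i j * R j m = if i = m then 1 else 0 := fun m => by
      rw [← Matrix.mul_apply, h1, Matrix.one_apply]
    have e3 : ∑ j, W i j * K j k a b = (if a = b then (if i = k then 1 else 0) else 0) +
        u * (F * ((if i = a then 1 else 0) * R b k)) := by
      simp only [hKa, mul_add, Finset.sum_add_distrib]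
      congr 1
      · by_cases hab : a = b
        · simp only [hab, if_true, e2]
        · simp only [hab, if_false, mul_zero, Finset.sum_const_zero]
      · rw [← e2, Finset.sum_mul, Finset.mul_sum, Finset.mul_sum]
        refine Finset.sum_congr rfl fun j _ => ?_
        have hFW : Commute F (W i j) := by
          rw [hW, shiftMat_apply]
          refine Commute.sub_right ?_ ((hu F).symm.mul_right (hFE i j))
          split_ifs
          · exact (hcu F).symm
          · exact Commute.zero_right _
        rw [← mul_assoc (W i j), ← (hu (W i j)).eq, mul_assoc u, ← mul_assoc (W i j) F,
          ← hFW.eq, mul_assoc F, mul_assoc (W i j)]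
    have e4 : ∑ j, K j k j b = R b k + u * (F * (R.trace * R b k)) := by
      simp only [hKa, Finset.sum_add_distrib, Matrix.trace, Matrix.diag_apply,
        Finset.sum_mul, Finset.mul_sum, Finset.sum_ite_eq', Finset.mem_univ, if_true]
    have e5 : (1 : Matrix ι ι (Matrix ι ι B)) i k a b =
        if a = b then (if i = k then 1 else 0) else 0 := by
      rw [Matrix.one_apply]
      by_cases hik : i = k
      · simp only [hik, if_true, Matrix.one_apply]
      · simp only [hik, if_false, Matrix.zero_apply, ite_self]
    rw [e1, Finset.sum_sub_distrib, e3, e5]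
    by_cases hia : i = a
    · subst hia
      simp only [if_true, ← Finset.mul_sum, e4, one_mul]
      have : F * R b k - R b k - u * (F * (R.trace * R b k)) = 0 := by
        have h5 : F * f * R b k = R b k := by rw [hF, one_mul]
        rw [hf, mul_sub, mul_one, sub_mul, ← mul_assoc F u, ← (hu F).eq] at h5
        simp only [mul_assoc] at h5
        rw [sub_right_comm, h5, sub_self]
      have h6 : u * (F * R b k) - u * (R b k + u * (F * (R.trace * R b k))) = 0 := by
        rw [← mul_sub, ← sub_sub, this, mul_zero]
      rw [add_sub_assoc, h6, add_zero]
    · simp only [hia, if_false, zero_mul, mul_zero, add_zero, Finset.sum_const_zero, sub_zero]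
  have hRK : R.map δ = K := by
    have : R.map δ * W.map δ = 1 := by
      rw [← Matrix.map_mul, h2, Matrix.map_one _ (map_zero δ) (map_one δ)]
    calc R.map δ = R.map δ * (W.map δ * K) := by rw [hWK, mul_one]
      _ = K := by rw [← mul_assoc, this, one_mul]
  have hδR : ∀ i, δ (R i i) = K i i := fun i => congrFun (congrFun hRK i) i
  have htr : δ R.trace = Matrix.scalar ι R.trace + Matrix.scalar ι (u * f) * (Q * Q) := by
    rw [Matrix.trace, map_sum]
    ext a b
    rw [Matrix.sum_apply, Matrix.add_apply]
    simp only [Matrix.diag_apply, hδR, hKa, Finset.sum_add_distrib]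
    congr 1
    · rw [Matrix.scalar_apply, Matrix.diagonal_apply]
      by_cases hab : a = b
      · simp only [hab, if_true]
      · simp only [hab, if_false, Finset.sum_const_zero]
    -- The rank one term becomes a square, since `R` is the transpose of `Q` times `f`.
    · have : ∀ x, u * (F * (R x a * R b x)) = u * f * (Q a x * Q x b) := fun x => by
        rw [hRQ, hRQ, mul_assoc (Q a x), ← mul_assoc f, (hfQ x b).eq, ← mul_assoc (Q a x),
          ← mul_assoc (Q a x), mul_assoc (Q a x * Q x b)]
        have h7 : Commute (f * f) (Q a x * Q x b) :=
          (((hfQ a x).mul_right (hfQ x b)).mul_left ((hfQ a x).mul_right (hfQ x b)))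
        rw [← h7.eq, mul_assoc f, ← mul_assoc F, hF, one_mul, mul_assoc]
      rw [scalar_mul_apply', Matrix.mul_apply, Finset.mul_sum]
      exact Finset.sum_congr rfl fun x _ => this x
  have h8 : Matrix.scalar ι f * (Matrix.scalar ι u * Matrix.scalar ι u * (Q * Q)) =
      Matrix.scalar ι u * (Matrix.scalar ι (u * f) * (Q * Q)) := by
    have : f * (u * u) = u * (u * f) := by
      rw [← mul_assoc, ← (hu f).eq, mul_assoc, ← (hu f).eq]
    rw [← map_mul, ← mul_assoc, ← map_mul, this, map_mul, mul_assoc]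
  have h9 : Matrix.scalar ι f = 1 - Matrix.scalar ι u * Matrix.scalar ι R.trace := by
    rw [hf, map_sub, map_one, map_mul]
  calc δ f = 1 - Matrix.scalar ι u * δ R.trace := by
        rw [hf, map_sub, map_one, map_mul, hδu]
    _ = Matrix.scalar ι f - Matrix.scalar ι u * (Matrix.scalar ι (u * f) * (Q * Q)) := by
        rw [htr, mul_add, ← sub_sub, h9]
    _ = _ := by rw [mul_sub (Matrix.scalar ι f), mul_one (Matrix.scalar ι f), h8]

end Resolvent

/-! ### Resolvents of a matrix and of its corner -/

section Branching

open Matrix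

variable {B : Type*} [Ring B] {n : ℕ}

/-- The Schur complement of the upper left block of `W`, where `V` stands for the inverse of that
block. -/
def schur (W : Matrix (Fin (n + 1)) (Fin (n + 1)) B) (V : Matrix (Fin n) (Fin n) B) : B :=
  W (Fin.last n) (Fin.last n) -
    ∑ i, W (Fin.last n) (Fin.castSucc i) * ∑ j, V i j * W (Fin.castSucc j) (Fin.last n)

/-- The last diagonal entry of an inverse is the inverse of the Schur complement. -/
theorem schur_mul {W R : Matrix (Fin (n + 1)) (Fin (n + 1)) B} {V : Matrix (Fin n) (Fin n) B}
    (hV : V * W.submatrix Fin.castSucc Fin.castSucc = 1) (hR : W * R = 1) :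
    schur W V * R (Fin.last n) (Fin.last n) = 1 := by
  have e1 : ∀ i : Fin n, ∑ j, W (Fin.castSucc i) (Fin.castSucc j) * R (Fin.castSucc j) (Fin.last n)
      = - (W (Fin.castSucc i) (Fin.last n) * R (Fin.last n) (Fin.last n)) := fun i => by
    have := congrFun (congrFun hR (Fin.castSucc i)) (Fin.last n)
    rw [Matrix.mul_apply, Fin.sum_univ_castSucc,
      Matrix.one_apply_ne (Fin.castSucc_lt_last i).ne] at this
    exact eq_neg_of_add_eq_zero_left this
  have e2 : ∀ i : Fin n, R (Fin.castSucc i) (Fin.last n) =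
      - ((∑ j, V i j * W (Fin.castSucc j) (Fin.last n)) * R (Fin.last n) (Fin.last n)) := fun i => by
    have h : (V * W.submatrix Fin.castSucc Fin.castSucc) *ᵥ
        (fun j => R (Fin.castSucc j) (Fin.last n)) = fun j => R (Fin.castSucc j) (Fin.last n) := by
      rw [hV, Matrix.one_mulVec]
    rw [← Matrix.mulVec_mulVec] at h
    rw [← congrFun h i, Finset.sum_mul, ← Finset.sum_neg_distrib, Matrix.mulVec, dotProduct]
    refine Finset.sum_congr rfl fun j _ => ?_
    rw [mul_assoc, ← mul_neg, ← e1]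
    rfl
  have e3 := congrFun (congrFun hR (Fin.last n)) (Fin.last n)
  rw [Matrix.mul_apply, Fin.sum_univ_castSucc, Matrix.one_apply_eq] at e3
  rw [schur, sub_mul, ← e3, Finset.sum_mul, sub_eq_add_neg, ← Finset.sum_neg_distrib, add_comm]
  congr 1
  refine Finset.sum_congr rfl fun j _ => ?_
  rw [e2, mul_neg, mul_assoc]

theorem mul_schur {W R : Matrix (Fin (n + 1)) (Fin (n + 1)) B} {V : Matrix (Fin n) (Fin n) B}
    (hV : W.submatrix Fin.castSucc Fin.castSucc * V = 1) (hR : R * W = 1) :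
    R (Fin.last n) (Fin.last n) * schur W V = 1 := by
  have e1 : ∀ i : Fin n, ∑ j, R (Fin.last n) (Fin.castSucc j) * W (Fin.castSucc j) (Fin.castSucc i)
      = - (R (Fin.last n) (Fin.last n) * W (Fin.last n) (Fin.castSucc i)) := fun i => by
    have := congrFun (congrFun hR (Fin.last n)) (Fin.castSucc i)
    rw [Matrix.mul_apply, Fin.sum_univ_castSucc,
      Matrix.one_apply_ne (Fin.castSucc_lt_last i).ne'] at this
    exact eq_neg_of_add_eq_zero_left this
  have e2 : ∀ i : Fin n, R (Fin.last n) (Fin.castSucc i) =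
      - (R (Fin.last n) (Fin.last n) * ∑ j, W (Fin.last n) (Fin.castSucc j) * V j i) := fun i => by
    have h : (fun j => R (Fin.last n) (Fin.castSucc j)) ᵥ*
        (W.submatrix Fin.castSucc Fin.castSucc * V) =
          fun j => R (Fin.last n) (Fin.castSucc j) := by
      rw [hV, Matrix.vecMul_one]
    rw [← Matrix.vecMul_vecMul] at h
    rw [← congrFun h i, Finset.mul_sum, ← Finset.sum_neg_distrib, Matrix.vecMul, dotProduct]
    refine Finset.sum_congr rfl fun j _ => ?_
    rw [← mul_assoc, ← neg_mul, ← e1]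
    rfl
  have e3 := congrFun (congrFun hR (Fin.last n)) (Fin.last n)
  rw [Matrix.mul_apply, Fin.sum_univ_castSucc, Matrix.one_apply_eq] at e3
  have e4 : ∑ i, W (Fin.last n) (Fin.castSucc i) * ∑ j, V i j * W (Fin.castSucc j) (Fin.last n) =
      ∑ j, (∑ i, W (Fin.last n) (Fin.castSucc i) * V i j) * W (Fin.castSucc j) (Fin.last n) := by
    simp only [Finset.mul_sum, Finset.sum_mul, mul_assoc]
    exact Finset.sum_comm
  rw [schur, e4, mul_sub, ← e3, Finset.mul_sum, sub_eq_add_neg, ← Finset.sum_neg_distrib, add_comm]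
  congr 1
  refine Finset.sum_congr rfl fun j _ => ?_
  rw [e2, neg_mul, mul_assoc]

theorem shiftMat_submatrix (u : B) (c : ℕ) (E : Matrix (Fin (n + 1)) (Fin (n + 1)) B) :
    (shiftMat u c E).submatrix Fin.castSucc Fin.castSucc =
      shiftMat u c (E.submatrix Fin.castSucc Fin.castSucc) := by
  ext i j
  simp [shiftMat_apply]

theorem Covariant.submatrix {E : Matrix (Fin (n + 1)) (Fin (n + 1)) B} (hE : Covariant E E) :
    Covariant (E.submatrix Fin.castSucc Fin.castSucc)
      (E.submatrix Fin.castSucc Fin.castSucc) := fun i j k l => by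
  simpa using hE i.castSucc j.castSucc k.castSucc l.castSucc

/-- Comparison of the Schur complements of the matrix of generators and of its transpose. -/
theorem schur_transpose {u : B} (hu : ∀ b, Commute u b)
    {E : Matrix (Fin (n + 1)) (Fin (n + 1)) B} (hE : Covariant E E)
    {V Q : Matrix (Fin n) (Fin n) B}
    (v1 : shiftMat u n (E.submatrix Fin.castSucc Fin.castSucc) * V = 1)
    (v2 : V * shiftMat u n (E.submatrix Fin.castSucc Fin.castSucc) = 1)
    (q1 : shiftMat u 0 (E.submatrix Fin.castSucc Fin.castSucc).transpose * Q = 1)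
    (q2 : Q * shiftMat u 0 (E.submatrix Fin.castSucc Fin.castSucc).transpose = 1) :
    schur (shiftMat u 0 E.transpose) Q = (1 - u * V.trace) * schur (shiftMat u n E) V := by
  set E' := E.submatrix Fin.castSucc Fin.castSucc with hE'
  have hE'' : Covariant E' E' := hE.submatrix
  have hV : Covariant E' V := hE''.inverse hu v1 v2
  have hQ : Contravariant E' Q := hE''.inverse_transpose hu q1 q2
  -- The blocks of the last column and row of `E`.
  set b : Fin n → B := fun i => E i.castSucc (Fin.last n) with hb
  set c : Fin n → B := fun i => E (Fin.last n) i.castSucc with hc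
  set d : B := E (Fin.last n) (Fin.last n) with hd
  have hlast : ∀ i : Fin n, Fin.last n ≠ i.castSucc := fun i => (Fin.castSucc_lt_last i).ne'
  have hlast' : ∀ i : Fin n, i.castSucc ≠ Fin.last n := fun i => (Fin.castSucc_lt_last i).ne
  have comb : ∀ k l i, E' k l * b i = b i * E' k l + if l = i then b k else 0 := fun k l i => by
    have := hE k.castSucc l.castSucc i.castSucc (Fin.last n)
    simp only [Fin.castSucc_inj, hlast', if_false, sub_zero] at this
    rw [sub_eq_iff_eq_add, add_comm] at this
    exact this
  have comc : ∀ k l i, E' k l * c i = c i * E' k l - if k = i then c l else 0 := fun k l i => by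
    have := hE k.castSucc l.castSucc (Fin.last n) i.castSucc
    simp only [Fin.castSucc_inj, hlast', if_false, zero_sub] at this
    rw [sub_eq_iff_eq_add, neg_add_eq_sub] at this
    exact this
  have bc : ∀ i j, b i * c j = c j * b i + (E' i j - if i = j then d else 0) := fun i j => by
    have := hE i.castSucc (Fin.last n) (Fin.last n) j.castSucc
    simp only [Fin.castSucc_inj, if_true] at this
    rw [sub_eq_iff_eq_add, add_comm] at this
    exact this
  set g : Fin n → B := fun j => ∑ i, V j i * b i with hg
  have comg : ∀ k j, E' k j * g j = g j * E' k j + g k := fun k j => by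
    have : ∀ i, E' k j * (V j i * b i) = V j i * b i * E' k j +
        (V k i * b i - (if k = i then V j j * b i else 0)) + (if j = i then V j i * b k else 0) := by
      intro i
      have h1 := hV k j j i
      rw [if_pos rfl, sub_eq_iff_eq_add] at h1
      rw [← mul_assoc, h1, add_mul, sub_mul, mul_assoc (V j i) (E' k j), comb, mul_add,
        ← mul_assoc (V j i)]
      simp only [ite_mul, zero_mul, mul_ite, mul_zero]
      abel
    simp only [hg, Finset.mul_sum, Finset.sum_mul, this, Finset.sum_add_distrib,
      Finset.sum_sub_distrib, Finset.sum_ite_eq, Finset.mem_univ, if_true]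
    abel
  -- The vector `g = V b` is also `b` times the resolvent of the transpose: the commutators of `E'`
  -- with `g` account for the different shifts.
  have gQ : ∀ k, ∑ i, b i * Q i k = g k := by
    have h1 : ∀ k, ∑ j, shiftMat u n E' k j * g j = b k := fun k => by
      have : (shiftMat u n E' * V) *ᵥ b = b := by rw [v1, Matrix.one_mulVec]
      rw [← Matrix.mulVec_mulVec] at this
      exact congrFun this k
    have h2 : g ᵥ* shiftMat u 0 E'.transpose = b := by
      ext k
      rw [← h1]
      simp only [Matrix.vecMul, dotProduct, shiftMat_apply, Matrix.transpose_apply, mul_sub, sub_mul,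
        Finset.sum_sub_distrib, mul_ite, ite_mul, mul_zero, zero_mul, Finset.sum_ite_eq,
        Finset.sum_ite_eq', Finset.mem_univ, if_true]
      have h3 : ∀ j, u * E' k j * g j = g j * (u * E' k j) + u * g k := fun j => by
        rw [mul_assoc, comg, mul_add, ← mul_assoc, ← mul_assoc, (hu (g j)).eq]
      simp only [h3, Finset.sum_add_distrib, Finset.sum_const, Finset.card_univ, Fintype.card_fin,
        nsmul_eq_mul, add_mul, one_mul, Nat.cast_zero, zero_mul, add_zero, mul_one, mul_assoc]
      abel
    intro k
    have h3 : g ᵥ* (shiftMat u 0 E'.transpose * Q) = g := by rw [q1, Matrix.vecMul_one]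
    rw [← Matrix.vecMul_vecMul, h2] at h3
    exact congrFun h3 k
  set m : Fin n → B := fun i => ∑ j, Q i j * c j with hm
  have comm : ∀ i k, E' i k * m i = m i * E' i k - m k := fun i k => by
    have : ∀ j, E' i k * (Q i j * c j) = Q i j * c j * E' i k +
        ((if k = j then Q i i * c j else 0) - Q k j * c j) - (if i = j then Q i j * c k else 0) := by
      intro j
      have h1 := hQ i k i j
      rw [if_pos rfl, sub_eq_iff_eq_add] at h1
      rw [← mul_assoc, h1, add_mul, sub_mul, mul_assoc (Q i j) (E' i k), comc, mul_sub,
        ← mul_assoc (Q i j)]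
      simp only [ite_mul, zero_mul, mul_ite, mul_zero]
      abel
    simp only [hm, Finset.mul_sum, Finset.sum_mul, this, Finset.sum_add_distrib,
      Finset.sum_sub_distrib, Finset.sum_ite_eq, Finset.mem_univ, if_true]
    abel
  -- In the same way `m = Q c` is `c` times the resolvent `V`.
  have mV : ∀ k, ∑ i, c i * V i k = m k := by
    have h1 : ∀ k, ∑ i, shiftMat u 0 E'.transpose k i * m i = c k := fun k => by
      have : (shiftMat u 0 E'.transpose * Q) *ᵥ c = c := by rw [q1, Matrix.one_mulVec]
      rw [← Matrix.mulVec_mulVec] at this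
      exact congrFun this k
    have h2 : m ᵥ* shiftMat u n E' = c := by
      ext k
      rw [← h1]
      simp only [Matrix.vecMul, dotProduct, shiftMat_apply, Matrix.transpose_apply, mul_sub, sub_mul,
        Finset.sum_sub_distrib, mul_ite, ite_mul, mul_zero, zero_mul, Finset.sum_ite_eq,
        Finset.sum_ite_eq', Finset.mem_univ, if_true]
      have h3 : ∀ i, u * E' i k * m i = m i * (u * E' i k) - u * m k := fun i => by
        rw [mul_assoc, comm, mul_sub, ← mul_assoc, ← mul_assoc, (hu (m i)).eq]
      have h4 : m k * (n * u) = n * (u * m k) := by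
        rw [(hu (m k)).eq, ← mul_assoc, ← mul_assoc, (Nat.cast_commute n (m k)).eq]
      simp only [h3, Finset.sum_sub_distrib, Finset.sum_const, Finset.card_univ, Fintype.card_fin,
        nsmul_eq_mul, mul_add, one_mul, Nat.cast_zero, zero_mul, add_zero, mul_one, h4]
      abel
    intro k
    have h3 : m ᵥ* (shiftMat u n E' * V) = m := by rw [v1, Matrix.vecMul_one]
    rw [← Matrix.vecMul_vecMul, h2] at h3
    exact congrFun h3 k
  have hVQ : ∀ k l, V l k = Q k l * (1 - u * V.trace) := fun k l => by
    have := resolvent_eq_mul hu hE'' (R := V) (Q := Q) (by rwa [Fintype.card_fin])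
      (by rwa [Fintype.card_fin]) q2 k l
    exact this
  set f := 1 - u * V.trace with hf
  have hfE : ∀ i j, Commute f (E' i j) := fun i j =>
    (Commute.one_left _).sub_left ((hu _).mul_left (hV.commute_trace i j).symm)
  have hfQ : ∀ i j, Commute f (Q i j) := fun i j =>
    commute_resolvent hu q1 q2 (fun i j => hfE j i) i j
  have mV' : ∀ i, ∑ j, V j i * c j = f * ∑ j, c j * V j i := fun i => by
    rw [mV, hm, Finset.mul_sum]
    refine Finset.sum_congr rfl fun j _ => ?_
    rw [hVQ, ← (hfQ i j).eq, mul_assoc]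
  -- The products `b i * c j` have to be reordered, which creates traces of `V` with `E'`.
  have trVE : u * ∑ i, ∑ j, V i j * E' j i = (1 + n * u) * V.trace - n := by
    have h1 : (V * shiftMat u n E').trace = n := by rw [v2, Matrix.trace_one, Fintype.card_fin]
    simp only [Matrix.trace, Matrix.diag_apply, mul_shiftMat_apply hu, Finset.sum_sub_distrib,
      ← Finset.mul_sum] at h1
    rw [sub_eq_iff_eq_add] at h1
    simp only [Matrix.trace, Matrix.diag_apply]
    rw [h1]
    abel
  have schur0 : schur (shiftMat u 0 E.transpose) Q = 1 - u * d - u * (u * ∑ j, g j * c j) := by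
    have e4 : ∀ W : Matrix (Fin (n+1)) (Fin (n+1)) B,
      ∑ i, W (Fin.last n) (Fin.castSucc i) * ∑ j, Q i j * W (Fin.castSucc j) (Fin.last n) =
      ∑ j, (∑ i, W (Fin.last n) (Fin.castSucc i) * Q i j) * W (Fin.castSucc j) (Fin.last n) := by
      intro W
      simp only [Finset.mul_sum, Finset.sum_mul, mul_assoc]
      exact Finset.sum_comm
    have e5 : ∀ j, ∑ i, u * b i * Q i j = u * g j := fun j => by
      rw [← gQ, Finset.mul_sum]
      simp only [mul_assoc]
    rw [schur, e4]
    simp only [shiftMat_apply, hlast, hlast', if_false, zero_sub, if_true, Matrix.transpose_apply]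
    rw [Nat.cast_zero, zero_mul, add_zero]
    congr 1
    rw [Finset.mul_sum, Finset.mul_sum]
    refine Finset.sum_congr rfl fun j _ => ?_
    simp only [neg_mul, Finset.sum_neg_distrib, mul_neg, neg_neg]
    rw [e5, mul_assoc, ← mul_assoc (g j), ← (hu (g j)).eq, mul_assoc u (g j)]
  have schurn : schur (shiftMat u n E) V =
      1 + n * u - u * d - u * (u * ∑ i, (∑ j, c j * V j i) * b i) := by
    have e4 : ∀ W : Matrix (Fin (n+1)) (Fin (n+1)) B,
      ∑ i, W (Fin.last n) (Fin.castSucc i) * ∑ j, V i j * W (Fin.castSucc j) (Fin.last n) =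
      ∑ j, (∑ i, W (Fin.last n) (Fin.castSucc i) * V i j) * W (Fin.castSucc j) (Fin.last n) := by
      intro W
      simp only [Finset.mul_sum, Finset.sum_mul, mul_assoc]
      exact Finset.sum_comm
    rw [schur, e4]
    simp only [shiftMat_apply, hlast, hlast', if_false, zero_sub, if_true]
    congr 1
    rw [Finset.mul_sum, Finset.mul_sum]
    refine Finset.sum_congr rfl fun j _ => ?_
    simp only [neg_mul, Finset.sum_neg_distrib, mul_neg, neg_neg]
    have e5 : ∑ i, u * c i * V i j = u * ∑ i, c i * V i j := by
      rw [Finset.mul_sum]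
      simp only [mul_assoc]
    have e6 := (hu (∑ i, c i * V i j)).eq
    rw [e5, mul_assoc, ← mul_assoc (∑ i, c i * V i j), ← e6, mul_assoc u (∑ i, c i * V i j)]
  have sumgc : ∑ j, g j * c j = f * ∑ i, (∑ j, c j * V j i) * b i +
      (∑ i, ∑ j, V i j * E' j i - V.trace * d) := by
    have e1 : ∀ j, g j * c j = ∑ i, (V j i * c j * b i +
        (V j i * E' i j - if i = j then V j i * d else 0)) := fun j => by
      rw [hg, Finset.sum_mul]
      refine Finset.sum_congr rfl fun i _ => ?_
      rw [mul_assoc, bc, mul_add, mul_sub, ← mul_assoc]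
      simp only [mul_ite, mul_zero]
    simp only [e1, Finset.sum_add_distrib, Finset.sum_sub_distrib, Finset.sum_ite_eq',
      Finset.mem_univ, if_true]
    congr 1
    · rw [Finset.sum_comm, Finset.mul_sum]
      refine Finset.sum_congr rfl fun i _ => ?_
      rw [← mul_assoc, ← mV', Finset.sum_mul]
    · rw [Matrix.trace, Finset.sum_mul]; rfl
  rw [schur0, schurn, sumgc]
  generalize ∑ i, (∑ j, c j * V j i) * b i = Z
  rw [mul_add u, mul_sub u, trVE, mul_sub f]
  have e7 : f * (u * (u * Z)) = u * (u * (f * Z)) := by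
    rw [← mul_assoc, ← (hu f).eq, mul_assoc, ← mul_assoc f, ← (hu f).eq, mul_assoc]
  rw [e7, hf]
  generalize V.trace = t
  have e8 : ∀ x : B, t * (u * x) = u * (t * x) := fun x => by
    rw [← mul_assoc, ← (hu t).eq, mul_assoc]
  have e11 : (n : B) * u = u * n := (Nat.cast_commute n u).eq
  have e12 : t * n = n * t := (Nat.cast_commute n t).eq.symm
  simp only [mul_add, add_mul, mul_sub, sub_mul, mul_one, one_mul, mul_assoc, e8, e11, e12]
  abel

/-- The branching relation: the traces of resolvents for the successive corners of the matrix of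
generators differ by a ratio of two diagonal entries of resolvents with shifts differing by one. -/
theorem branching {u : B} (hu : ∀ b, Commute u b)
    {E : Matrix (Fin (n + 1)) (Fin (n + 1)) B} (hE : Covariant E E)
    {R₁ R₀ Q : Matrix (Fin (n + 1)) (Fin (n + 1)) B} {V Q' : Matrix (Fin n) (Fin n) B}
    (r1 : shiftMat u (n + 1) E * R₁ = 1) (r1' : R₁ * shiftMat u (n + 1) E = 1)
    (r0' : R₀ * shiftMat u n E = 1)
    (q1 : shiftMat u 0 E.transpose * Q = 1)
    (q2 : Q * shiftMat u 0 E.transpose = 1)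
    (v1 : shiftMat u n (E.submatrix Fin.castSucc Fin.castSucc) * V = 1)
    (v2 : V * shiftMat u n (E.submatrix Fin.castSucc Fin.castSucc) = 1)
    (q1' : shiftMat u 0 (E.submatrix Fin.castSucc Fin.castSucc).transpose * Q' = 1)
    (q2' : Q' * shiftMat u 0 (E.submatrix Fin.castSucc Fin.castSucc).transpose = 1) :
    R₀ (Fin.last n) (Fin.last n) * (1 + u * Q'.trace) =
      R₁ (Fin.last n) (Fin.last n) * (1 + u * Q.trace) := by
  have hF' := trace_resolvent_mul hu hE.submatrix (R := V) (Q := Q') (by rwa [Fintype.card_fin])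
      (by rwa [Fintype.card_fin]) q2'
  have h1 := mul_schur (R := R₀) (V := V) (by rw [shiftMat_submatrix]; exact v1) r0'
  have h2 := schur_mul (R := Q) (V := Q') (W := shiftMat u 0 E.transpose)
    (by rw [shiftMat_submatrix]; exact q2') q1
  rw [schur_transpose hu hE v1 v2 q1' q2'] at h2
  have h3 : schur (shiftMat u n E) V * Q (Fin.last n) (Fin.last n) = 1 + u * Q'.trace := by
    calc _ = (1 + u * Q'.trace) * ((1 - u * V.trace) * schur (shiftMat u n E) V *
          Q (Fin.last n) (Fin.last n)) := by
          rw [mul_assoc, ← mul_assoc (1 + u * Q'.trace), hF', one_mul]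
      _ = _ := by rw [h2, mul_one]
  have h4 : R₀ (Fin.last n) (Fin.last n) * (1 + u * Q'.trace) = Q (Fin.last n) (Fin.last n) := by
    rw [← h3, ← mul_assoc, h1, one_mul]
  have r1c : shiftMat u (Fintype.card (Fin (n + 1))) E * R₁ = 1 := by
    rwa [Fintype.card_fin]
  have r1c' : R₁ * shiftMat u (Fintype.card (Fin (n + 1))) E = 1 := by
    rwa [Fintype.card_fin]
  have hR := hE.inverse hu r1 r1'
  have hF2 := trace_resolvent_mul hu hE r1c r1c' q2
  have hfE : ∀ i j, Commute (1 - u * R₁.trace) (E i j) := fun i j =>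
    (Commute.one_left _).sub_left ((hu _).mul_left (hR.commute_trace i j).symm)
  have hfQ : ∀ i j, Commute (1 - u * R₁.trace) (Q i j) := fun i j =>
    commute_resolvent hu q1 q2 (fun i j => hfE j i) i j
  have hfF : Commute (1 - u * R₁.trace) (1 + u * Q.trace) :=
    (Commute.one_right _).add_right ((hu _).symm.mul_right
      (Commute.sum_right _ _ _ fun i _ => hfQ i i))
  rw [h4, resolvent_eq_mul hu hE r1c r1c' q2, mul_assoc, hfF.eq, hF2, mul_one]

end Branching

/-! ### Euler derivative and binomial transform of power series -/

section Series

open PowerSeries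

variable {A : Type*} [Ring A]

/-- The derivation `X d/dX` of `A⟦X⟧`. -/
def euler (a : A⟦X⟧) : A⟦X⟧ := mk fun n => (n : A) * coeff n a

@[simp] theorem coeff_euler (a : A⟦X⟧) (n : ℕ) : coeff n (euler a) = n * coeff n a :=
  coeff_mk _ _

theorem euler_sub (a b : A⟦X⟧) : euler (a - b) = euler a - euler b := by
  ext n; simp [mul_sub]

theorem euler_mul (a b : A⟦X⟧) : euler (a * b) = euler a * b + a * euler b := by
  ext n
  simp only [coeff_euler, map_add, coeff_mul, Finset.mul_sum, ← Finset.sum_add_distrib]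
  refine Finset.sum_congr rfl fun p hp => ?_
  rw [← Finset.HasAntidiagonal.mem_antidiagonal.1 hp, Nat.cast_add, add_mul, mul_assoc, ← mul_assoc (coeff p.1 a),
    ← (Nat.cast_commute p.2 (coeff p.1 a)).eq, mul_assoc]

theorem euler_one : euler (1 : A⟦X⟧) = 0 := by
  ext n
  by_cases h : n = 0 <;> simp [coeff_one, h]

/-- The alternating binomial coefficients `(-1)^(n - k) (n choose k)`, which are the coefficients
of the powers of `X` in `X ^ k / (1 + X) ^ (k + 1)`. -/
def altChoose (n k : ℕ) : ℤ := (-1) ^ (n + k) * n.choose k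

theorem altChoose_self (n : ℕ) : altChoose n n = 1 := by simp [altChoose, ← two_mul]

theorem altChoose_eq_zero {n k : ℕ} (h : n < k) : altChoose n k = 0 := by
  simp [altChoose, Nat.choose_eq_zero_of_lt h]

theorem altChoose_succ_self (n : ℕ) : altChoose (n + 1) n = -(n + 1) := by
  simp [altChoose, show n + 1 + n = 2 * n + 1 by ring, pow_succ]

theorem altChoose_succ_succ (n k : ℕ) :
    altChoose (n + 1) (k + 1) + altChoose n (k + 1) = altChoose n k := by
  simp only [altChoose, Nat.choose_succ_succ, Nat.cast_add]
  ring

theorem altChoose_succ_zero (n : ℕ) : altChoose (n + 1) 0 + altChoose n 0 = 0 := by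
  simp only [altChoose, Nat.choose_zero_right]
  ring

theorem one_add_X_mul_altChoose_mul (i j : ℕ) :
    (1 + X) * ((mk fun n => altChoose n i) * mk fun n => altChoose n j) =
      mk fun n => altChoose n (i + j) := by
  have h0 : (1 + X) * (mk fun n => altChoose n 0) = 1 := by
    ext n
    cases n with
    | zero => simp [add_mul, altChoose]
    | succ n =>
      rw [add_mul, one_mul, map_add, coeff_succ_X_mul, coeff_mk, coeff_mk, altChoose_succ_zero]
      simp [coeff_one]
  have hs : ∀ i, (1 + X) * (mk fun n => altChoose n (i + 1)) = X * mk fun n => altChoose n i := by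
    intro i
    ext n
    cases n with
    | zero => simp [add_mul, altChoose]
    | succ n =>
      rw [add_mul, one_mul, map_add, coeff_succ_X_mul, coeff_succ_X_mul, coeff_mk, coeff_mk,
        coeff_mk, altChoose_succ_succ]
  have hne : (1 + X : ℤ⟦X⟧) ≠ 0 := fun h => by
    have := congrArg (coeff 0) h
    simp at this
  induction i with
  | zero => rw [← mul_assoc, h0, one_mul, zero_add]
  | succ i ih =>
    refine mul_left_cancel₀ hne ?_
    rw [show i + 1 + j = (i + j) + 1 by ring, hs (i + j), ← ih]
    linear_combination ((1 + X) * (mk fun n => altChoose n j)) * hs i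

/-- The binomial transform: the substitution `X ↦ X / (1 + X)`, followed by multiplication with
`1 / (1 + X)`. In the variable `1 / X` this is the translation by one. -/
def binomTransform (a : A⟦X⟧) : A⟦X⟧ :=
  mk fun n => ∑ k ∈ Finset.range (n + 1), altChoose n k • coeff k a

theorem coeff_binomTransform (a : A⟦X⟧) (n : ℕ) :
    coeff n (binomTransform a) = ∑ k ∈ Finset.range (n + 1), altChoose n k • coeff k a :=
  coeff_mk _ _

theorem coeff_binomTransform_of_le (a : A⟦X⟧) {n m : ℕ} (h : n < m) :
    coeff n (binomTransform a) = ∑ k ∈ Finset.range m, altChoose n k • coeff k a := by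
  rw [coeff_binomTransform]
  refine Finset.sum_subset (Finset.range_subset_range.2 h) fun k _ hk => ?_
  rw [altChoose_eq_zero (by simpa using hk), zero_smul]

theorem binomTransform_add (a b : A⟦X⟧) :
    binomTransform (a + b) = binomTransform a + binomTransform b := by
  ext n; simp [coeff_binomTransform, smul_add, Finset.sum_add_distrib]

theorem binomTransform_sub (a b : A⟦X⟧) :
    binomTransform (a - b) = binomTransform a - binomTransform b := by
  ext n; simp [coeff_binomTransform, smul_sub, Finset.sum_sub_distrib]

theorem one_add_X_mul_binomTransform_mul (a b : A⟦X⟧) :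
    binomTransform (a * b) = (1 + X) * (binomTransform a * binomTransform b) := by
  ext n
  have hprod : ∀ m ≤ n, coeff m (binomTransform a * binomTransform b) =
      ∑ i ∈ Finset.range (n + 1), ∑ j ∈ Finset.range (n + 1),
        coeff m ((mk fun n => altChoose n i) * mk fun n => altChoose n j) •
          (coeff i a * coeff j b) := by
    intro m hm
    have : ∀ p ∈ Finset.HasAntidiagonal.antidiagonal m, coeff p.1 (binomTransform a) * coeff p.2 (binomTransform b)
        = ∑ i ∈ Finset.range (n + 1), ∑ j ∈ Finset.range (n + 1),
          (altChoose p.1 i * altChoose p.2 j) • (coeff i a * coeff j b) := fun p hp => by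
      have hp := Finset.HasAntidiagonal.mem_antidiagonal.1 hp
      rw [coeff_binomTransform_of_le a (m := n + 1) (by omega),
        coeff_binomTransform_of_le b (m := n + 1) (by omega), Finset.sum_mul]
      refine Finset.sum_congr rfl fun i _ => ?_
      rw [Finset.mul_sum]
      refine Finset.sum_congr rfl fun j _ => ?_
      rw [smul_mul_smul_comm]
    rw [coeff_mul, Finset.sum_congr rfl this, Finset.sum_comm]
    refine Finset.sum_congr rfl fun i _ => ?_
    rw [Finset.sum_comm]
    refine Finset.sum_congr rfl fun j _ => ?_
    rw [coeff_mul, Finset.sum_smul]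
    simp only [coeff_mk]
  have hrhs : coeff n ((1 + X) * (binomTransform a * binomTransform b)) =
      ∑ i ∈ Finset.range (n + 1), ∑ j ∈ Finset.range (n + 1),
        altChoose n (i + j) • (coeff i a * coeff j b) := by
    have : ∀ i j, altChoose n (i + j) =
        coeff n ((mk fun n => altChoose n i) * mk fun n => altChoose n j) +
        coeff n (X * ((mk fun n => altChoose n i) * mk fun n => altChoose n j)) := fun i j => by
      rw [← map_add, ← one_add_mul, one_add_X_mul_altChoose_mul, coeff_mk]
    simp only [this, add_smul, Finset.sum_add_distrib]
    rw [one_add_mul, map_add, hprod n le_rfl]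
    congr 1
    cases n with
    | zero => simp
    | succ n =>
      simp only [coeff_succ_X_mul]
      rw [hprod n (Nat.le_succ n)]
  rw [hrhs, coeff_binomTransform]
  have h1 : ∀ k ∈ Finset.range (n + 1), altChoose n k • coeff k (a * b) =
      ∑ i ∈ Finset.range (n + 1), ∑ j ∈ Finset.range (n + 1),
        if i + j = k then altChoose n k • (coeff i a * coeff j b) else 0 := fun k hk => by
    rw [coeff_mul, Finset.smul_sum, ← Finset.sum_product', ← Finset.sum_filter]
    refine Finset.sum_congr ?_ fun _ _ => rfl
    ext p
    simp only [Finset.HasAntidiagonal.mem_antidiagonal, Finset.mem_filter, Finset.mem_product, Finset.mem_range]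
      at hk ⊢
    omega
  rw [Finset.sum_congr rfl h1, Finset.sum_comm]
  refine Finset.sum_congr rfl fun i _ => ?_
  rw [Finset.sum_comm]
  refine Finset.sum_congr rfl fun j _ => ?_
  rw [Finset.sum_ite_eq]
  split_ifs with h
  · rfl
  · rw [altChoose_eq_zero (by simpa using h), zero_smul]

theorem one_add_X_mul_euler_binomTransform (a : A⟦X⟧) :
    (1 + X) * euler (binomTransform a) = binomTransform (euler a) - X * binomTransform a := by
  ext n
  rw [one_add_mul, map_add, map_sub]
  cases n with
  | zero => simp [coeff_binomTransform]
  | succ n =>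
    rw [coeff_succ_X_mul, coeff_succ_X_mul, coeff_euler, coeff_euler, coeff_binomTransform _ (n + 1),
      coeff_binomTransform _ (n + 1), coeff_binomTransform_of_le a (n := n) (m := n + 2) (by omega),
      Finset.mul_sum, Finset.mul_sum, ← Finset.sum_add_distrib, ← Finset.sum_sub_distrib]
    refine Finset.sum_congr rfl fun k _ => ?_
    have key : ((n : ℤ) + 1) * altChoose (n + 1) k + n * altChoose n k =
        altChoose (n + 1) k * k - altChoose n k := by
      cases k with
      | zero =>
        have := altChoose_succ_zero n
        push_cast
        linear_combination ((n : ℤ) + 1) * this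
      | succ k =>
        have h2 := altChoose_succ_succ n k
        have h3 : ((n : ℤ) + 1) * altChoose n k = altChoose (n + 1) (k + 1) * (k + 1) := by
          have := congrArg (Nat.cast (R := ℤ)) (Nat.add_one_mul_choose_eq n k)
          simp only [altChoose]
          push_cast at this ⊢
          linear_combination (-1) ^ (n + k) * this
        push_cast
        linear_combination ((n : ℤ) + 1) * h2 + h3
    have := congrArg (fun z : ℤ => z • coeff k a) key
    simp only [add_smul, sub_smul] at this
    rw [coeff_euler]
    simp only [zsmul_eq_mul, Int.cast_mul, Int.cast_add, Int.cast_natCast, Int.cast_one] at this ⊢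
    push_cast
    simpa only [mul_assoc] using this

/-- A series `a` can be recovered from `a - binomTransform a`. -/
theorem coeff_mem_of_sub_binomTransform {S : AddSubgroup A}
    (hS : ∀ (n : ℕ) (x : A), ((n : A) + 1) * x ∈ S → x ∈ S) {a : A⟦X⟧}
    (h : ∀ n, coeff n (a - binomTransform a) ∈ S) (k : ℕ) : coeff k a ∈ S := by
  induction k using Nat.strong_induction_on with
  | _ n ih =>
    refine hS n _ ?_
    have h1 := h (n + 1)
    rw [map_sub, coeff_binomTransform, Finset.sum_range_succ, Finset.sum_range_succ,
      altChoose_self, one_smul, altChoose_succ_self] at h1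
    have h2 : ∑ k ∈ Finset.range n, altChoose (n + 1) k • coeff k a ∈ S :=
      sum_mem fun k hk => S.zsmul_mem (ih k (Finset.mem_range.1 hk)) _
    have h3 := add_mem h1 h2
    have : ∀ x y z : A, x - (y + (-((n : ℤ) + 1)) • z + x) + y = ((n : A) + 1) * z := by
      intro x y z
      rw [neg_smul, zsmul_eq_mul]
      push_cast
      abel
    rwa [this] at h3

/-- The geometric series `1 + M X + M² X² + ⋯`. -/
def geom (M : A) : A⟦X⟧ := mk fun k => M ^ k

@[simp] theorem coeff_geom (M : A) (k : ℕ) : coeff k (geom M) = M ^ k := coeff_mk _ _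

theorem one_sub_mul_geom (M : A) : (1 - X * C M) * geom M = 1 := by
  ext n
  rw [sub_mul, one_mul, mul_assoc, map_sub]
  cases n with
  | zero => simp
  | succ n => rw [coeff_succ_X_mul, coeff_C_mul]; simp [pow_succ', coeff_one]

theorem geom_mul_one_sub (M : A) : geom M * (1 - X * C M) = 1 := by
  ext n
  rw [mul_sub, mul_one, ← mul_assoc, (commute_X (geom M)).eq, mul_assoc, map_sub]
  cases n with
  | zero => simp
  | succ n => rw [coeff_succ_X_mul, coeff_mul_C]; simp [pow_succ, coeff_one]

theorem binomTransform_geom (M : A) : binomTransform (geom M) = geom (M - 1) := by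
  ext n
  rw [coeff_binomTransform, coeff_geom, sub_eq_add_neg,
    (Commute.neg_one_right M).add_pow]
  refine Finset.sum_congr rfl fun k hk => ?_
  have hk : k ≤ n := Nat.lt_succ_iff.1 (Finset.mem_range.1 hk)
  have : ((-1 : ℤ)) ^ (n + k) = (-1) ^ (n - k) := by
    rw [show n + k = (n - k) + 2 * k by omega, pow_add, pow_mul]
    simp
  rw [altChoose, this, zsmul_eq_mul, coeff_geom, mul_assoc (M ^ k)]
  push_cast
  rw [← ((Commute.neg_one_left (M ^ k)).pow_left (n - k) |>.mul_left
    (Nat.cast_commute (n.choose k) (M ^ k))).eq]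

variable {ι : Type*} [Fintype ι] [DecidableEq ι]

/-- A series of matrices, seen as a matrix of series. -/
def toMat : (Matrix ι ι A)⟦X⟧ →+* Matrix ι ι A⟦X⟧ where
  toFun s := Matrix.of fun i j => mk fun k => coeff k s i j
  map_one' := by
    ext i j k
    rw [Matrix.of_apply, coeff_mk, coeff_one, Matrix.one_apply]
    by_cases h : k = 0 <;> by_cases h' : i = j <;> simp [h, h', coeff_one, Matrix.one_apply]
  map_zero' := by ext i j k; simp
  map_add' a b := by ext i j k; simp
  map_mul' a b := by
    ext i j k
    simp only [Matrix.of_apply, coeff_mk, Matrix.mul_apply, map_sum, coeff_mul, Matrix.sum_apply]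
    exact Finset.sum_comm

@[simp] theorem coeff_toMat (s : (Matrix ι ι A)⟦X⟧) (i j : ι) (k : ℕ) :
    coeff k (toMat s i j) = coeff k s i j := by simp [toMat]

theorem toMat_injective : Function.Injective (toMat : (Matrix ι ι A)⟦X⟧ → Matrix ι ι A⟦X⟧) :=
  fun s t h => by
    ext k i j
    rw [← coeff_toMat, ← coeff_toMat, h]

theorem toMat_X : toMat (X : (Matrix ι ι A)⟦X⟧) = Matrix.scalar ι X := by
  ext i j k
  rw [coeff_toMat, Matrix.scalar_apply, Matrix.diagonal_apply, coeff_X]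
  by_cases h : k = 1 <;> by_cases h' : i = j <;> simp [h, h', coeff_X, Matrix.one_apply]

theorem toMat_C (M : Matrix ι ι A) : toMat (C M) = M.map C := by
  ext i j k
  rw [coeff_toMat, coeff_C, Matrix.map_apply, coeff_C]
  split_ifs <;> rfl

theorem toMat_map_scalar (s : A⟦X⟧) :
    toMat (PowerSeries.map (Matrix.scalar ι) s) = Matrix.scalar ι s := by
  ext i j k
  rw [coeff_toMat, coeff_map, Matrix.scalar_apply, Matrix.diagonal_apply, Matrix.scalar_apply,
    Matrix.diagonal_apply]
  split_ifs <;> simp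

theorem shiftMat_eq_toMat (c : ℕ) (E : Matrix ι ι A) :
    shiftMat (X : A⟦X⟧) c (E.map C) = toMat (1 - X * C (E - (c : Matrix ι ι A))) := by
  rw [map_sub, map_one, map_mul, toMat_X, map_sub, map_sub, toMat_C, map_natCast, map_natCast,
    mul_sub, shiftMat, map_add, map_one, map_mul, map_natCast, (Nat.cast_commute c _).eq]
  abel

theorem shiftMat_mul_geom (c : ℕ) (E : Matrix ι ι A) :
    shiftMat (X : A⟦X⟧) c (E.map C) * toMat (geom (E - (c : Matrix ι ι A))) = 1 := by
  rw [shiftMat_eq_toMat, ← map_mul, one_sub_mul_geom, map_one]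

theorem geom_mul_shiftMat (c : ℕ) (E : Matrix ι ι A) :
    toMat (geom (E - (c : Matrix ι ι A))) * shiftMat (X : A⟦X⟧) c (E.map C) = 1 := by
  rw [shiftMat_eq_toMat, ← map_mul, geom_mul_one_sub, map_one]

theorem shiftMat_mul_geom_zero (E : Matrix ι ι A) :
    shiftMat (X : A⟦X⟧) 0 (E.map C).transpose * toMat (geom E.transpose) = 1 := by
  have := shiftMat_mul_geom 0 E.transpose
  rwa [Nat.cast_zero, sub_zero, Matrix.transpose_map] at this

theorem geom_mul_shiftMat_zero (E : Matrix ι ι A) :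
    toMat (geom E.transpose) * shiftMat (X : A⟦X⟧) 0 (E.map C).transpose = 1 := by
  have := geom_mul_shiftMat 0 E.transpose
  rwa [Nat.cast_zero, sub_zero, Matrix.transpose_map] at this

end Series

/-! ### The logarithmic derivative of the series of traces -/

section LogDerivative

open PowerSeries

variable {A : Type*} [Ring A]

theorem commute_of_coeff {a b : A⟦X⟧} (h : ∀ i j, Commute (coeff i a) (coeff j b)) :
    Commute a b := by
  ext n
  rw [coeff_mul, coeff_mul, ← Finset.Nat.sum_antidiagonal_swap]
  exact Finset.sum_congr rfl fun p _ => (h _ _).eq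

/-- Division of series with a divisor of constant term one does not leave a subring. -/
theorem coeff_mem_of_mul {S : Subring A} {a b c : A⟦X⟧} (h : a * b = c) (h0 : coeff 0 a = 1)
    (ha : ∀ k, coeff k a ∈ S) (hc : ∀ k, coeff k c ∈ S) (k : ℕ) : coeff k b ∈ S := by
  induction k using Nat.strong_induction_on with
  | _ k ih =>
    have h1 := congrArg (coeff k) h
    rw [coeff_mul, Finset.Nat.sum_antidiagonal_eq_sum_range_succ_mk, Finset.sum_range_succ',
      h0, one_mul, Nat.sub_zero] at h1
    rw [← eq_sub_iff_add_eq'] at h1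
    rw [h1]
    refine sub_mem (hc k) (sum_mem fun i hi => mul_mem (ha _) (ih _ ?_))
    have := Finset.mem_range.1 hi
    omega

theorem mul_left_cancel_of_coeff_zero {a b c : A⟦X⟧} (h0 : coeff 0 a = 1) (h : a * b = a * c) :
    b = c := by
  rw [← sub_eq_zero] at h ⊢
  rw [← mul_sub] at h
  generalize b - c = d at h
  ext k
  induction k using Nat.strong_induction_on with
  | _ k ih =>
    have h1 := congrArg (coeff k) h
    rw [coeff_mul, Finset.Nat.sum_antidiagonal_eq_sum_range_succ_mk, Finset.sum_range_succ',
      h0, one_mul, Nat.sub_zero, Finset.sum_eq_zero, zero_add] at h1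
    · exact h1
    · intro i hi
      have := Finset.mem_range.1 hi
      rw [ih _ (by omega)]
      simp

/-- The upper left corner of size `n` of an infinite matrix. -/
def corner (E : ℕ → ℕ → A) (n : ℕ) : Matrix (Fin n) (Fin n) A := Matrix.of fun i j => E i j

/-- The generating series `1 + ∑ Tr(Ωᵏ) X^(k + 1)` of the traces of the powers of the transpose `Ω`
of a matrix. -/
def traceSeries {ι : Type*} [Fintype ι] [DecidableEq ι] (M : Matrix ι ι A) : A⟦X⟧ :=
  1 + X * mk fun k => (M.transpose ^ k).trace

theorem coeff_zero_traceSeries {ι : Type*} [Fintype ι] [DecidableEq ι] (M : Matrix ι ι A) :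
    coeff 0 (traceSeries M) = 1 := by simp [traceSeries]

theorem coeff_succ_traceSeries {ι : Type*} [Fintype ι] [DecidableEq ι] (M : Matrix ι ι A) (n : ℕ) :
    coeff (n + 1) (traceSeries M) = (M.transpose ^ n).trace := by
  simp [traceSeries, coeff_one, coeff_succ_X_mul]

theorem traceSeries_eq {ι : Type*} [Fintype ι] [DecidableEq ι] (M : Matrix ι ι A) :
    traceSeries M = 1 + X * (toMat (geom M.transpose)).trace := by
  rw [traceSeries]
  congr 2
  ext k
  simp [Matrix.trace]

/-- The last diagonal entries of the powers of the corner of size `n + 1`, shifted by `n`. -/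
def topSeries (E : ℕ → ℕ → A) (n : ℕ) : A⟦X⟧ :=
  mk fun k => ((corner E (n + 1) - (n : Matrix (Fin (n + 1)) (Fin (n + 1)) A)) ^ k) (Fin.last n) (Fin.last n)

theorem coeff_zero_topSeries (E : ℕ → ℕ → A) (n : ℕ) : coeff 0 (topSeries E n) = 1 := by
  simp [topSeries]

theorem binomTransform_topSeries (E : ℕ → ℕ → A) (n : ℕ) :
    binomTransform (topSeries E n) =
      toMat (geom (corner E (n + 1) - ((n + 1 : ℕ) : Matrix (Fin (n + 1)) (Fin (n + 1)) A)))
        (Fin.last n) (Fin.last n) := by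
  rw [show corner E (n + 1) - ((n + 1 : ℕ) : Matrix (Fin (n + 1)) (Fin (n + 1)) A) =
    corner E (n + 1) - (n : Matrix (Fin (n + 1)) (Fin (n + 1)) A) - 1 by push_cast; abel, ← binomTransform_geom]
  ext k
  rw [coeff_toMat, coeff_binomTransform, coeff_binomTransform, Matrix.sum_apply]
  simp [topSeries]

theorem covariant_map_C {ι : Type*} [Fintype ι] [DecidableEq ι] {E : Matrix ι ι A}
    (hE : Covariant E E) : Covariant (E.map C) (E.map C) := fun i j k l => by
  simp only [Matrix.map_apply, ← map_mul, ← map_sub, hE i j k l]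
  rw [map_sub]
  congr 1 <;> split_ifs <;> simp

/-- The branching relation for power series. -/
theorem topSeries_mul_traceSeries (E : ℕ → ℕ → A) (n : ℕ)
    (hE : Covariant (corner E (n + 1)) (corner E (n + 1))) :
    topSeries E n * traceSeries (corner E n) =
      binomTransform (topSeries E n) * traceSeries (corner E (n + 1)) := by
  have h0 : topSeries E n = toMat (geom (corner E (n + 1) - (n : Matrix (Fin (n + 1)) (Fin (n + 1)) A)))
      (Fin.last n) (Fin.last n) := by
    ext k; simp [topSeries]
  rw [binomTransform_topSeries, h0, traceSeries_eq, traceSeries_eq]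
  exact branching (fun b => (commute_X b).symm) (covariant_map_C hE)
    (shiftMat_mul_geom (n + 1) _) (geom_mul_shiftMat (n + 1) _) (geom_mul_shiftMat n _)
    (shiftMat_mul_geom_zero _) (geom_mul_shiftMat_zero _) (shiftMat_mul_geom n (corner E n))
    (geom_mul_shiftMat n (corner E n)) (shiftMat_mul_geom_zero (corner E n))
    (geom_mul_shiftMat_zero (corner E n))

theorem commute_trace_transpose_pow {ι : Type*} [Fintype ι] [DecidableEq ι] {E : Matrix ι ι A}
    (hE : Covariant E E) (i j : ι) (k : ℕ) : Commute (E i j) (E.transpose ^ k).trace := by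
  have h := contravariant_iff.2 fun i j => (contravariant_iff.1 hE.transpose i j).pow_right k
  rw [commute_iff_eq, ← sub_eq_zero, Matrix.trace, Finset.mul_sum, Finset.sum_mul,
    ← Finset.sum_sub_distrib]
  simp [h i j]

theorem commute_pow_apply {ι : Type*} [Fintype ι] [DecidableEq ι] {M : Matrix ι ι A} {x : A}
    (h : ∀ i j, Commute x (M i j)) (k : ℕ) (i j : ι) : Commute x ((M ^ k) i j) := by
  have h1 : Commute (Matrix.scalar ι x) M := by
    rw [commute_iff_eq]; ext i j; simpa using (h i j).eq
  have := congrFun (congrFun (h1.pow_right k).eq i) j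
  simpa [commute_iff_eq] using this

theorem commute_traceSeries_topSeries_succ {E : ℕ → ℕ → A} {n : ℕ}
    (hE : Covariant (corner E (n + 1)) (corner E (n + 1))) (i j : ℕ) :
    Commute (coeff i (traceSeries (corner E (n + 1)))) (coeff j (topSeries E n)) := by
  rw [topSeries, coeff_mk]
  refine commute_pow_apply (fun k l => ?_) _ _ _
  have h1 : Commute (coeff i (traceSeries (corner E (n + 1)))) (corner E (n + 1) k l) := by
    cases i with
    | zero => rw [coeff_zero_traceSeries]; exact Commute.one_left _
    | succ i =>
      rw [coeff_succ_traceSeries]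
      exact (commute_trace_transpose_pow hE k l i).symm
  rw [Matrix.sub_apply]
  refine h1.sub_right ?_
  rw [← Matrix.diagonal_natCast, Matrix.diagonal_apply]
  split_ifs
  · exact (Nat.cast_commute _ _).symm
  · exact Commute.zero_right _

theorem commute_traceSeries_topSeries {E : ℕ → ℕ → A} {n : ℕ}
    (hE : Covariant (corner E (n + 1)) (corner E (n + 1))) (i j : ℕ) :
    Commute (coeff i (traceSeries (corner E n))) (coeff j (topSeries E n)) := by
  have h : Covariant (corner E (n + 1)) ((corner E (n + 1) - (n : Matrix (Fin (n + 1)) (Fin (n + 1)) A)) ^ j) :=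
    covariant_iff.2 fun k l => (((covariant_iff.1 hE k l).sub_right
      (Nat.cast_commute _ _).symm).pow_right j)
  rw [topSeries, coeff_mk]
  cases i with
  | zero => rw [coeff_zero_traceSeries]; exact Commute.one_left _
  | succ i =>
    rw [coeff_succ_traceSeries, Matrix.trace]
    refine (Commute.sum_right _ _ _ fun m _ => ?_).symm
    refine commute_pow_apply (fun k l => ?_) i m m
    have := h l.castSucc k.castSucc (Fin.last n) (Fin.last n)
    rw [if_neg (Fin.castSucc_lt_last k).ne, if_neg (Fin.castSucc_lt_last l).ne, sub_zero,
      sub_eq_zero] at this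
    exact this.symm

/-- The logarithmic derivative of the trace series, in terms of those of the top series. -/
theorem euler_traceSeries {E : ℕ → ℕ → A} {N : ℕ}
    (hE : ∀ n ≤ N, Covariant (corner E n) (corner E n)) {P : ℕ → A⟦X⟧}
    (hP : ∀ n < N, topSeries E n * P n = euler (topSeries E n)) :
    euler (traceSeries (corner E N)) = traceSeries (corner E N) *
      (((N : A⟦X⟧) + ∑ m ∈ Finset.range N, P m) -
        binomTransform ((N : A⟦X⟧) + ∑ m ∈ Finset.range N, P m)) := by
  induction N with
  | zero =>
    have h1 : traceSeries (corner E 0) = 1 := by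
      simp [traceSeries, Matrix.trace]
      ext n
      cases n <;> simp [coeff_succ_X_mul]
    have h2 : binomTransform (0 : A⟦X⟧) = 0 := by ext; simp [coeff_binomTransform]
    rw [h1, euler_one]
    simp [h2]
  | succ n ih =>
    have hE' := hE (n + 1) le_rfl
    have ih := ih (fun m hm => hE m (by omega)) (fun m hm => hP m (by omega))
    have hPn := hP n (Nat.lt_succ_self n)
    rw [Finset.sum_range_succ]
    set L : A⟦X⟧ := n + ∑ m ∈ Finset.range n, P m with hL
    set F₀ := traceSeries (corner E n) with hF₀
    set F := traceSeries (corner E (n + 1)) with hF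
    set S := topSeries E n with hS
    set p := P n with hp
    -- As `S` has constant term one, `S * p = euler S` shows that whatever commutes with the
    -- coefficients of `S` commutes with those of `p`.
    have hmem : ∀ x : A, (∀ k, Commute x (coeff k S)) → ∀ k, Commute x (coeff k p) := by
      intro x hx k
      have h1 : ∀ k, coeff k S ∈ Subring.centralizer {x} := fun k =>
        Subring.mem_centralizer_iff.2 fun y hy => by rw [Set.mem_singleton_iff.1 hy]; exact hx k
      have h2 := coeff_mem_of_mul hPn (coeff_zero_topSeries E n) h1 (fun k => by
        rw [coeff_euler]; exact mul_mem (natCast_mem _ k) (h1 k)) k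
      exact Subring.mem_centralizer_iff.1 h2 x rfl
    have hpF₀ : Commute p F₀ := (commute_of_coeff fun i j =>
      hmem _ (fun k => commute_traceSeries_topSeries hE' i k) j).symm
    have hpF' : ∀ i j, Commute (coeff i F) (coeff j p) := fun i j =>
      hmem _ (fun k => commute_traceSeries_topSeries_succ hE' i k) j
    have hpF : Commute p F := (commute_of_coeff hpF').symm
    have hkF : Commute (binomTransform p) F := (commute_of_coeff fun i j => by
      rw [coeff_binomTransform]
      exact Commute.sum_right _ _ _ fun k _ => (hpF' i k).smul_right _).symm
    have hrel : S * F₀ = binomTransform S * F := topSeries_mul_traceSeries E n hE'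
    have hX : ∀ a : A⟦X⟧, Commute (1 + X) a := fun a =>
      (Commute.one_left a).add_left (commute_X a).symm
    have hS1 : coeff 0 (binomTransform S) = 1 := by
      rw [coeff_binomTransform]
      simp [altChoose, hS, topSeries]
    have h1X : coeff 0 (1 + X : A⟦X⟧) = 1 := by simp
    have hκ1 : (1 + X) * binomTransform (1 : A⟦X⟧) = 1 := by
      have h := one_add_X_mul_binomTransform_mul (1 : A⟦X⟧) 1
      rw [one_mul, ← mul_assoc] at h
      have h0 : coeff 0 (binomTransform (1 : A⟦X⟧)) = 1 := by
        rw [coeff_binomTransform]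
        simp [altChoose]
      refine mul_left_cancel_of_coeff_zero h0 ?_
      rw [mul_one, ← mul_assoc, ← (hX _).eq, ← h]
    -- the logarithmic derivative of the shifted top series
    have hS2 : (1 + X) * euler (binomTransform S) =
        (1 + X) * (binomTransform S * (binomTransform p - (1 - binomTransform 1))) := by
      rw [one_add_X_mul_euler_binomTransform, ← hPn, one_add_X_mul_binomTransform_mul, mul_sub,
        mul_sub]
      congr 1
      rw [← mul_assoc, (hX _).eq, mul_assoc, mul_sub (1 + X), hκ1, mul_one, add_sub_cancel_left,
        (commute_X _).eq]
    have hS3 := mul_left_cancel_of_coeff_zero h1X hS2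
    -- Differentiate the branching relation and cancel `binomTransform S`.
    have hd := congrArg euler hrel
    rw [euler_mul, euler_mul, ← hPn, hS3, ih] at hd
    have h3 : binomTransform S * (F * (p + (L - binomTransform L))) = binomTransform S *
        ((binomTransform p - (1 - binomTransform 1)) * F + euler F) := by
      rw [mul_add (binomTransform S) (_ * F), ← mul_assoc (binomTransform S) (_ - _), ← hd,
        ← mul_assoc, ← hrel, mul_assoc S p, hpF₀.eq, ← mul_add, ← mul_add, mul_assoc]
    have h4 := mul_left_cancel_of_coeff_zero hS1 h3
    have hκF : Commute (binomTransform (1 : A⟦X⟧)) F := by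
      refine mul_left_cancel_of_coeff_zero h1X ?_
      rw [← mul_assoc, hκ1, one_mul, ← mul_assoc, (hX F).eq, mul_assoc, hκ1, mul_one]
    have h5 : Commute (binomTransform p - (1 - binomTransform 1)) F :=
      hkF.sub_left ((Commute.one_left F).sub_left hκF)
    rw [h5.eq, ← sub_eq_iff_eq_add', ← mul_sub] at h4
    rw [← h4]
    have h6 : ((n + 1 : ℕ) : A⟦X⟧) + (∑ m ∈ Finset.range n, P m + p) = L + p + 1 := by
      rw [hL]; push_cast; abel
    rw [h6, binomTransform_add (L + p) 1, binomTransform_add L p]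
    congr 1
    abel

end LogDerivative

/-! ### Sums over walks and first returns -/

section Walks

open PowerSeries

variable {A : Type*} [Ring A] {N : ℕ}

/-- The first positive time at which the walk `v` visits `m` (and `0` if there is none). -/
def hit {k : ℕ} (m : Fin N) (v : Fin (k + 1) → Fin N) : ℕ :=
  sInf {j : ℕ | 1 ≤ j ∧ ∃ h : j < k + 1, v ⟨j, h⟩ = m}

/-- The ordered product of the entries of `X` along the steps of the walk `v`. -/
def walkProd {k : ℕ} (X : Matrix (Fin N) (Fin N) A) (v : Fin (k + 1) → Fin N) : A :=
  (List.ofFn fun i : Fin k => X (v i.castSucc) (v i.succ)).prod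

/-- The sum over the walks of length `k` from `a` to `m` of the products along the walk, weighted by
the first positive time of visit of `m`. -/
def walkSum (X : Matrix (Fin N) (Fin N) A) (m : Fin N) (k : ℕ) (a : Fin N) : A :=
  ∑ v : Fin (k + 1) → Fin N,
    if v 0 = a ∧ v (Fin.last k) = m then (hit m v : A) * walkProd X v else 0

theorem sum_walk_succ {k : ℕ} (φ : (Fin (k + 2) → Fin N) → A) :
    ∑ v, φ v = ∑ a : Fin N, ∑ w : Fin (k + 1) → Fin N, φ (Fin.cons a w) := by
  rw [← (Fin.consEquiv fun _ => Fin N).sum_comp, Fintype.sum_prod_type]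
  rfl

theorem walkProd_cons {k : ℕ} (X : Matrix (Fin N) (Fin N) A) (a : Fin N)
    (w : Fin (k + 1) → Fin N) :
    walkProd X (Fin.cons a w : Fin (k + 2) → Fin N) = X a (w 0) * walkProd X w := by
  rw [walkProd, List.ofFn_succ, List.prod_cons]
  rfl

theorem hit_cons {k : ℕ} {m : Fin N} (a : Fin N) {w : Fin (k + 1) → Fin N}
    (hw : w (Fin.last k) = m) :
    hit m (Fin.cons a w : Fin (k + 2) → Fin N) = if w 0 = m then 1 else hit m w + 1 := by
  have hmem : ∀ j, (1 ≤ j ∧ ∃ h : j < k + 2, (Fin.cons a w : Fin (k + 2) → Fin N) ⟨j, h⟩ = m) ↔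
      ∃ i, j = i + 1 ∧ ∃ h : i < k + 1, w ⟨i, h⟩ = m := by
    intro j
    constructor
    · rintro ⟨h1, h2, h3⟩
      obtain ⟨i, rfl⟩ : ∃ i, j = i + 1 := ⟨j - 1, by omega⟩
      exact ⟨i, rfl, by omega, h3⟩
    · rintro ⟨i, rfl, h, h3⟩
      exact ⟨by omega, by omega, h3⟩
  rw [hit]
  simp only [hmem]
  split_ifs with h0
  · refine le_antisymm (Nat.sInf_le ⟨0, rfl, Nat.succ_pos k, h0⟩) ?_
    refine le_csInf ⟨1, 0, rfl, Nat.succ_pos k, h0⟩ ?_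
    rintro j ⟨i, rfl, -⟩
    omega
  · have hne : {j : ℕ | 1 ≤ j ∧ ∃ h : j < k + 1, w ⟨j, h⟩ = m}.Nonempty := by
      refine ⟨k, ?_, Nat.lt_succ_self k, hw⟩
      by_contra hk
      obtain rfl : k = 0 := by omega
      exact h0 hw
    obtain ⟨h1, h2, h3⟩ := Nat.sInf_mem hne
    refine le_antisymm (Nat.sInf_le ⟨_, rfl, h2, h3⟩) (le_csInf ⟨_, _, rfl, h2, h3⟩ ?_)
    rintro j ⟨i, rfl, h4, h5⟩
    refine Nat.succ_le_succ (Nat.sInf_le ⟨?_, h4, h5⟩)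
    by_contra hi
    obtain rfl : i = 0 := by omega
    exact h0 h5

theorem sum_walk_cons {k : ℕ} (m a : Fin N) (φ : (Fin (k + 2) → Fin N) → A) :
    ∑ v, (if v 0 = a ∧ v (Fin.last (k + 1)) = m then φ v else 0) =
      ∑ w : Fin (k + 1) → Fin N, if w (Fin.last k) = m then φ (Fin.cons a w) else 0 := by
  rw [sum_walk_succ, Finset.sum_comm]
  refine Finset.sum_congr rfl fun w _ => ?_
  simp only [Fin.cons_zero, ← Fin.succ_last, Fin.cons_succ, ite_and, Finset.sum_ite_eq',
    Finset.mem_univ, if_true]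

theorem sum_mul_walk {k : ℕ} (X : Matrix (Fin N) (Fin N) A) (m a : Fin N)
    (φ : (Fin (k + 1) → Fin N) → A) :
    ∑ b, X a b * ∑ v, (if v 0 = b ∧ v (Fin.last k) = m then φ v else 0) =
      ∑ w : Fin (k + 1) → Fin N, if w (Fin.last k) = m then X a (w 0) * φ w else 0 := by
  simp only [Finset.mul_sum]
  rw [Finset.sum_comm]
  refine Finset.sum_congr rfl fun w _ => ?_
  simp only [ite_and, mul_ite, mul_zero, Finset.sum_ite_eq, Finset.mem_univ, if_true]

theorem pow_apply_eq_sum_walk (X : Matrix (Fin N) (Fin N) A) (m : Fin N) (k : ℕ) (a : Fin N) :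
    (X ^ k) a m = ∑ v : Fin (k + 1) → Fin N,
      if v 0 = a ∧ v (Fin.last k) = m then walkProd X v else 0 := by
  induction k generalizing a with
  | zero =>
    rw [← (Equiv.funUnique (Fin 1) (Fin N)).symm.sum_comp]
    simp [walkProd, Matrix.one_apply, ite_and]
  | succ k ih =>
    rw [pow_succ', Matrix.mul_apply, sum_walk_cons]
    simp only [ih, walkProd_cons]
    exact sum_mul_walk X m a (walkProd X)

/-- Recursion by the first step: a step which does not lead to `m` delays the first visit by one. -/
theorem walkSum_succ (X : Matrix (Fin N) (Fin N) A) (m : Fin N) (k : ℕ) (a : Fin N) :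
    walkSum X m (k + 1) a = (X ^ (k + 1)) a m + ∑ b, X a b * walkSum X m k b -
      X a m * walkSum X m k m := by
  have h1 : (X ^ (k + 1)) a m = ∑ w : Fin (k + 1) → Fin N,
      if w (Fin.last k) = m then X a (w 0) * walkProd X w else 0 := by
    rw [pow_apply_eq_sum_walk, sum_walk_cons]
    simp only [walkProd_cons]
  rw [walkSum, sum_walk_cons, h1]
  simp only [walkSum]
  rw [sum_mul_walk, Finset.mul_sum, ← Finset.sum_add_distrib, ← Finset.sum_sub_distrib]
  refine Finset.sum_congr rfl fun w _ => ?_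
  by_cases hw : w (Fin.last k) = m
  · rw [hit_cons a hw]
    simp only [hw, if_true, and_true, walkProd_cons]
    by_cases h0 : w 0 = m
    · simp [h0]
    · simp only [h0, if_false, mul_zero, sub_zero]
      push_cast
      rw [add_mul, one_mul, ← mul_assoc, (Nat.cast_commute _ _).eq, mul_assoc, add_comm]
  · simp [hw]

theorem walkSum_zero (X : Matrix (Fin N) (Fin N) A) (m a : Fin N) : walkSum X m 0 a = 0 := by
  refine Finset.sum_eq_zero fun v _ => ?_
  have : hit m v = 0 := by
    have : {j : ℕ | 1 ≤ j ∧ ∃ h : j < 0 + 1, v ⟨j, h⟩ = m} = ∅ := by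
      ext j
      simp
      omega
    rw [hit, this, Nat.sInf_empty]
  simp [this]

/-- The recursion solved: all walks have weight `k`, up to the correction for what follows the first
visit. -/
theorem walkSum_eq (X : Matrix (Fin N) (Fin N) A) (m : Fin N) (k : ℕ) (a : Fin N) :
    walkSum X m k a = k * (X ^ k) a m -
      ∑ i ∈ Finset.range k, (X ^ (i + 1)) a m * walkSum X m (k - 1 - i) m := by
  induction k generalizing a with
  | zero => simp [walkSum_zero]
  | succ k ih =>
    have h1 : ∀ b, X a b * walkSum X m k b = k * (X a b * (X ^ k) b m) -
        ∑ i ∈ Finset.range k, X a b * (X ^ (i + 1)) b m * walkSum X m (k - 1 - i) m := fun b => by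
      rw [ih, mul_sub, ← mul_assoc, ← (Nat.cast_commute k _).eq, mul_assoc, Finset.mul_sum]
      simp only [mul_assoc]
    rw [walkSum_succ, Finset.sum_congr rfl fun b _ => h1 b]
    simp only [Finset.sum_sub_distrib, ← Finset.mul_sum]
    rw [Finset.sum_comm]
    simp only [← Finset.sum_mul, ← Matrix.mul_apply, ← pow_succ']
    rw [Finset.sum_range_succ']
    have h2 : ∀ i ∈ Finset.range k, (X ^ (i + 1 + 1)) a m * walkSum X m (k + 1 - 1 - (i + 1)) m =
        (X ^ (i + 1 + 1)) a m * walkSum X m (k - 1 - i) m := fun i _ => by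
      rw [show k + 1 - 1 - (i + 1) = k - 1 - i by omega]
    rw [Finset.sum_congr rfl h2]
    simp only [zero_add, pow_one, Nat.add_sub_cancel, Nat.sub_zero]
    push_cast
    rw [add_mul, one_mul]
    abel

/-- The generating series of the weighted walk sums is the logarithmic derivative of the generating
series of the diagonal entries of the powers. -/
theorem mk_pow_mul_walkSum (X : Matrix (Fin N) (Fin N) A) (m : Fin N) :
    (mk fun k => (X ^ k) m m) * (mk fun k => walkSum X m k m) =
      euler (mk fun k => (X ^ k) m m) := by
  ext k
  rw [coeff_mul, Finset.Nat.sum_antidiagonal_eq_sum_range_succ_mk, Finset.sum_range_succ']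
  simp only [coeff_mk, coeff_euler, pow_zero, Matrix.one_apply_eq, one_mul, Nat.sub_zero]
  rw [walkSum_eq X m k m]
  have : ∀ i ∈ Finset.range k, (X ^ (i + 1)) m m * walkSum X m (k - (i + 1)) m =
      (X ^ (i + 1)) m m * walkSum X m (k - 1 - i) m := fun i _ => by
    rw [show k - (i + 1) = k - 1 - i by omega]
  rw [Finset.sum_congr rfl this]
  abel

/-- A matrix supported on an initial block may be replaced by that block. -/
theorem pow_apply_of_block {M : ℕ} {X : Matrix (Fin N) (Fin N) A} {Y : Matrix (Fin M) (Fin M) A}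
    (f : Fin M → Fin N) (hf : Function.Injective f) (hY : ∀ i j, X (f i) (f j) = Y i j)
    (h0 : ∀ i j, j ∉ Set.range f → X i j = 0) (k : ℕ) (i j : Fin M) :
    (X ^ k) (f i) (f j) = (Y ^ k) i j := by
  induction k generalizing i with
  | zero => simp [Matrix.one_apply, hf.eq_iff]
  | succ k ih =>
    rw [pow_succ', pow_succ', Matrix.mul_apply, Matrix.mul_apply]
    refine (Fintype.sum_of_injective f hf _ _ (fun b hb => ?_) fun b => ?_).symm
    · rw [h0 _ _ hb, zero_mul]
    · rw [hY, ih]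

end Walks

/-! ### The fundamental relation for the elements `Ψ_k` -/

section Central

open PowerSeries

attribute [local instance 100] LieRing.ofAssociativeRing

variable (N : ℕ)

/-- The matrix of the generators of `U(gl_N)`. -/
def genMat : Matrix (Fin N) (Fin N) (Ugl N) := Matrix.of (gen N)

/-- The generators of `U(gl_N)`, extended by zero to all pairs of natural numbers. -/
def genExt (i j : ℕ) : Ugl N := if h : i < N ∧ j < N then gen N ⟨i, h.1⟩ ⟨j, h.2⟩ else 0

theorem corner_genExt : corner (genExt N) N = genMat N := by
  ext i j
  simp [corner, genExt, genMat]

theorem toU_mul_sub (a b : Matrix (Fin N) (Fin N) ℂ) :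
    toU N a * toU N b - toU N b * toU N a = toU N (a * b - b * a) := by
  have := (toU N).map_lie a b
  rw [LieRing.of_associative_ring_bracket, LieRing.of_associative_ring_bracket] at this
  exact this.symm

theorem covariant_genMat : Covariant (genMat N) (genMat N) := by
  intro i j k l
  simp only [genMat, Matrix.of_apply, gen]
  rw [toU_mul_sub, map_sub]
  congr 1
  · split_ifs with h
    · subst h; rw [Matrix.single_mul_single_same, one_mul]
    · rw [Matrix.single_mul_single_of_ne _ _ _ _ h, map_zero]
  · split_ifs with h
    · subst h; rw [Matrix.single_mul_single_same, one_mul]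
    · rw [Matrix.single_mul_single_of_ne _ _ _ _ (Ne.symm h), map_zero]

theorem covariant_corner_genExt {n : ℕ} (hn : n ≤ N) :
    Covariant (corner (genExt N) n) (corner (genExt N) n) := by
  intro i j k l
  have h := covariant_genMat N (Fin.castLE hn i) (Fin.castLE hn j) (Fin.castLE hn k)
    (Fin.castLE hn l)
  have h2 : ∀ i j : Fin n, corner (genExt N) n i j =
      genMat N (Fin.castLE hn i) (Fin.castLE hn j) := fun i j => by
    have hi : (i : ℕ) < N := i.2.trans_le hn
    have hj : (j : ℕ) < N := j.2.trans_le hn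
    simp [corner, genExt, genMat, hi, hj]
    rfl
  simp only [h2, h, Fin.castLE_inj]

/-- The matrix of the labels of the edges of the paths based at `m`. -/
def edgeMat (m : Fin N) : Matrix (Fin N) (Fin N) (Ugl N) :=
  Matrix.of fun i j => if i ≤ m ∧ j ≤ m then edge m i j else 0

theorem sum_paths (m : Fin N) (k : ℕ) :
    ∑ v ∈ paths k m, pathElem v = walkSum (edgeMat N m) m k m := by
  rw [paths, Finset.sum_filter, walkSum]
  refine Finset.sum_congr rfl fun v _ => ?_
  by_cases h1 : v 0 = m ∧ v (Fin.last k) = m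
  · rw [if_pos h1]
    by_cases h2 : ∀ i, v i ≤ m
    · rw [if_pos ⟨h1.1, h1.2, h2⟩, pathElem, walkProd, ← nsmul_eq_mul, ← Nat.cast_smul_eq_nsmul ℂ]
      congr 1
      · rw [firstReturn, hit, h1.1]
      · congr 2
        ext i
        simp [edgeMat, h2, h1.1]
    · rw [if_neg fun h => h2 h.2.2]
      push Not at h2
      obtain ⟨i, hi⟩ := h2
      have hi0 : i ≠ 0 := fun h => by rw [h, h1.1] at hi; exact lt_irrefl _ hi
      obtain ⟨j, rfl⟩ := Fin.exists_succ_eq.2 hi0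
      rw [walkProd, List.prod_eq_zero, mul_zero]
      rw [List.mem_ofFn]
      refine ⟨j, ?_⟩
      simp [edgeMat, hi]
  · rw [if_neg h1, if_neg fun h => h1 ⟨h.1, h.2.1⟩]

theorem psi_eq_sum_walkSum (k : ℕ) : psi N k = ∑ m : Fin N, walkSum (edgeMat N m) m k m :=
  Finset.sum_congr rfl fun m _ => sum_paths N m k

/-- The labels of the paths based at `m` are the entries of a corner, shifted by `m`. -/
theorem topSeries_eq (m : Fin N) :
    topSeries (genExt N) m = mk fun k => (edgeMat N m ^ k) m m := by
  ext k
  rw [topSeries, coeff_mk, coeff_mk]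
  set f : Fin (m + 1) → Fin N := Fin.castLE m.2 with hf
  have hl : f (Fin.last m) = m := rfl
  have := pow_apply_of_block (X := edgeMat N m) (Y := corner (genExt N) (m + 1) -
    ((m : ℕ) : Matrix (Fin (m + 1)) (Fin (m + 1)) (Ugl N))) f (Fin.castLE_injective m.2) ?_ ?_ k
    (Fin.last m) (Fin.last m)
  · rw [← this, hl]
  · intro i j
    have hi : f i ≤ m := Nat.lt_succ_iff.1 i.2
    have hj : f j ≤ m := Nat.lt_succ_iff.1 j.2
    have hij : f i = f j ↔ i = j := (Fin.castLE_injective m.2).eq_iff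
    have h3 : corner (genExt N) (m + 1) i j = gen N (f i) (f j) := by
      have h4 : (i : ℕ) < N := (f i).2
      have h5 : (j : ℕ) < N := (f j).2
      simp [corner, genExt, h4, h5]
      rfl
    rw [Matrix.sub_apply, h3, ← Matrix.diagonal_natCast, Matrix.diagonal_apply, edgeMat,
      Matrix.of_apply, if_pos ⟨hi, hj⟩, edge]
    simp only [hij]
    split_ifs with h
    · rw [h, map_natCast]
    · rw [sub_zero]
  · intro i j hj
    rw [edgeMat, Matrix.of_apply, if_neg]
    rintro ⟨-, h⟩
    exact hj ⟨⟨j, Nat.lt_succ_iff.2 h⟩, rfl⟩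

/-- The elements `Ψ_k`, completed by `N` for `k = 0`. -/
def psiExt (k : ℕ) : Ugl N := if k = 0 then (N : Ugl N) else psi N k

/-- The fundamental relation between the traces of powers and the elements `Ψ_k`. -/
theorem euler_traceSeries_genMat :
    euler (traceSeries (genMat N)) = traceSeries (genMat N) *
      ((mk (psiExt N)) - binomTransform (mk (psiExt N))) := by
  have h := euler_traceSeries (E := genExt N) (N := N) (fun n hn => covariant_corner_genExt N hn)
    (P := fun m => if h : m < N then mk fun k => walkSum (edgeMat N ⟨m, h⟩) ⟨m, h⟩ k ⟨m, h⟩ else 0)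
    (fun n hn => by
      rw [dif_pos hn, topSeries_eq N ⟨n, hn⟩]
      exact mk_pow_mul_walkSum _ _)
  rw [corner_genExt] at h
  have h2 : (N : (Ugl N)⟦X⟧) + ∑ m ∈ Finset.range N, (if h : m < N then
      mk fun k => walkSum (edgeMat N ⟨m, h⟩) ⟨m, h⟩ k ⟨m, h⟩ else 0) = mk (psiExt N) := by
    ext k
    rw [Finset.sum_range, map_add, map_sum, coeff_mk, psiExt]
    simp only [Fin.is_lt, dif_pos, coeff_mk, Fin.eta]
    rw [← psi_eq_sum_walkSum]
    have : coeff k (N : (Ugl N)⟦X⟧) = if k = 0 then (N : Ugl N) else 0 := by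
      rw [← map_natCast C, coeff_C]
    rw [this]
    split_ifs with hk
    · rw [hk, psi_eq_sum_walkSum]
      simp [walkSum_zero]
    · rw [zero_add]
  rwa [h2] at h

end Central

/-! ### The coproduct of the elements `Ψ_k` -/

section Delta

open PowerSeries

attribute [local instance 100] LieRing.ofAssociativeRing

theorem toU_eq_sum (N : ℕ) (M : Matrix (Fin N) (Fin N) ℂ) :
    toU N M = ∑ i, ∑ j, M i j • gen N i j := by
  conv_lhs => rw [Matrix.matrix_eq_sum_single M]
  simp only [map_sum, gen]
  refine Finset.sum_congr rfl fun i _ => Finset.sum_congr rfl fun j _ => ?_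
  rw [← map_smul, Matrix.smul_single, smul_eq_mul, mul_one]

/-- The enveloping algebra is generated by the Lie algebra. -/
theorem subalgebra_eq_top {N : ℕ} (S : Subalgebra ℂ (Ugl N)) (h : ∀ M, toU N M ∈ S) : S = ⊤ := by
  let f : Matrix (Fin N) (Fin N) ℂ →ₗ⁅ℂ⁆ S :=
    { toFun := fun M => ⟨toU N M, h M⟩
      map_add' := fun a b => Subtype.ext (map_add _ _ _)
      map_smul' := fun c a => Subtype.ext (map_smul _ _ _)
      map_lie' := fun {a b} => Subtype.ext ((toU N).map_lie a b) }
  have h1 : S.val.comp (UniversalEnvelopingAlgebra.lift ℂ f) = AlgHom.id ℂ (Ugl N) := by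
    apply UniversalEnvelopingAlgebra.hom_ext
    ext M
    change ((UniversalEnvelopingAlgebra.lift ℂ f (UniversalEnvelopingAlgebra.ι ℂ M) : S) : Ugl N) = _
    rw [UniversalEnvelopingAlgebra.lift_ι_apply]
    rfl
  refine eq_top_iff.2 fun x _ => ?_
  have := DFunLike.congr_fun h1 x
  rw [AlgHom.id_apply] at this
  rw [← this]
  exact (UniversalEnvelopingAlgebra.lift ℂ f x).2

/-- An element commuting with the generators is central. -/
theorem commute_of_commute_gen {N : ℕ} {x : Ugl N} (h : ∀ i j, Commute (gen N i j) x) (y : Ugl N) :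
    Commute x y := by
  have h1 : ∀ M, toU N M ∈ Subalgebra.centralizer ℂ {x} := fun M => by
    rw [toU_eq_sum]
    refine sum_mem fun i _ => sum_mem fun j _ => Subalgebra.smul_mem _ ?_ _
    rw [Subalgebra.mem_centralizer_iff]
    rintro _ rfl
    exact (h i j).eq.symm
  have h2 : y ∈ Subalgebra.centralizer ℂ {x} := by
    rw [subalgebra_eq_top _ h1]
    trivial
  exact (Subalgebra.mem_centralizer_iff ℂ).1 h2 x rfl

/-- The algebra morphism `(id ⊗ π) ∘ Δ` to the matrices over `U(gl_N)`, where `π` is the natural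
representation. -/
def delta (N : ℕ) : Ugl N →ₐ[ℂ] Matrix (Fin N) (Fin N) (Ugl N) :=
  UniversalEnvelopingAlgebra.lift ℂ
    { toFun := fun M => Matrix.scalar (Fin N) (toU N M) + M.map (algebraMap ℂ (Ugl N))
      map_add' := fun a b => by
        rw [map_add, map_add, Matrix.map_add _ (map_add _)]
        abel
      map_smul' := fun c a => by
        ext i j
        rw [RingHom.id_apply, map_smul, Matrix.smul_apply, Matrix.add_apply, Matrix.add_apply,
          Matrix.scalar_apply, Matrix.scalar_apply, Matrix.diagonal_apply, Matrix.diagonal_apply,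
          Matrix.map_apply, Matrix.map_apply, Matrix.smul_apply, smul_add, smul_eq_mul, map_mul,
          ← Algebra.smul_def, smul_ite, smul_zero]
      map_lie' := fun {a b} => by
        have hc : ∀ (x : Ugl N) (M : Matrix (Fin N) (Fin N) ℂ),
            Matrix.scalar (Fin N) x * M.map (algebraMap ℂ (Ugl N)) =
              M.map (algebraMap ℂ (Ugl N)) * Matrix.scalar (Fin N) x := fun x M => by
          ext i j
          rw [scalar_mul_apply', mul_scalar_apply', Matrix.map_apply, Algebra.commutes]
        rw [LieHom.map_lie]
        simp only [LieRing.of_associative_ring_bracket, map_sub, map_mul, mul_add, add_mul, hc,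
          Matrix.map_sub _ (map_sub (algebraMap ℂ (Ugl N))), Matrix.map_mul]
        rw [← hc (toU N b) a]
        abel }

theorem delta_toU (N : ℕ) (M : Matrix (Fin N) (Fin N) ℂ) :
    delta N (toU N M) = Matrix.scalar (Fin N) (toU N M) + M.map (algebraMap ℂ (Ugl N)) :=
  UniversalEnvelopingAlgebra.lift_ι_apply ℂ _ _

theorem delta_genMat (N : ℕ) (i j : Fin N) :
    delta N (genMat N i j) = Matrix.scalar (Fin N) (genMat N i j) + Matrix.single i j 1 := by
  rw [genMat, Matrix.of_apply, gen, delta_toU]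
  congr 1
  ext k l
  simp [Matrix.single_apply]

theorem natCast_add_one_mul_eq_zero {A : Type*} [Ring A] [Algebra ℂ A] (n : ℕ) {x : A}
    (h : ((n : A) + 1) * x = 0) : x = 0 := by
  have h1 : ((n : ℂ) + 1) • x = 0 := by
    rw [Algebra.smul_def]; simpa using h
  exact (smul_eq_zero.1 h1).resolve_left (Nat.cast_add_one_ne_zero n)

theorem commute_coeff_traceSeries (N k : ℕ) (y : Ugl N) :
    Commute (coeff k (traceSeries (genMat N))) y := by
  refine commute_of_commute_gen (fun i j => ?_) y
  cases k with
  | zero => rw [coeff_zero_traceSeries]; exact Commute.one_right _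
  | succ k => rw [coeff_succ_traceSeries]; exact commute_trace_transpose_pow (covariant_genMat N) i j k

theorem commute_coeff_logDeriv (N k : ℕ) (y : Ugl N) :
    Commute (coeff k (mk (psiExt N) - binomTransform (mk (psiExt N)))) y := by
  have h1 : ∀ k, coeff k (traceSeries (genMat N)) ∈ Subring.centralizer {y} := fun k =>
    Subring.mem_centralizer_iff.2 fun x hx => by
      rw [Set.mem_singleton_iff.1 hx]; exact (commute_coeff_traceSeries N k y).eq.symm
  have h2 := coeff_mem_of_mul (euler_traceSeries_genMat N).symm (coeff_zero_traceSeries _) h1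
    (fun k => by rw [coeff_euler]; exact mul_mem (natCast_mem _ k) (h1 k)) k
  exact (Subring.mem_centralizer_iff.1 h2 y rfl).symm

theorem commute_psiExt (N k : ℕ) (y : Ugl N) : Commute (psiExt N k) y := by
  have h := coeff_mem_of_sub_binomTransform (S := (Subring.centralizer {y}).toAddSubgroup)
    (a := mk (psiExt N)) (fun n x hx => ?_) (fun n => ?_) k
  · rw [coeff_mk] at h
    exact (Subring.mem_centralizer_iff.1 h y rfl).symm
  · refine Subring.mem_centralizer_iff.2 fun z hz => ?_
    rw [Set.mem_singleton_iff.1 hz]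
    have h1 := Subring.mem_centralizer_iff.1 hx y rfl
    rw [← sub_eq_zero]
    refine natCast_add_one_mul_eq_zero n ?_
    have h3 : Commute ((n : Ugl N) + 1) y := (Nat.cast_commute n y).add_left (Commute.one_left y)
    rw [mul_sub, ← mul_assoc, h3.eq, mul_assoc, h1, mul_assoc, sub_self]
  · exact Subring.mem_centralizer_iff.2 fun z hz => by
      rw [Set.mem_singleton_iff.1 hz]; exact (commute_coeff_logDeriv N n y).eq.symm

theorem euler_map {A B : Type*} [Ring A] [Ring B] (f : A →+* B) (a : A⟦X⟧) :
    euler (PowerSeries.map f a) = PowerSeries.map f (euler a) := by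
  ext n; simp

theorem binomTransform_map {A B : Type*} [Ring A] [Ring B] (f : A →+* B) (a : A⟦X⟧) :
    binomTransform (PowerSeries.map f a) = PowerSeries.map f (binomTransform a) := by
  ext n; simp [coeff_binomTransform]

theorem euler_X {A : Type*} [Ring A] : euler (X : A⟦X⟧) = X := by
  ext n
  rw [coeff_euler, coeff_X]
  split_ifs with h <;> simp [h]

theorem euler_geom {A : Type*} [Ring A] (M : A) : euler (geom M) = geom M * geom M - geom M := by
  ext n
  rw [map_sub, coeff_mul]
  simp only [coeff_euler, coeff_geom, ← pow_add]
  rw [Finset.sum_congr rfl fun p hp => by rw [Finset.HasAntidiagonal.mem_antidiagonal.1 hp]]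
  rw [Finset.sum_const, Finset.Nat.card_antidiagonal, nsmul_eq_mul]
  push_cast
  rw [add_mul, one_mul, add_sub_cancel_right]

theorem geom_add_one_mul {A : Type*} [Ring A] (M : A) :
    geom (M + 1) * (1 - X * geom M) = geom M := by
  have h : geom (M + 1) = geom M + geom (M + 1) * X * geom M := by
    calc geom (M + 1) = geom (M + 1) * ((1 - X * C M) * geom M) := by
          rw [one_sub_mul_geom, mul_one]
      _ = geom (M + 1) * (1 - X * C (M + 1)) * geom M + geom (M + 1) * X * geom M := by
          rw [map_add, map_one]; noncomm_ring
      _ = _ := by rw [geom_mul_one_sub, one_mul]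
  rw [mul_sub, mul_one, ← mul_assoc, sub_eq_iff_eq_add]
  exact h

theorem geom_sub_one_mul {A : Type*} [Ring A] (M : A) :
    geom (M - 1) * (1 + X * geom M) = geom M := by
  have h : geom (M - 1) = geom M - geom (M - 1) * X * geom M := by
    calc geom (M - 1) = geom (M - 1) * ((1 - X * C M) * geom M) := by
          rw [one_sub_mul_geom, mul_one]
      _ = geom (M - 1) * (1 - X * C (M - 1)) * geom M - geom (M - 1) * X * geom M := by
          rw [map_sub, map_one]; noncomm_ring
      _ = _ := by rw [geom_mul_one_sub, one_mul]
  rw [mul_add, mul_one, ← mul_assoc]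
  nth_rewrite 1 [h]
  rw [sub_add_cancel]

/-- The second difference of geometric series against the logarithmic derivative of
`1 - X² / (1 - M X)²`. -/
theorem geom_second_difference {A : Type*} [Ring A] (M : A) :
    (geom (M + 1) - geom M - (geom M - geom (M - 1))) * (1 - X * X * (geom M * geom M)) =
      - euler (1 - X * X * (geom M * geom M)) := by
  have hX : ∀ a : A⟦X⟧, a * X = X * a := fun a => (commute_X a).eq
  have h1 : (1 - X * X * (geom M * geom M)) = (1 - X * geom M) * (1 + X * geom M) := by
    have : X * geom M * (X * geom M) = X * X * (geom M * geom M) := by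
      rw [mul_assoc X, ← mul_assoc (geom M), hX (geom M)]; noncomm_ring
    rw [← this]; noncomm_ring
  have h2 : (1 - X * X * (geom M * geom M)) = (1 + X * geom M) * (1 - X * geom M) := by
    rw [h1]; noncomm_ring
  have h3 : geom (M + 1) * (1 - X * X * (geom M * geom M)) = geom M + X * (geom M * geom M) := by
    rw [h1, ← mul_assoc, geom_add_one_mul, mul_add, ← mul_assoc, hX, mul_one, mul_assoc]
  have h4 : geom (M - 1) * (1 - X * X * (geom M * geom M)) = geom M - X * (geom M * geom M) := by
    rw [h2, ← mul_assoc, geom_sub_one_mul, mul_sub, ← mul_assoc, hX, mul_one, mul_assoc]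
  have h5 : geom M * (1 - X * X * (geom M * geom M)) =
      geom M - X * X * (geom M * geom M * geom M) := by
    rw [mul_sub, mul_one, ← mul_assoc (geom M), ← mul_assoc (geom M), hX, mul_assoc X, hX]
    noncomm_ring
  rw [sub_mul, sub_mul, sub_mul, h3, h4, h5, euler_sub, euler_one, euler_mul, euler_mul, euler_mul,
    euler_geom, euler_X]
  noncomm_ring

/-- The image of `Ψ_k` under `(id ⊗ π) ∘ Δ`. -/
theorem delta_psiExt (N k : ℕ) :
    delta N (psiExt N k) = Matrix.scalar (Fin N) (psiExt N k) +
      (((genMat N).transpose + 1) ^ k - (genMat N).transpose ^ k) := by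
  set Ω := (genMat N).transpose with hΩ
  set F := traceSeries (genMat N) with hF
  set L := mk (psiExt N) - binomTransform (mk (psiExt N)) with hL
  have hFL : euler F = F * L := euler_traceSeries_genMat N
  set sc : Ugl N →+* Matrix (Fin N) (Fin N) (Ugl N) := Matrix.scalar (Fin N) with hsc
  set δ : Ugl N →+* Matrix (Fin N) (Fin N) (Ugl N) := (delta N).toRingHom with hδ
  set R := toMat (geom (genMat N - ((Fintype.card (Fin N) : ℕ) : Matrix (Fin N) (Fin N) (Ugl N))))
    with hR
  set Q : Matrix (Fin N) (Fin N) (Ugl N)⟦X⟧ := toMat (geom Ω) with hQ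
  set f : (Ugl N)⟦X⟧ := 1 - X * R.trace with hf
  have hu : ∀ b : (Ugl N)⟦X⟧, Commute X b := fun b => (commute_X b).symm
  have hcov := covariant_map_C (covariant_genMat N)
  have hFQ : F = 1 + X * Q.trace := traceSeries_eq _
  have hFf : F * f = 1 := by
    rw [hFQ]
    exact trace_resolvent_mul hu hcov (shiftMat_mul_geom _ _) (geom_mul_shiftMat _ _)
      (geom_mul_shiftMat_zero _)
  have hfF : f * F = 1 := by
    refine mul_left_cancel_of_coeff_zero (coeff_zero_traceSeries (genMat N)) ?_
    rw [← mul_assoc, mul_one]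
    change F * f * F = F
    rw [hFf, one_mul]
  have hFc : ∀ b, Commute F b := fun b => commute_of_coeff fun i j => commute_coeff_traceSeries N i _
  set G := geom Ω with hG
  set J := 1 - X * X * (G * G) with hJ
  -- Since `F` is the inverse of `f`, the action of `δ` on `F` is known as well.
  have hδf : PowerSeries.map δ f = PowerSeries.map sc f * J := by
    have := map_trace_resolvent (F := F) hu hcov (shiftMat_mul_geom _ _) (geom_mul_shiftMat _ _)
      (shiftMat_mul_geom_zero _) (geom_mul_shiftMat_zero _) hFf (fun i j => hFc _)
      (toMat.comp (PowerSeries.map δ)) (by simp [toMat_X]) (fun i j => by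
        simp only [Matrix.map_apply, RingHom.comp_apply, map_C]
        have h1 := delta_genMat N i j
        change toMat (C (delta N (genMat N i j))) = _
        rw [h1, toMat_C, Matrix.map_add _ (map_add _)]
        congr 1
        · ext a b : 1
          simp only [Matrix.map_apply, Matrix.scalar_apply, Matrix.diagonal_apply]
          split_ifs <;> simp
        · ext a b : 1
          simp only [Matrix.map_apply, Matrix.single_apply]
          split_ifs <;> simp)
    apply toMat_injective
    rw [RingHom.comp_apply] at this
    rw [hf, this, hJ, map_mul toMat, toMat_map_scalar, map_sub toMat, map_one toMat, map_mul toMat,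
      map_mul toMat, map_mul toMat, toMat_X]
  set V := PowerSeries.map δ F with hV
  set c := PowerSeries.map sc F with hc
  have hcc : ∀ b, Commute c b := fun b => commute_of_coeff fun i j => by
    rw [hc, coeff_map]
    exact Matrix.scalar_commute _ (fun y => commute_coeff_traceSeries N i y) _
  have hV0 : coeff 0 V = 1 := by rw [hV, coeff_map, coeff_zero_traceSeries, map_one]
  have hcf : PowerSeries.map sc f * c = 1 := by rw [hc, ← map_mul, hfF, map_one]
  have hVf : V * (PowerSeries.map sc f * J) = 1 := by rw [← hδf, hV, ← map_mul, hFf, map_one]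
  have hVJ : V * J = c := by
    calc V * J = V * (PowerSeries.map sc f * c) * J := by rw [hcf, mul_one]
      _ = V * (PowerSeries.map sc f * J) * c := by
        rw [mul_assoc, mul_assoc, (hcc J).eq, ← mul_assoc (PowerSeries.map sc f), ← mul_assoc]
      _ = c := by rw [hVf, one_mul]
  have hsL : Commute (PowerSeries.map sc L) J := commute_of_coeff fun i j => by
    rw [coeff_map]
    exact Matrix.scalar_commute _ (fun y => commute_coeff_logDeriv N i y) _
  have hVL : euler V = V * PowerSeries.map δ L := by rw [hV, euler_map, hFL, map_mul]
  have hcL : euler c = c * PowerSeries.map sc L := by rw [hc, euler_map, hFL, map_mul]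
  -- Take logarithmic derivatives in `δ(F) J = F`.
  have h1 : (PowerSeries.map δ L - PowerSeries.map sc L) * J = - euler J := by
    rw [← hVJ, euler_mul, hVL, mul_assoc, mul_assoc, ← mul_add] at hcL
    have := mul_left_cancel_of_coeff_zero hV0 hcL
    rw [sub_mul, hsL.eq, ← this]
    abel
  have hJinv : J * (V * PowerSeries.map sc f) = 1 := by
    have h0 : coeff 0 (V * PowerSeries.map sc f) = 1 := by
      have : coeff 0 f = 1 := by simp [hf]
      have h2 : coeff 0 (PowerSeries.map sc f) = 1 := by rw [coeff_map, this, map_one]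
      rw [coeff_mul, Finset.Nat.antidiagonal_zero, Finset.sum_singleton, hV0, h2, one_mul]
    refine mul_left_cancel_of_coeff_zero h0 ?_
    rw [← mul_assoc, mul_assoc V, hVf, one_mul, mul_one]
  have h2 : PowerSeries.map δ L - PowerSeries.map sc L =
      geom (Ω + 1) - geom Ω - (geom Ω - geom (Ω - 1)) := by
    rw [← geom_second_difference] at h1
    change _ * J = _ * J at h1
    have := congrArg (· * (V * PowerSeries.map sc f)) h1
    simp only [mul_assoc _ J, hJinv, mul_one] at this
    exact this
  set d := PowerSeries.map δ (mk (psiExt N)) - (PowerSeries.map sc (mk (psiExt N)) +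
    (geom (Ω + 1) - geom Ω)) with hd
  -- The difference of the two sides is invariant under the binomial transform, hence zero.
  have hd0 : d - binomTransform d = 0 := by
    have h3 : binomTransform (geom (Ω + 1)) = geom Ω := by
      rw [binomTransform_geom, add_sub_cancel_right]
    rw [hL, map_sub, map_sub, ← binomTransform_map, ← binomTransform_map] at h2
    rw [hd, binomTransform_sub, binomTransform_add, binomTransform_sub, h3, binomTransform_geom]
    rw [← sub_eq_zero] at h2
    rw [← h2]
    abel
  have h4 := coeff_mem_of_sub_binomTransform (S := ⊥) (a := d)
    (fun n x hx => natCast_add_one_mul_eq_zero n hx) (fun n => by rw [hd0]; simp) k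
  rw [AddSubgroup.mem_bot, hd, map_sub, sub_eq_zero] at h4
  simp only [coeff_map, coeff_mk, map_add, map_sub, coeff_geom] at h4
  exact h4

end Delta

/-! ### The generator of the semigroup -/

section Generator

attribute [local instance 100] LieRing.ofAssociativeRing

variable {N : ℕ}

/-- Induction principle for `U(gl_N)`: right multiplication by elements of the Lie algebra. -/
theorem ugl_induction {p : Ugl N → Prop} (one : p 1) (add : ∀ x y, p x → p y → p (x + y))
    (smul : ∀ (c : ℂ) x, p x → p (c • x)) (mul : ∀ x M, p x → p (x * toU N M)) (x : Ugl N) :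
    p x := by
  let S : Subalgebra ℂ (Ugl N) :=
    { carrier := {y | ∀ x, p x → p (x * y)}
      mul_mem' := fun {a b} ha hb x hx => by rw [← mul_assoc]; exact hb _ (ha _ hx)
      add_mem' := fun {a b} ha hb x hx => by rw [mul_add]; exact add _ _ (ha _ hx) (hb _ hx)
      algebraMap_mem' := fun c x hx => by
        rw [← Algebra.commutes, ← Algebra.smul_def]; exact smul c x hx }
  have h : x ∈ S := by
    rw [subalgebra_eq_top S fun M x hx => mul x M hx]
    trivial
  simpa using h 1 one

/-- The map `X ↦ Tr (δ(X) B)` on `U(gl_N)`, where `δ = (id ⊗ π) ∘ Δ`. -/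
def traceOp (B : Matrix (Fin N) (Fin N) ℂ) : Ugl N →ₗ[ℂ] Ugl N where
  toFun X := (delta N X * B.map (algebraMap ℂ (Ugl N))).trace
  map_add' X Y := by rw [map_add, add_mul, Matrix.trace_add]
  map_smul' c X := by rw [map_smul, smul_mul_assoc, Matrix.trace_smul, RingHom.id_apply]

theorem traceOp_apply (B : Matrix (Fin N) (Fin N) ℂ) (X : Ugl N) :
    traceOp B X = (delta N X * B.map (algebraMap ℂ (Ugl N))).trace := rfl

theorem traceOp_one (B : Matrix (Fin N) (Fin N) ℂ) :
    traceOp B 1 = algebraMap ℂ (Ugl N) B.trace := by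
  rw [traceOp_apply, map_one, one_mul, Matrix.trace, Matrix.trace, map_sum]
  rfl

/-- Leibniz rule for `traceOp`, from the multiplicativity of `delta`. -/
theorem traceOp_mul_toU (A B : Matrix (Fin N) (Fin N) ℂ) (X : Ugl N) :
    traceOp B (X * toU N A) = traceOp B X * toU N A + traceOp (A * B) X := by
  have hc : Matrix.scalar (Fin N) (toU N A) * B.map (algebraMap ℂ (Ugl N)) =
      B.map (algebraMap ℂ (Ugl N)) * Matrix.scalar (Fin N) (toU N A) := by
    ext i j
    rw [scalar_mul_apply', mul_scalar_apply', Matrix.map_apply, Algebra.commutes]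
  rw [traceOp_apply, traceOp_apply, traceOp_apply, map_mul, delta_toU, mul_assoc, add_mul, mul_add,
    Matrix.trace_add, hc, ← mul_assoc, Matrix.map_mul]
  congr 1
  rw [Matrix.trace, Matrix.trace, Finset.sum_mul]
  refine Finset.sum_congr rfl fun i _ => ?_
  rw [Matrix.diag_apply, mul_scalar_apply', Matrix.diag_apply]

theorem traceOp_comm (A B : Matrix (Fin N) (Fin N) ℂ) (X : Ugl N) :
    traceOp A (traceOp B X) = traceOp B (traceOp A X) := by
  induction X using ugl_induction generalizing A B with
  | one =>
    simp only [traceOp_one, Algebra.algebraMap_eq_smul_one, map_smul]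
    rw [smul_comm]
  | add x y hx hy => simp only [map_add, hx, hy]
  | smul c x hx => simp only [map_smul, hx A B]
  | mul x M hx =>
    simp only [traceOp_mul_toU, map_add, hx A B, hx (M * A) B, hx A (M * B)]
    abel

variable (N) in
/-- The generator of the semigroup of Markov operators. -/
def genOp : Ugl N →ₗ[ℂ] Ugl N := traceOp 1 - (N : ℂ) • LinearMap.id

theorem genOp_apply (X : Ugl N) : genOp N X = traceOp 1 X - (N : ℂ) • X := rfl

theorem genOp_mul_toU (A : Matrix (Fin N) (Fin N) ℂ) (X : Ugl N) :
    genOp N (X * toU N A) = genOp N X * toU N A + traceOp A X := by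
  rw [genOp_apply, genOp_apply, traceOp_mul_toU, mul_one, sub_mul, smul_mul_assoc]
  abel

theorem genOp_one : genOp N 1 = 0 := by
  rw [genOp_apply, traceOp_one, Matrix.trace_one, Fintype.card_fin, Algebra.algebraMap_eq_smul_one,
    sub_self]

theorem traceOp_genOp_pow (A : Matrix (Fin N) (Fin N) ℂ) (n : ℕ) (X : Ugl N) :
    traceOp A ((genOp N ^ n) X) = (genOp N ^ n) (traceOp A X) := by
  induction n generalizing X with
  | zero => rfl
  | succ n ih =>
    rw [pow_succ, Module.End.mul_apply, Module.End.mul_apply, ih, genOp_apply, genOp_apply, map_sub,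
      traceOp_comm, map_smul]

/-- The commutator of `genOp` with the right multiplication by `A` is `traceOp A`, which commutes with
`genOp`. -/
theorem genOp_pow_mul_toU (A : Matrix (Fin N) (Fin N) ℂ) (n : ℕ) (X : Ugl N) :
    (genOp N ^ (n + 1)) (X * toU N A) = (genOp N ^ (n + 1)) X * toU N A +
      ((n : ℂ) + 1) • (genOp N ^ n) (traceOp A X) := by
  induction n generalizing X with
  | zero => simp [genOp_mul_toU]
  | succ n ih =>
    have h : traceOp A (genOp N X) = genOp N (traceOp A X) := by
      simpa using traceOp_genOp_pow A 1 X
    rw [pow_succ, Module.End.mul_apply, genOp_mul_toU, map_add, ih, h, Module.End.mul_apply,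
      ← Module.End.mul_apply (genOp N ^ n), ← pow_succ, add_assoc, Nat.cast_add, Nat.cast_one,
      add_smul ((n : ℂ) + 1), one_smul]

/-- The counit of `U(gl_N)`. -/
def counit (N : ℕ) : Ugl N →ₐ[ℂ] ℂ :=
  UniversalEnvelopingAlgebra.lift ℂ
    { toFun := fun _ => 0
      map_add' := fun _ _ => (add_zero 0).symm
      map_smul' := fun c _ => (smul_zero c).symm
      map_lie' := fun {_ _} => by rw [LieRing.of_associative_ring_bracket]; simp }

theorem counit_toU (A : Matrix (Fin N) (Fin N) ℂ) : counit N (toU N A) = 0 :=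
  UniversalEnvelopingAlgebra.lift_ι_apply ℂ _ _

theorem counit_genOp_pow_mul_toU (A : Matrix (Fin N) (Fin N) ℂ) (n : ℕ) (X : Ugl N) :
    counit N ((genOp N ^ (n + 1)) (X * toU N A)) =
      ((n : ℂ) + 1) * counit N ((genOp N ^ n) (traceOp A X)) := by
  rw [genOp_pow_mul_toU, map_add, map_mul, counit_toU, mul_zero, zero_add, map_smul, smul_eq_mul]

/-- The span of the products of at most `n` elements of the Lie algebra. -/
def lengthFilt (N : ℕ) : ℕ → Submodule ℂ (Ugl N)
  | 0 => Submodule.span ℂ {1}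
  | n + 1 => lengthFilt N n ⊔
      Submodule.span ℂ {y | ∃ x ∈ lengthFilt N n, ∃ A, y = x * toU N A}

theorem lengthFilt_mono : Monotone (lengthFilt N) :=
  monotone_nat_of_le_succ fun _ => le_sup_left

theorem mul_toU_mem_lengthFilt {n : ℕ} {x : Ugl N} (hx : x ∈ lengthFilt N n)
    (A : Matrix (Fin N) (Fin N) ℂ) : x * toU N A ∈ lengthFilt N (n + 1) :=
  Submodule.mem_sup_right (Submodule.subset_span ⟨x, hx, A, rfl⟩)

theorem lengthFilt_succ_le {n : ℕ} {S : Submodule ℂ (Ugl N)} (h1 : lengthFilt N n ≤ S)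
    (h2 : ∀ x ∈ lengthFilt N n, ∀ A, x * toU N A ∈ S) : lengthFilt N (n + 1) ≤ S :=
  sup_le h1 (Submodule.span_le.2 (by rintro _ ⟨x, hx, A, rfl⟩; exact h2 x hx A))

theorem exists_mem_lengthFilt (X : Ugl N) : ∃ n, X ∈ lengthFilt N n := by
  induction X using ugl_induction with
  | one => exact ⟨0, Submodule.mem_span_singleton_self 1⟩
  | add x y hx hy =>
    obtain ⟨n, hn⟩ := hx
    obtain ⟨m, hm⟩ := hy
    exact ⟨max n m, add_mem (lengthFilt_mono (le_max_left n m) hn)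
      (lengthFilt_mono (le_max_right n m) hm)⟩
  | smul c x hx =>
    obtain ⟨n, hn⟩ := hx
    exact ⟨n, Submodule.smul_mem _ c hn⟩
  | mul x M hx =>
    obtain ⟨n, hn⟩ := hx
    exact ⟨n + 1, mul_toU_mem_lengthFilt hn M⟩

theorem traceOp_mem_lengthFilt {n : ℕ} {x : Ugl N} (hx : x ∈ lengthFilt N n)
    (B : Matrix (Fin N) (Fin N) ℂ) : traceOp B x ∈ lengthFilt N n := by
  induction n generalizing x B with
  | zero =>
    obtain ⟨c, rfl⟩ := Submodule.mem_span_singleton.1 hx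
    rw [map_smul, traceOp_one, Algebra.algebraMap_eq_smul_one]
    exact Submodule.smul_mem _ _ (Submodule.smul_mem _ _ (Submodule.mem_span_singleton_self 1))
  | succ n ih =>
    refine lengthFilt_succ_le (S := (lengthFilt N (n + 1)).comap (traceOp B)) (fun y hy => ?_)
      (fun y hy A => ?_) hx
    · exact lengthFilt_mono (Nat.le_succ n) (ih hy B)
    · rw [Submodule.mem_comap, traceOp_mul_toU]
      exact add_mem (mul_toU_mem_lengthFilt (ih hy B) A)
        (lengthFilt_mono (Nat.le_succ n) (ih hy _))

/-- The recursion satisfied by the state `⟨·⟩_t`, which determines it by induction on the length. -/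
def IsStateRec (t : ℂ) (φ : Ugl N →ₗ[ℂ] ℂ) : Prop :=
  φ 1 = 1 ∧ ∀ X A, φ (X * toU N A) = t * φ (traceOp A X)

/-- A functional satisfying the recursion of the state is the exponential of the generator, followed
by the counit. -/
theorem IsStateRec.eq_sum {t : ℂ} {φ : Ugl N →ₗ[ℂ] ℂ} (h : IsStateRec t φ) {m : ℕ} {X : Ugl N}
    (hX : X ∈ lengthFilt N m) {K : ℕ} (hK : m < K) :
    φ X = ∑ n ∈ Finset.range K, t ^ n / (n.factorial : ℂ) * counit N ((genOp N ^ n) X) := by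
  induction m generalizing X K with
  | zero =>
    obtain ⟨c, rfl⟩ := Submodule.mem_span_singleton.1 hX
    obtain ⟨k, rfl⟩ : ∃ k, K = k + 1 := ⟨K - 1, by omega⟩
    rw [Finset.sum_range_succ', Finset.sum_eq_zero]
    · simp [h.1]
    · intro n _
      rw [pow_succ (genOp N), Module.End.mul_apply, map_smul, genOp_one]
      simp
  | succ m ih =>
    let ψ : Ugl N →ₗ[ℂ] ℂ := ∑ n ∈ Finset.range K,
      (t ^ n / (n.factorial : ℂ)) • ((counit N).toLinearMap ∘ₗ (genOp N ^ n))
    have hψ : ∀ Y, ψ Y = ∑ n ∈ Finset.range K,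
        t ^ n / (n.factorial : ℂ) * counit N ((genOp N ^ n) Y) := fun Y => by
      simp [ψ]
    rw [← hψ]
    refine lengthFilt_succ_le (S := LinearMap.eqLocus φ ψ) (fun Y hY => ?_) (fun Y hY A => ?_) hX
    · rw [LinearMap.mem_eqLocus, hψ, ih hY (K := K) (by omega)]
    · obtain ⟨k, rfl⟩ : ∃ k, K = k + 1 := ⟨K - 1, by omega⟩
      rw [LinearMap.mem_eqLocus, hψ, h.2, ih (traceOp_mem_lengthFilt hY A) (K := k) (by omega),
        Finset.sum_range_succ', Finset.mul_sum]
      have h0 : counit N ((genOp N ^ 0) (Y * toU N A)) = 0 := by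
        rw [pow_zero, Module.End.one_apply, map_mul, counit_toU, mul_zero]
      rw [h0, mul_zero, add_zero]
      refine Finset.sum_congr rfl fun n _ => ?_
      rw [counit_genOp_pow_mul_toU, Nat.factorial_succ]
      have h1 : (n.factorial : ℂ) ≠ 0 := Nat.cast_ne_zero.2 n.factorial_ne_zero
      have h2 : (n : ℂ) + 1 ≠ 0 := Nat.cast_add_one_ne_zero n
      push_cast
      field_simp
      ring

/-- The coproduct intertwines the operators `traceOp B` with their action on the second factor. -/
theorem lTensor_traceOp_coproduct (B : Matrix (Fin N) (Fin N) ℂ) (X : Ugl N) :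
    (traceOp B).lTensor (Ugl N) (coproduct N X) = coproduct N (traceOp B X) := by
  have hΔ : ∀ A, coproduct N (toU N A) = toU N A ⊗ₜ[ℂ] 1 + 1 ⊗ₜ[ℂ] toU N A := fun A =>
    UniversalEnvelopingAlgebra.lift_ι_apply ℂ _ _
  have key : ∀ (A B : Matrix (Fin N) (Fin N) ℂ) (Z : Ugl N ⊗[ℂ] Ugl N),
      (traceOp B).lTensor (Ugl N) (Z * coproduct N (toU N A)) =
        (traceOp B).lTensor (Ugl N) Z * coproduct N (toU N A) +
          (traceOp (A * B)).lTensor (Ugl N) Z := fun A B Z => by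
    induction Z using TensorProduct.induction_on with
    | zero => simp
    | tmul x y =>
      simp only [hΔ, mul_add, Algebra.TensorProduct.tmul_mul_tmul, mul_one, map_add,
        LinearMap.lTensor_tmul, traceOp_mul_toU, TensorProduct.tmul_add, add_assoc]
    | add x y hx hy =>
      rw [add_mul, map_add, map_add, map_add, hx, hy, add_mul]
      abel
  induction X using ugl_induction generalizing B with
  | one =>
    rw [map_one, traceOp_one, AlgHom.commutes, Algebra.TensorProduct.one_def,
      LinearMap.lTensor_tmul, traceOp_one, Algebra.algebraMap_eq_smul_one,
      Algebra.algebraMap_eq_smul_one, TensorProduct.tmul_smul]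
    rfl
  | add x y hx hy => simp only [map_add, hx, hy]
  | smul c x hx => simp only [map_smul, hx]
  | mul x M hx => rw [map_mul, key, hx, hx, traceOp_mul_toU, map_add, map_mul]

theorem lTensor_genOp_pow_coproduct (n : ℕ) (X : Ugl N) :
    (genOp N ^ n).lTensor (Ugl N) (coproduct N X) = coproduct N ((genOp N ^ n) X) := by
  have h1 : ∀ X, (genOp N).lTensor (Ugl N) (coproduct N X) = coproduct N (genOp N X) := fun X => by
    rw [genOp_apply, genOp, LinearMap.lTensor_sub, LinearMap.lTensor_smul, LinearMap.lTensor_id,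
      LinearMap.sub_apply, lTensor_traceOp_coproduct, map_sub, map_smul]
    rfl
  induction n generalizing X with
  | zero => rw [pow_zero]; exact LinearMap.lTensor_id_apply _ _ _
  | succ n ih =>
    rw [pow_succ, Module.End.mul_eq_comp, LinearMap.lTensor_comp, LinearMap.comp_apply, h1, ih]
    rfl

theorem rid_lTensor_counit_coproduct (X : Ugl N) :
    TensorProduct.rid ℂ (Ugl N)
      ((counit N).toLinearMap.lTensor (Ugl N) (coproduct N X)) = X := by
  have hΔ : ∀ A, coproduct N (toU N A) = toU N A ⊗ₜ[ℂ] 1 + 1 ⊗ₜ[ℂ] toU N A := fun A =>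
    UniversalEnvelopingAlgebra.lift_ι_apply ℂ _ _
  have key : ∀ (A : Matrix (Fin N) (Fin N) ℂ) (Z : Ugl N ⊗[ℂ] Ugl N),
      TensorProduct.rid ℂ (Ugl N)
        ((counit N).toLinearMap.lTensor (Ugl N) (Z * coproduct N (toU N A))) =
      TensorProduct.rid ℂ (Ugl N) ((counit N).toLinearMap.lTensor (Ugl N) Z) * toU N A :=
    fun A Z => by
      induction Z using TensorProduct.induction_on with
      | zero => simp
      | tmul x y =>
        simp [hΔ, mul_add, Algebra.TensorProduct.tmul_mul_tmul, counit_toU]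
      | add x y hx hy => rw [add_mul, map_add, map_add, map_add, map_add, hx, hy, add_mul]
  induction X using ugl_induction with
  | one => rw [map_one, Algebra.TensorProduct.one_def]; simp
  | add x y hx hy => simp only [map_add, hx, hy]
  | smul c x hx => simp only [map_smul, hx]
  | mul x M hx => rw [map_mul, key, hx]

end Generator

/-! ### The recursion for the state -/

section StateRecursion

attribute [local instance 100] LieRing.ofAssociativeRing
attribute [local instance] Matrix.linftyOpNormedRing Matrix.linftyOpNormedAlgebra

variable {N : ℕ}

/-- Multiplication of a function by the linear form `U ↦ Tr (U B)`. -/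
def traceMul (B : Matrix (Fin N) (Fin N) ℂ) (g : Hol N) : Hol N :=
  ⟨fun U => (U * B).trace * g.1 U, by
    have h : ContDiff ℂ (⊤ : ℕ∞) (fun U : Matrix (Fin N) (Fin N) ℂ => U.trace) :=
      (LinearMap.toContinuousLinearMap (Matrix.traceLinearMap (Fin N) ℂ ℂ)).contDiff
    exact (h.comp (contDiff_id.mul contDiff_const)).mul (hol_contDiff g)⟩

theorem hasFDerivAt_trace_mul (B U V : Matrix (Fin N) (Fin N) ℂ) :
    DifferentiableAt ℂ (fun U : Matrix (Fin N) (Fin N) ℂ => (U * B).trace) U ∧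
      fderiv ℂ (fun U : Matrix (Fin N) (Fin N) ℂ => (U * B).trace) U V = (V * B).trace := by
  have h : HasFDerivAt (fun U : Matrix (Fin N) (Fin N) ℂ => (U * B).trace)
      (LinearMap.toContinuousLinearMap ((Matrix.traceLinearMap (Fin N) ℂ ℂ) ∘ₗ
        LinearMap.mulRight ℂ B)) U :=
    (LinearMap.toContinuousLinearMap ((Matrix.traceLinearMap (Fin N) ℂ ℂ) ∘ₗ
        LinearMap.mulRight ℂ B)).hasFDerivAt
  exact ⟨h.differentiableAt, by rw [h.fderiv]; rfl⟩

theorem leftDeriv_traceMul (A B : Matrix (Fin N) (Fin N) ℂ) (g : Hol N) :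
    leftDeriv N A (traceMul B g) = traceMul (A * B) g + traceMul B (leftDeriv N A g) := by
  ext U
  have h := hasFDerivAt_trace_mul B U (U * A)
  change fderiv ℂ (fun U => (U * B).trace * g.1 U) U (U * A) =
    (U * (A * B)).trace * g.1 U + (U * B).trace * fderiv ℂ g.1 U (U * A)
  refine (DFunLike.congr_fun (h.1.hasFDerivAt.mul
    (hol_differentiable g U).hasFDerivAt).fderiv (U * A)).trans ?_
  change (U * B).trace * fderiv ℂ g.1 U (U * A) + g.1 U * fderiv ℂ _ U (U * A) = _
  rw [h.2, ← mul_assoc U A B]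
  ring

theorem leftDeriv_kappa (A : Matrix (Fin N) (Fin N) ℂ) (t : ℝ) :
    leftDeriv N A (kappa N t) = (t : ℂ) • traceMul A (kappa N t) := by
  ext U
  have h : HasFDerivAt (fun U : Matrix (Fin N) (Fin N) ℂ => (t : ℂ) * (U - 1).trace)
      ((t : ℂ) • LinearMap.toContinuousLinearMap (Matrix.traceLinearMap (Fin N) ℂ ℂ)) U := by
    have h1 := (LinearMap.toContinuousLinearMap
      (Matrix.traceLinearMap (Fin N) ℂ ℂ)).hasFDerivAt (x := U - 1)
    have h2 := h1.comp U ((hasFDerivAt_id U).sub_const 1)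
    have h3 := h2.const_mul (t : ℂ)
    exact h3
  change fderiv ℂ (fun U => Complex.exp (t * (U - 1).trace)) U (U * A) =
    t * ((U * A).trace * Complex.exp (t * (U - 1).trace))
  refine (DFunLike.congr_fun h.cexp.fderiv (U * A)).trans ?_
  change _ * (_ * (U * A).trace) = _
  ring

theorem diffOp_toU (A : Matrix (Fin N) (Fin N) ℂ) : diffOp N (toU N A) = leftDeriv N A :=
  UniversalEnvelopingAlgebra.lift_ι_apply ℂ _ _

/-- At the identity, multiplication by a linear form is dual to the operator `traceOp`. -/
theorem diffOp_traceMul (B : Matrix (Fin N) (Fin N) ℂ) (X : Ugl N) (g : Hol N) :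
    (diffOp N X (traceMul B g)).1 1 = (diffOp N (traceOp B X) g).1 1 := by
  induction X using ugl_induction generalizing B g with
  | one =>
    rw [traceOp_one, map_one, AlgHom.commutes]
    change (1 * B).trace * g.1 1 = B.trace * g.1 1
    rw [one_mul]
  | add x y hx hy =>
    rw [map_add, map_add, map_add]
    exact congrArg₂ (· + ·) (hx B g) (hy B g)
  | smul c x hx =>
    rw [map_smul, map_smul, map_smul]
    exact congrArg (c * ·) (hx B g)
  | mul x M hx =>
    rw [map_mul, Module.End.mul_apply, diffOp_toU, leftDeriv_traceMul, map_add, traceOp_mul_toU,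
      map_add, map_mul, diffOp_toU]
    refine (congrArg₂ (· + ·) (hx (M * B) g) (hx B (leftDeriv N M g))).trans ?_
    exact add_comm _ _

theorem isStateRec_state (t : ℝ) : IsStateRec (t : ℂ) (state N t) := by
  constructor
  · change (diffOp N 1 (kappa N t)).1 1 = 1
    rw [map_one]
    change Complex.exp (t * (1 - 1 : Matrix (Fin N) (Fin N) ℂ).trace) = 1
    simp
  · intro X A
    change (diffOp N (X * toU N A) (kappa N t)).1 1 = t * (diffOp N (traceOp A X) (kappa N t)).1 1
    rw [map_mul, Module.End.mul_apply, diffOp_toU, leftDeriv_kappa, map_smul, ← diffOp_traceMul]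
    rfl

end StateRecursion

/-! ### State and Markov operators as exponentials -/

section Exponential

variable {N : ℕ}

theorem exists_state_eq_sum (t : ℝ) (X : Ugl N) : ∃ K₀ : ℕ, ∀ K, K₀ ≤ K →
    state N t X = ∑ n ∈ Finset.range K,
      (t : ℂ) ^ n / (n.factorial : ℂ) * counit N ((genOp N ^ n) X) := by
  obtain ⟨m, hm⟩ := exists_mem_lengthFilt X
  exact ⟨m + 1, fun K hK => (isStateRec_state t).eq_sum hm hK⟩

theorem exists_markov_eq_sum (t : ℝ) (X : Ugl N) : ∃ K₀ : ℕ, ∀ K, K₀ ≤ K →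
    markov N t X = ∑ n ∈ Finset.range K, ((t : ℂ) ^ n / (n.factorial : ℂ)) • (genOp N ^ n) X := by
  have key : ∀ Z : Ugl N ⊗[ℂ] Ugl N, ∃ K₀ : ℕ, ∀ K, K₀ ≤ K →
      (state N t).lTensor (Ugl N) Z = ∑ n ∈ Finset.range K,
        ((t : ℂ) ^ n / (n.factorial : ℂ)) • (counit N).toLinearMap.lTensor (Ugl N)
          ((genOp N ^ n).lTensor (Ugl N) Z) := fun Z => by
    induction Z using TensorProduct.induction_on with
    | zero => exact ⟨0, fun K _ => by simp⟩
    | tmul x y =>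
      obtain ⟨K₀, h⟩ := exists_state_eq_sum t y
      refine ⟨K₀, fun K hK => ?_⟩
      rw [LinearMap.lTensor_tmul, h K hK, TensorProduct.tmul_sum]
      refine Finset.sum_congr rfl fun n _ => ?_
      rw [LinearMap.lTensor_tmul, LinearMap.lTensor_tmul, ← TensorProduct.tmul_smul]
      rfl
    | add x y hx hy =>
      obtain ⟨K₁, h₁⟩ := hx
      obtain ⟨K₂, h₂⟩ := hy
      refine ⟨max K₁ K₂, fun K hK => ?_⟩
      rw [map_add, h₁ K (le_trans (le_max_left _ _) hK), h₂ K (le_trans (le_max_right _ _) hK),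
        ← Finset.sum_add_distrib]
      simp only [map_add, smul_add]
  obtain ⟨K₀, h⟩ := key (coproduct N X)
  refine ⟨K₀, fun K hK => ?_⟩
  change TensorProduct.rid ℂ (Ugl N) ((state N t).lTensor (Ugl N) (coproduct N X)) = _
  rw [h K hK, map_sum]
  refine Finset.sum_congr rfl fun n _ => ?_
  rw [map_smul, lTensor_genOp_pow_coproduct, rid_lTensor_counit_coproduct]

end Exponential

/-! ### The filtration by weight -/

section Filtration

open MvPolynomial

/-- Polynomials in symbols `X k`, which stand for the elements `psiExt N k`. The symbol `X k` has
weight `k + 1`. -/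
abbrev Symb : Type := MvPolynomial ℕ ℝ

/-- The weight of a monomial, where the variable `X k` has weight `k + 1`. -/
def monWeight : (ℕ →₀ ℕ) →+ ℤ := (Nat.castAddMonoidHom ℤ).comp (Finsupp.weight fun k : ℕ => k + 1)

theorem monWeight_nonneg (e : ℕ →₀ ℕ) : 0 ≤ monWeight e := Nat.cast_nonneg _

theorem monWeight_single (k : ℕ) : monWeight (Finsupp.single k 1) = k + 1 := by
  simp [monWeight, Finsupp.weight_single]

/-- The polynomials all of whose monomials have weight at most `d`. -/
def filt (d : ℤ) : Submodule ℝ Symb where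
  carrier := {q | ∀ e, coeff e q ≠ 0 → monWeight e ≤ d}
  add_mem' {p q} hp hq e h := by
    by_cases h1 : coeff e p = 0
    · refine hq e fun h2 => h ?_
      rw [coeff_add, h1, h2, add_zero]
    · exact hp e h1
  zero_mem' e h := absurd (coeff_zero e) h
  smul_mem' c q hq e h := hq e fun h2 => h (by rw [coeff_smul, h2, smul_zero])

theorem filt_mono {d d' : ℤ} (h : d ≤ d') : filt d ≤ filt d' := fun _ hq e he => (hq e he).trans h

theorem monomial_mem_filt {e : ℕ →₀ ℕ} {d : ℤ} (h : monWeight e ≤ d) (a : ℝ) :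
    monomial e a ∈ filt d := fun e' he' => by
  rw [coeff_monomial] at he'
  split_ifs at he' with h1
  · rwa [← h1]
  · exact absurd rfl he'

theorem C_mem_filt (a : ℝ) {d : ℤ} (h : 0 ≤ d) : (C a : Symb) ∈ filt d :=
  monomial_mem_filt (by rwa [map_zero]) a

theorem X_mem_filt (k : ℕ) : (X k : Symb) ∈ filt (k + 1) :=
  monomial_mem_filt (monWeight_single k).le 1

theorem mul_mem_filt {d d' : ℤ} {p q : Symb} (hp : p ∈ filt d) (hq : q ∈ filt d') :
    p * q ∈ filt (d + d') := fun e he => by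
  rw [coeff_mul] at he
  obtain ⟨x, hx, h⟩ := Finset.exists_ne_zero_of_sum_ne_zero he
  rw [← Finset.HasAntidiagonal.mem_antidiagonal.1 hx, map_add]
  exact add_le_add (hp _ (left_ne_zero_of_mul h)) (hq _ (right_ne_zero_of_mul h))

theorem eq_zero_of_mem_filt {d : ℤ} (hd : d < 0) {q : Symb} (hq : q ∈ filt d) : q = 0 := by
  ext e
  by_contra h
  exact absurd (hq e h) (not_le.2 (hd.trans_le (monWeight_nonneg e)))

theorem exists_mem_filt (q : Symb) : ∃ d : ℕ, q ∈ filt d := by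
  induction q using MvPolynomial.induction_on with
  | C a => exact ⟨0, C_mem_filt a le_rfl⟩
  | add p q hp hq =>
    obtain ⟨a, ha⟩ := hp
    obtain ⟨b, hb⟩ := hq
    exact ⟨max a b, add_mem (filt_mono (Nat.cast_le.2 (le_max_left a b)) ha)
      (filt_mono (Nat.cast_le.2 (le_max_right a b)) hb)⟩
  | mul_X p n hp =>
    obtain ⟨a, ha⟩ := hp
    refine ⟨a + (n + 1), ?_⟩
    exact_mod_cast mul_mem_filt ha (X_mem_filt n)

/-- Induction along the filtration by weight. -/
theorem filt_induction {P : ℤ → Symb → Prop} (zero : ∀ d, P d 0)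
    (add : ∀ d p q, P d p → P d q → P d (p + q)) (const : ∀ d a, 0 ≤ d → P d (C a))
    (mul_X : ∀ d p (n : ℕ), 0 ≤ d → p ∈ filt d → P d p → P (d + (n + 1)) (p * X n))
    {d : ℤ} {q : Symb} (hq : q ∈ filt d) : P d q := by
  have key : ∀ (e : ℕ →₀ ℕ) (a : ℝ) (d : ℤ), monWeight e ≤ d → P d (monomial e a) := by
    intro e a
    have h := induction_on_monomial
      (motive := fun q => ∀ d, q ∈ filt d → P d q)
      (fun a d hd => by
        by_cases h : a = 0
        · rw [h, map_zero]; exact zero d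
        · exact const d a (by simpa using hd 0 (by simpa using h)))
      (fun p n ih d hd => by
        by_cases h : p = 0
        · rw [h, zero_mul]; exact zero d
        have h1 : p ∈ filt (d - (n + 1)) := fun e he => by
          have := hd (e + Finsupp.single n 1) (by rwa [coeff_mul_X])
          rw [map_add, monWeight_single] at this
          omega
        have h2 : 0 ≤ d - (n + 1) := by
          by_contra h2
          exact h (eq_zero_of_mem_filt (not_le.1 h2) h1)
        simpa using mul_X _ p n h2 h1 (ih _ h1)) e a
    exact fun d hd => h d (monomial_mem_filt hd a)
  have hs : ∀ s ⊆ q.support, P d (∑ e ∈ s, monomial e (coeff e q)) := fun s => by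
    induction s using Finset.induction_on with
    | empty => exact fun _ => zero d
    | insert e s he ih =>
      intro hs
      rw [Finset.sum_insert he]
      exact add _ _ _ (key _ _ _ (hq e (mem_support_iff.1 (hs (Finset.mem_insert_self e s)))))
        (ih fun x hx => hs (Finset.mem_insert_of_mem hx))
  have := hs _ subset_rfl
  rwa [support_sum_monomial_coeff] at this

/-- The polynomials over `Symb` of weight at most `d`, where the variable has weight one. -/
def polyFilt (d : ℤ) : Submodule ℝ (Polynomial Symb) where
  carrier := {s | ∀ j : ℕ, s.coeff j ∈ filt (d - j)}
  add_mem' {p q} hp hq j := by rw [Polynomial.coeff_add]; exact add_mem (hp j) (hq j)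
  zero_mem' j := by rw [Polynomial.coeff_zero]; exact zero_mem _
  smul_mem' c q hq j := by rw [Polynomial.coeff_smul]; exact Submodule.smul_mem _ c (hq j)

theorem polyFilt_mono {d d' : ℤ} (h : d ≤ d') : polyFilt d ≤ polyFilt d' := fun _ hs j =>
  filt_mono (by omega) (hs j)

theorem polynomialC_mem_polyFilt {d : ℤ} {q : Symb} (hq : q ∈ filt d) :
    Polynomial.C q ∈ polyFilt d := fun j => by
  rw [Polynomial.coeff_C]
  split_ifs with h
  · rw [h]; simpa using hq
  · exact zero_mem _

theorem mul_mem_polyFilt {d d' : ℤ} {p q : Polynomial Symb} (hp : p ∈ polyFilt d)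
    (hq : q ∈ polyFilt d') : p * q ∈ polyFilt (d + d') := fun j => by
  rw [Polynomial.coeff_mul]
  refine sum_mem fun x hx => ?_
  have h := mul_mem_filt (hp x.1) (hq x.2)
  rw [← Finset.HasAntidiagonal.mem_antidiagonal.1 hx]
  refine filt_mono ?_ h
  push_cast
  omega

end Filtration

/-! ### The generator on symbols -/

section SymbolicGenerator

open MvPolynomial

/-- The coefficients of the logarithmic derivative of the series of the `powSymb`. -/
def logSymb (n : ℕ) : Symb := -∑ k ∈ Finset.range n, altChoose n k • X k

theorem logSymb_mem_filt (n : ℕ) : logSymb n ∈ filt n := by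
  refine neg_mem (sum_mem fun k hk => zsmul_mem (filt_mono ?_ (X_mem_filt k)) _)
  have := Finset.mem_range.1 hk
  omega

/-- The symbol of the trace of the `n`-th power of the transpose of `genMat N`, by the Newton type
recursion which expresses `euler_traceSeries_genMat`. -/
def powSymb (n : ℕ) : Symb :=
  ((n : ℝ) + 1)⁻¹ • (logSymb (n + 1) + ∑ a : Fin n, powSymb a * logSymb (n - a))
termination_by n
decreasing_by exact a.2

theorem powSymb_eq (n : ℕ) : powSymb n =
    ((n : ℝ) + 1)⁻¹ • (logSymb (n + 1) + ∑ a ∈ Finset.range n, powSymb a * logSymb (n - a)) := by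
  rw [powSymb, Finset.sum_range]

theorem powSymb_mem_filt (n : ℕ) : powSymb n ∈ filt (n + 1) := by
  induction n using Nat.strong_induction_on with
  | _ n ih =>
    rw [powSymb_eq]
    refine Submodule.smul_mem _ _ (add_mem ?_ (sum_mem fun a ha => ?_))
    · exact_mod_cast logSymb_mem_filt (n + 1)
    · have h := Finset.mem_range.1 ha
      refine filt_mono ?_ (mul_mem_filt (ih a h) (logSymb_mem_filt (n - a)))
      omega

/-- The `Symb`-linear map replacing the powers of the variable by the symbols of the traces. -/
def symbTrace : Polynomial Symb →ₗ[Symb] Symb where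
  toFun s := s.sum fun j c => c * powSymb j
  map_add' p q := Polynomial.sum_add_index p q _ (fun _ => zero_mul _) fun _ _ _ => add_mul _ _ _
  map_smul' c p := by
    rw [Polynomial.sum_smul_index p c (fun j c => c * powSymb j) (fun _ => zero_mul _),
      Polynomial.sum, Polynomial.sum, RingHom.id_apply, smul_eq_mul, Finset.mul_sum]
    exact Finset.sum_congr rfl fun _ _ => mul_assoc _ _ _

theorem symbTrace_apply (s : Polynomial Symb) :
    symbTrace s = ∑ j ∈ s.support, s.coeff j * powSymb j := rfl

theorem symbTrace_monomial (j : ℕ) (c : Symb) :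
    symbTrace (Polynomial.monomial j c) = c * powSymb j :=
  Polynomial.sum_monomial_index c (fun j c => c * powSymb j) (zero_mul _)

theorem symbTrace_C_mul (c : Symb) (s : Polynomial Symb) :
    symbTrace (Polynomial.C c * s) = c * symbTrace s := by
  rw [← Polynomial.smul_eq_C_mul, map_smul, smul_eq_mul]

theorem symbTrace_mem_filt {d : ℤ} {s : Polynomial Symb} (hs : s ∈ polyFilt d) :
    symbTrace s ∈ filt (d + 1) := by
  rw [symbTrace_apply]
  refine sum_mem fun j _ => ?_
  refine filt_mono ?_ (mul_mem_filt (hs j) (powSymb_mem_filt j))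
  omega

/-- The increment of the symbol `X k` under the coproduct. -/
def increment (k : ℕ) : Polynomial Symb := (Polynomial.X + 1) ^ k - Polynomial.X ^ k

theorem increment_zero : increment 0 = 0 := by simp [increment]

theorem increment_eq (k : ℕ) :
    increment k = ∑ j ∈ Finset.range k, Polynomial.monomial j (k.choose j : Symb) := by
  rw [increment, add_pow, Finset.sum_range_succ]
  simp only [one_pow, mul_one, Nat.choose_self, Nat.cast_one, add_sub_cancel_right]
  refine Finset.sum_congr rfl fun j _ => ?_
  rw [← Polynomial.C_mul_X_pow_eq_monomial, mul_comm, map_natCast]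

theorem increment_mem_polyFilt (k : ℕ) : increment k ∈ polyFilt (k - 1) := by
  rw [increment_eq]
  refine sum_mem fun j hj i => ?_
  rw [Polynomial.coeff_monomial]
  split_ifs with h
  · have := Finset.mem_range.1 hj
    rw [← map_natCast (C : ℝ →+* Symb)]
    exact C_mem_filt _ (by omega)
  · exact zero_mem _

/-- The symbolic version of `delta`. -/
def symbDelta : Symb →ₐ[ℝ] Polynomial Symb := aeval fun k => Polynomial.C (X k) + increment k

/-- The difference of `symbDelta` and the inclusion of the constants. -/
def symbDiff : Symb →ₗ[ℝ] Polynomial Symb :=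
  symbDelta.toLinearMap - (Algebra.ofId Symb (Polynomial Symb)).toLinearMap.restrictScalars ℝ

theorem symbDiff_apply (q : Symb) : symbDiff q = symbDelta q - Polynomial.C q := rfl

theorem symbDiff_C (a : ℝ) : symbDiff (C a) = 0 := by
  rw [symbDiff_apply, symbDelta, aeval_C, sub_eq_zero]
  rfl

theorem symbDiff_X (k : ℕ) : symbDiff (X k) = increment k := by
  rw [symbDiff_apply, symbDelta, aeval_X, add_sub_cancel_left]

theorem symbDiff_mul (p q : Symb) : symbDiff (p * q) =
    symbDiff p * symbDiff q + Polynomial.C p * symbDiff q + Polynomial.C q * symbDiff p := by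
  simp only [symbDiff_apply, map_mul]
  ring

/-- The increment of a symbol under the coproduct is of lower order by two. -/
theorem symbDiff_mem_polyFilt {d : ℤ} {q : Symb} (hq : q ∈ filt d) :
    symbDiff q ∈ polyFilt (d - 2) := by
  refine filt_induction (P := fun d q => symbDiff q ∈ polyFilt (d - 2))
    (fun d => by rw [map_zero]; exact zero_mem _)
    (fun d p q hp hq => by rw [map_add]; exact add_mem hp hq)
    (fun d a _ => by rw [symbDiff_C]; exact zero_mem _) (fun d p n _ hp ih => ?_) hq
  have hn := increment_mem_polyFilt n
  rw [symbDiff_mul, symbDiff_X]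
  refine add_mem (add_mem ?_ ?_) ?_
  · exact polyFilt_mono (by omega) (mul_mem_polyFilt ih hn)
  · exact polyFilt_mono (by omega) (mul_mem_polyFilt (polynomialC_mem_polyFilt hp) hn)
  · exact polyFilt_mono (by omega)
      (mul_mem_polyFilt (polynomialC_mem_polyFilt (X_mem_filt n)) ih)

/-- The symbolic version of the generator `genOp`. -/
def symbGen : Symb →ₗ[ℝ] Symb := (symbTrace.restrictScalars ℝ) ∘ₗ symbDiff

theorem symbGen_apply (q : Symb) : symbGen q = symbTrace (symbDiff q) := rfl

theorem symbGen_mem_filt {d : ℤ} {q : Symb} (hq : q ∈ filt d) : symbGen q ∈ filt (d - 1) :=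
  filt_mono (by omega) (symbTrace_mem_filt (symbDiff_mem_polyFilt hq))

theorem symbGen_pow_mem_filt {d : ℤ} {q : Symb} (hq : q ∈ filt d) (n : ℕ) :
    (symbGen ^ n) q ∈ filt (d - n) := by
  induction n with
  | zero => simpa using hq
  | succ n ih =>
    rw [pow_succ', Module.End.mul_apply]
    refine filt_mono ?_ (symbGen_mem_filt ih)
    push_cast
    omega

/-- The carré du champ of the generator. -/
def gammaTwo (x y : Symb) : Symb := symbTrace (symbDiff x * symbDiff y)

/-- The defect of the carré du champ from being a derivation in each variable. -/
def gammaThree (x y z : Symb) : Symb := symbTrace (symbDiff x * (symbDiff y * symbDiff z))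

theorem symbGen_mul (x y : Symb) :
    symbGen (x * y) = gammaTwo x y + x * symbGen y + y * symbGen x := by
  rw [symbGen_apply, symbDiff_mul, map_add, map_add, symbTrace_C_mul, symbTrace_C_mul]
  rfl

theorem gammaTwo_mul (x y z : Symb) :
    gammaTwo x (y * z) = gammaThree x y z + y * gammaTwo x z + z * gammaTwo x y := by
  rw [gammaTwo, symbDiff_mul, mul_add, mul_add, map_add, map_add, mul_left_comm _ (Polynomial.C y),
    symbTrace_C_mul, mul_left_comm _ (Polynomial.C z), symbTrace_C_mul]
  rfl

theorem gammaTwo_mem_filt {a b : ℤ} {x y : Symb} (hx : x ∈ filt a) (hy : y ∈ filt b) :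
    gammaTwo x y ∈ filt (a + b - 3) :=
  filt_mono (by omega)
    (symbTrace_mem_filt (mul_mem_polyFilt (symbDiff_mem_polyFilt hx) (symbDiff_mem_polyFilt hy)))

theorem gammaThree_mem_filt {a b c : ℤ} {x y z : Symb} (hx : x ∈ filt a) (hy : y ∈ filt b)
    (hz : z ∈ filt c) : gammaThree x y z ∈ filt (a + b + c - 5) :=
  filt_mono (by omega) (symbTrace_mem_filt (mul_mem_polyFilt (symbDiff_mem_polyFilt hx)
    (mul_mem_polyFilt (symbDiff_mem_polyFilt hy) (symbDiff_mem_polyFilt hz))))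

end SymbolicGenerator

/-! ### The exponential and the covariance on symbols -/

section SymbolicExponential

open MvPolynomial

/-- The exponential of the symbolic generator, as a polynomial in the time; the sum is finite since
the generator lowers the weight. -/
def symbExp (q : Symb) : Polynomial Symb :=
  ∑ n ∈ Finset.range ((exists_mem_filt q).choose + 1),
    Polynomial.monomial n (((n.factorial : ℝ)⁻¹) • (symbGen ^ n) q)

theorem coeff_symbExp (q : Symb) (n : ℕ) :
    (symbExp q).coeff n = ((n.factorial : ℝ)⁻¹) • (symbGen ^ n) q := by
  rw [symbExp, Polynomial.finsetSum_coeff]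
  simp only [Polynomial.coeff_monomial]
  rw [Finset.sum_ite_eq']
  split_ifs with h
  · rfl
  · have h1 := symbGen_pow_mem_filt (exists_mem_filt q).choose_spec n
    rw [Finset.mem_range] at h
    rw [eq_zero_of_mem_filt (by omega) h1, smul_zero]

theorem symbExp_add (p q : Symb) : symbExp (p + q) = symbExp p + symbExp q := by
  ext1 n
  rw [Polynomial.coeff_add, coeff_symbExp, coeff_symbExp, coeff_symbExp, map_add, smul_add]

theorem derivative_symbExp (q : Symb) :
    Polynomial.derivative (symbExp q) = symbExp (symbGen q) := by
  ext1 n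
  rw [Polynomial.coeff_derivative, coeff_symbExp, coeff_symbExp, pow_succ, Module.End.mul_apply,
    Nat.factorial_succ, ← Nat.cast_succ, mul_comm, ← nsmul_eq_mul, ← Nat.cast_smul_eq_nsmul ℝ,
    smul_smul]
  congr 1
  have h1 : (n.factorial : ℝ) ≠ 0 := Nat.cast_ne_zero.2 n.factorial_ne_zero
  have h2 : ((n + 1 : ℕ) : ℝ) ≠ 0 := Nat.cast_ne_zero.2 n.succ_ne_zero
  rw [Nat.cast_mul]
  field_simp

theorem symbExp_mem_polyFilt {d : ℤ} {q : Symb} (hq : q ∈ filt d) : symbExp q ∈ polyFilt d :=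
  fun n => by
    rw [coeff_symbExp]
    exact Submodule.smul_mem _ _ (symbGen_pow_mem_filt hq n)

theorem coeff_zero_symbExp (q : Symb) : (symbExp q).coeff 0 = q := by
  rw [coeff_symbExp]
  simp

theorem symbGen_C (a : ℝ) : symbGen (C a) = 0 := by rw [symbGen_apply, symbDiff_C, map_zero]

theorem symbGen_mul_X_zero (q : Symb) : symbGen (q * X 0) = symbGen q * X 0 := by
  rw [symbGen_apply, symbDiff_mul, symbDiff_X, increment_zero, mul_zero, mul_zero, zero_add,
    zero_add, symbTrace_C_mul, mul_comm]
  rfl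

theorem symbExp_C (a : ℝ) : symbExp (C a) = Polynomial.C (C a) := by
  ext1 n
  rw [coeff_symbExp, Polynomial.coeff_C]
  cases n with
  | zero => simp
  | succ n => rw [pow_succ, Module.End.mul_apply, symbGen_C, map_zero, smul_zero, if_neg (by omega)]

theorem symbExp_mul_X_zero (q : Symb) : symbExp (q * X 0) = symbExp q * Polynomial.C (X 0) := by
  ext1 n
  rw [Polynomial.coeff_mul_C, coeff_symbExp, coeff_symbExp, smul_mul_assoc]
  congr 1
  induction n with
  | zero => simp
  | succ n ih => rw [pow_succ', Module.End.mul_apply, Module.End.mul_apply, ih, symbGen_mul_X_zero]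

/-- The symbolic covariance. -/
def symbCov (x y : Symb) : Polynomial Symb := symbExp (x * y) - symbExp x * symbExp y

theorem symbCov_add (x y z : Symb) : symbCov x (y + z) = symbCov x y + symbCov x z := by
  rw [symbCov, symbCov, symbCov, mul_add, symbExp_add, symbExp_add]
  ring

theorem symbCov_C (x : Symb) (a : ℝ) : symbCov x (C a) = 0 := by
  rw [symbCov, symbExp_C, sub_eq_zero]
  ext1 n
  rw [Polynomial.coeff_mul_C, coeff_symbExp, coeff_symbExp, mul_comm x, mul_comm _ (C a), C_mul', C_mul',
    map_smul, smul_comm]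

theorem symbCov_X_zero (x : Symb) : symbCov x (X 0) = 0 := by
  have h : symbExp (X 0) = Polynomial.C (X 0) := by
    have := symbExp_mul_X_zero 1
    rwa [one_mul, ← C_1, symbExp_C, C_1, map_one, one_mul] at this
  rw [symbCov, symbExp_mul_X_zero, h, sub_self]

theorem derivative_symbCov (x y : Symb) : Polynomial.derivative (symbCov x y) =
    symbCov (symbGen x) y + symbCov x (symbGen y) + symbExp (gammaTwo x y) := by
  rw [symbCov, Polynomial.derivative_sub, Polynomial.derivative_mul, derivative_symbExp,
    derivative_symbExp, derivative_symbExp, symbGen_mul, symbExp_add, symbExp_add, symbCov, symbCov,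
    mul_comm y]
  ring

theorem coeff_zero_symbCov (x y : Symb) : (symbCov x y).coeff 0 = 0 := by
  rw [symbCov, Polynomial.coeff_sub, Polynomial.mul_coeff_zero, coeff_zero_symbExp,
    coeff_zero_symbExp, coeff_zero_symbExp, sub_self]

theorem coeff_succ_mem_filt {d : ℤ} {s : Polynomial Symb} {n : ℕ}
    (h : (Polynomial.derivative s).coeff n ∈ filt d) : s.coeff (n + 1) ∈ filt d := by
  rw [Polynomial.coeff_derivative, ← Nat.cast_succ, mul_comm, ← nsmul_eq_mul,
    ← Nat.cast_smul_eq_nsmul ℝ] at h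
  exact (Submodule.smul_mem_iff _ (Nat.cast_ne_zero.2 n.succ_ne_zero)).1 h

/-- Covariances lower the weight by two. -/
theorem symbCov_mem_polyFilt {a b : ℤ} {x y : Symb} (hx : x ∈ filt a) (hy : y ∈ filt b) :
    symbCov x y ∈ polyFilt (a + b - 2) := fun (n : ℕ) => by
  induction n generalizing a b x y with
  | zero => rw [coeff_zero_symbCov]; exact zero_mem _
  | succ n ih =>
    refine coeff_succ_mem_filt ?_
    rw [derivative_symbCov, Polynomial.coeff_add, Polynomial.coeff_add]
    refine add_mem (add_mem ?_ ?_) ?_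
    · exact filt_mono (by push_cast; omega) (ih (symbGen_mem_filt hx) hy)
    · exact filt_mono (by push_cast; omega) (ih hx (symbGen_mem_filt hy))
    · exact filt_mono (by push_cast; omega) (symbExp_mem_polyFilt (gammaTwo_mem_filt hx hy) n)

/-- The defect of the symbolic covariance from being a derivation. -/
def symbCum (x y z : Symb) : Polynomial Symb :=
  symbCov x (y * z) - symbExp y * symbCov x z - symbExp z * symbCov x y

/-- Time derivative of the third order defect; it involves only covariances of lower weight. -/
theorem derivative_symbCum (x y z : Symb) : Polynomial.derivative (symbCum x y z) =
    symbCum (symbGen x) y z + symbCum x (symbGen y) z + symbCum x y (symbGen z) +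
      (symbCov x (gammaTwo y z) + symbCov y (gammaTwo x z) + symbCov z (gammaTwo x y)) +
      symbExp (gammaThree x y z) := by
  simp only [symbCum, Polynomial.derivative_sub, Polynomial.derivative_mul, derivative_symbCov,
    derivative_symbExp, symbGen_mul, symbCov_add, gammaTwo_mul, symbExp_add]
  have h1 : symbExp (y * gammaTwo x z) = symbCov y (gammaTwo x z) +
      symbExp y * symbExp (gammaTwo x z) := (sub_add_cancel _ _).symm
  have h2 : symbExp (z * gammaTwo x y) = symbCov z (gammaTwo x y) +
      symbExp z * symbExp (gammaTwo x y) := (sub_add_cancel _ _).symm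
  rw [h1, h2]
  ring_nf

theorem coeff_zero_symbCum (x y z : Symb) : (symbCum x y z).coeff 0 = 0 := by
  simp only [symbCum, Polynomial.coeff_sub, Polynomial.mul_coeff_zero, coeff_zero_symbCov, mul_zero,
    sub_zero]

/-- The covariance is a derivation in each variable up to terms which lower the weight by four. -/
theorem symbCum_mem_polyFilt {a b c : ℤ} {x y z : Symb} (hx : x ∈ filt a) (hy : y ∈ filt b)
    (hz : z ∈ filt c) : symbCum x y z ∈ polyFilt (a + b + c - 4) := fun (n : ℕ) => by
  induction n generalizing a b c x y z with
  | zero => rw [coeff_zero_symbCum]; exact zero_mem _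
  | succ n ih =>
    refine coeff_succ_mem_filt ?_
    rw [derivative_symbCum]
    simp only [Polynomial.coeff_add]
    have h3 := symbExp_mem_polyFilt (gammaThree_mem_filt hx hy hz) n
    have h1 := symbCov_mem_polyFilt hx (gammaTwo_mem_filt hy hz) n
    have h4 := symbCov_mem_polyFilt hy (gammaTwo_mem_filt hx hz) n
    have h5 := symbCov_mem_polyFilt hz (gammaTwo_mem_filt hx hy) n
    refine add_mem (add_mem (add_mem (add_mem ?_ ?_) ?_) (add_mem (add_mem ?_ ?_) ?_)) ?_
    · exact filt_mono (by push_cast; omega) (ih (symbGen_mem_filt hx) hy hz)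
    · exact filt_mono (by push_cast; omega) (ih hx (symbGen_mem_filt hy) hz)
    · exact filt_mono (by push_cast; omega) (ih hx hy (symbGen_mem_filt hz))
    · exact filt_mono (by push_cast; omega) h1
    · exact filt_mono (by push_cast; omega) h4
    · exact filt_mono (by push_cast; omega) h5
    · exact filt_mono (by push_cast; omega) h3

end SymbolicExponential

/-! ### Evaluation of symbols -/

section Evaluation

attribute [local instance 100] LieRing.ofAssociativeRing

/-- The evaluation of symbols in `U(gl_N)`; its values lie in the center. -/
def symbEvalCenter (N : ℕ) : Symb →+* Subalgebra.center ℂ (Ugl N) :=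
  MvPolynomial.eval₂Hom ((algebraMap ℂ (Subalgebra.center ℂ (Ugl N))).comp Complex.ofRealHom)
    fun k => ⟨psiExt N k, Subalgebra.mem_center_iff.2 fun y => ((commute_psiExt N k y).eq).symm⟩

/-- The evaluation `X k ↦ psiExt N k` of symbols in `U(gl_N)`. -/
def symbEval (N : ℕ) : Symb →+* Ugl N :=
  (Subalgebra.center ℂ (Ugl N)).val.toRingHom.comp (symbEvalCenter N)

theorem symbEval_C (N : ℕ) (a : ℝ) : symbEval N (MvPolynomial.C a) = algebraMap ℂ (Ugl N) a := by
  rw [symbEval, RingHom.comp_apply, symbEvalCenter, MvPolynomial.eval₂Hom_C]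
  rfl

theorem symbEval_X (N k : ℕ) : symbEval N (MvPolynomial.X k) = psiExt N k := by
  rw [symbEval, RingHom.comp_apply, symbEvalCenter, MvPolynomial.eval₂Hom_X']
  rfl

theorem symbEval_smul (N : ℕ) (a : ℝ) (q : Symb) :
    symbEval N (a • q) = (a : ℂ) • symbEval N q := by
  rw [MvPolynomial.smul_eq_C_mul, map_mul, symbEval_C, Algebra.smul_def]

theorem commute_symbEval (N : ℕ) (q : Symb) (y : Ugl N) : Commute (symbEval N q) y :=
  (Subalgebra.mem_center_iff.1 (symbEvalCenter N q).2 y).symm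

/-- The symbols `powSymb n` stand for the traces of the powers of the transpose of `genMat N`. -/
theorem symbEval_powSymb (N n : ℕ) : symbEval N (powSymb n) = ((genMat N).transpose ^ n).trace := by
  have hlog : ∀ n, symbEval N (logSymb n) = PowerSeries.coeff n
      (PowerSeries.mk (psiExt N) - binomTransform (PowerSeries.mk (psiExt N))) := fun n => by
    rw [map_sub, coeff_binomTransform, Finset.sum_range_succ, altChoose_self, one_smul, logSymb,
      map_neg, map_sum]
    simp only [PowerSeries.coeff_mk, map_zsmul, symbEval_X]
    abel
  induction n using Nat.strong_induction_on with
  | _ n ih =>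
    have h := congrArg (PowerSeries.coeff (n + 1)) (euler_traceSeries_genMat N)
    rw [coeff_euler, coeff_succ_traceSeries, PowerSeries.coeff_mul,
      Finset.Nat.antidiagonal_succ, Finset.sum_cons, Finset.sum_map] at h
    simp only [Function.Embedding.prodMap, Function.Embedding.coeFn_mk, Prod.map,
      coeff_zero_traceSeries, one_mul, ← hlog, Nat.succ_eq_add_one, coeff_succ_traceSeries,
      Function.Embedding.refl_apply] at h
    rw [Finset.Nat.sum_antidiagonal_eq_sum_range_succ
      (fun i j => ((genMat N).transpose ^ i).trace * symbEval N (logSymb j)),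
      Finset.sum_range_succ, Nat.sub_self] at h
    have h0 : logSymb 0 = 0 := by simp [logSymb]
    rw [h0, map_zero, mul_zero, add_zero] at h
    rw [powSymb_eq, symbEval_smul, map_add, map_sum]
    have h2 : ∀ a ∈ Finset.range n, symbEval N (powSymb a * logSymb (n - a)) =
        ((genMat N).transpose ^ a).trace * symbEval N (logSymb (n - a)) := fun a ha => by
      rw [map_mul, ih a (Finset.mem_range.1 ha)]
    rw [Finset.sum_congr rfl h2, ← h]
    have h3 : ((n : ℂ) + 1) ≠ 0 := Nat.cast_add_one_ne_zero n
    rw [← nsmul_eq_mul, ← Nat.cast_smul_eq_nsmul ℂ, smul_smul]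
    push_cast
    rw [inv_mul_cancel₀ h3, one_smul]

/-- The evaluation of polynomials over the symbols at the transpose of `genMat N`. -/
def matEval (N : ℕ) : Polynomial Symb →+* Matrix (Fin N) (Fin N) (Ugl N) :=
  Polynomial.eval₂RingHom' ((Matrix.scalar (Fin N)).comp (symbEval N)) (genMat N).transpose
    fun a => Matrix.scalar_commute _ (fun y => commute_symbEval N a y) _

theorem matEval_C (N : ℕ) (q : Symb) :
    matEval N (Polynomial.C q) = Matrix.scalar (Fin N) (symbEval N q) :=
  Polynomial.eval₂_C _ _

theorem matEval_X (N : ℕ) : matEval N Polynomial.X = (genMat N).transpose :=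
  Polynomial.eval₂_X _ _

theorem trace_matEval (N : ℕ) (s : Polynomial Symb) :
    (matEval N s).trace = symbEval N (symbTrace s) := by
  induction s using Polynomial.induction_on' with
  | add p q hp hq => rw [map_add, Matrix.trace_add, hp, hq, map_add, map_add]
  | monomial n a =>
    rw [symbTrace_monomial, map_mul, symbEval_powSymb, ← Polynomial.C_mul_X_pow_eq_monomial,
      map_mul, map_pow, matEval_C, matEval_X, Matrix.trace, Matrix.trace, Finset.mul_sum]
    exact Finset.sum_congr rfl fun i _ => scalar_mul_apply' _ _ _ _

/-- The symbolic coproduct computes `delta`. -/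
theorem delta_symbEval (N : ℕ) (q : Symb) : delta N (symbEval N q) = matEval N (symbDelta q) := by
  have h : (delta N).toRingHom.comp (symbEval N) = (matEval N).comp symbDelta.toRingHom := by
    refine MvPolynomial.ringHom_ext (fun a => ?_) (fun k => ?_)
    · change delta N (symbEval N (MvPolynomial.C a)) = matEval N (symbDelta (MvPolynomial.C a))
      rw [symbDelta, MvPolynomial.aeval_C]
      change _ = matEval N (Polynomial.C (MvPolynomial.C a))
      rw [matEval_C, symbEval_C, AlgHom.commutes]
      rfl
    · change delta N (symbEval N (MvPolynomial.X k)) = matEval N (symbDelta (MvPolynomial.X k))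
      rw [symbDelta, MvPolynomial.aeval_X, map_add, matEval_C, symbEval_X, delta_psiExt, increment,
        map_sub, map_pow, map_pow, map_add, map_one, matEval_X]
  exact DFunLike.congr_fun h q

/-- The symbolic generator computes `genOp`. -/
theorem genOp_symbEval (N : ℕ) (q : Symb) : genOp N (symbEval N q) = symbEval N (symbGen q) := by
  rw [genOp_apply, traceOp_apply, Matrix.map_one _ (map_zero _) (map_one _), mul_one,
    delta_symbEval, symbGen_apply, ← trace_matEval, symbDiff_apply, map_sub, Matrix.trace_sub,
    matEval_C, Matrix.scalar_apply, Matrix.trace_diagonal, Finset.sum_const, Finset.card_univ,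
    Fintype.card_fin, ← Nat.cast_smul_eq_nsmul ℂ]

theorem genOp_pow_symbEval (N n : ℕ) (q : Symb) :
    (genOp N ^ n) (symbEval N q) = symbEval N ((symbGen ^ n) q) := by
  induction n with
  | zero => rfl
  | succ n ih => rw [pow_succ', pow_succ', Module.End.mul_apply, ih, genOp_symbEval]; rfl

/-- The values of the counit on the elements `psiExt N k`. -/
def powSum (N k : ℕ) : ℝ := ∑ m ∈ Finset.range N, (-(m : ℝ)) ^ k

theorem counit_edge {N : ℕ} (m i j : Fin N) :
    counit N (edge m i j) = if i = j then -((m : ℕ) : ℂ) else 0 := by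
  have h : ∀ i j, counit N (gen N i j) = 0 := fun i j => counit_toU _
  rw [edge]
  split_ifs
  · rw [map_sub, h, AlgHom.commutes, zero_sub]
    rfl
  · exact h _ _

/-- The counit only sees the constant paths, whose first return is at time one. -/
theorem counit_psi (N k : ℕ) (hk : k ≠ 0) : counit N (psi N k) = powSum N k := by
  rw [psi, map_sum, powSum, Finset.sum_range, Complex.ofReal_sum]
  refine Finset.sum_congr rfl fun m _ => ?_
  rw [map_sum, Finset.sum_eq_single fun _ => m]
  · have h1 : firstReturn (fun _ : Fin (k + 1) => m) = 1 := by
      refine le_antisymm (Nat.sInf_le ⟨le_rfl, by omega, rfl⟩) (le_csInf ⟨1, le_rfl, by omega, rfl⟩ ?_)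
      exact fun j hj => hj.1
    rw [pathElem, h1, Nat.cast_one, one_smul, map_list_prod]
    simp [counit_edge]
  · intro v _ hv
    have : ∃ i : Fin k, v i.castSucc ≠ v i.succ := by
      by_contra! h
      have hc : ∀ i, v i = v 0 := fun i => by
        induction i using Fin.induction with
        | zero => rfl
        | succ i ih => rw [← h i, ih]
      simp only [paths, Finset.mem_filter] at *
      exact hv (funext fun i => by rw [hc i]; tauto)
    obtain ⟨i, hi⟩ := this
    rw [pathElem, map_smul, map_list_prod, List.map_ofFn]
    rw [List.prod_eq_zero, smul_zero]
    rw [List.mem_ofFn]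
    exact ⟨i, by rw [Function.comp_apply, counit_edge, if_neg hi]⟩
  · intro h
    exact absurd (by simp [paths]) h

theorem counit_psiExt (N k : ℕ) : counit N (psiExt N k) = powSum N k := by
  rw [psiExt]
  split_ifs with h
  · rw [map_natCast, h, powSum]
    simp
  · exact counit_psi N k h

/-- The evaluation of symbols at the values of the counit. -/
def symbVal (N : ℕ) : Symb →ₐ[ℝ] ℝ := MvPolynomial.aeval (powSum N)

theorem counit_symbEval (N : ℕ) (q : Symb) : counit N (symbEval N q) = symbVal N q := by
  have h : (counit N).toRingHom.comp (symbEval N) =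
      Complex.ofRealHom.comp (symbVal N).toRingHom := by
    refine MvPolynomial.ringHom_ext (fun a => ?_) (fun k => ?_)
    · change counit N (symbEval N (MvPolynomial.C a)) = (symbVal N (MvPolynomial.C a) : ℝ)
      rw [symbVal, MvPolynomial.aeval_C, symbEval_C, AlgHom.commutes]
      rfl
    · change counit N (symbEval N (MvPolynomial.X k)) = (symbVal N (MvPolynomial.X k) : ℝ)
      rw [symbVal, MvPolynomial.aeval_X, symbEval_X, counit_psiExt]
  exact DFunLike.congr_fun h q

/-- The evaluation of polynomials over the symbols at the values of the counit and a given time. -/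
def timeVal (N : ℕ) (t : ℝ) : Polynomial Symb →+* ℝ :=
  Polynomial.eval₂RingHom (symbVal N).toRingHom t

theorem timeVal_eq_sum (N : ℕ) (t : ℝ) (s : Polynomial Symb) {K : ℕ} (hK : s.natDegree < K) :
    timeVal N t s = ∑ n ∈ Finset.range K, symbVal N (s.coeff n) * t ^ n :=
  Polynomial.eval₂_eq_sum_range' _ hK _

/-- The state of an element given by a symbol. -/
theorem state_symbEval (N : ℕ) (t : ℝ) (q : Symb) :
    state N t (symbEval N q) = timeVal N t (symbExp q) := by
  obtain ⟨K, hK⟩ := exists_state_eq_sum t (symbEval N q)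
  rw [hK (max K ((symbExp q).natDegree + 1)) (le_max_left _ _),
    timeVal_eq_sum N t _ (lt_of_lt_of_le (Nat.lt_succ_self _) (le_max_right K _)),
    Complex.ofReal_sum]
  refine Finset.sum_congr rfl fun n _ => ?_
  rw [genOp_pow_symbEval, counit_symbEval, coeff_symbExp, map_smul, smul_eq_mul]
  push_cast
  ring

/-- The Markov operators on the elements given by symbols. -/
theorem markov_symbEval (N : ℕ) (t : ℝ) {q : Symb} {d : ℕ} (hq : q ∈ filt d) :
    markov N t (symbEval N q) = ∑ n ∈ Finset.range (d + 1),
      symbEval N ((t ^ n / (n.factorial : ℝ)) • (symbGen ^ n) q) := by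
  obtain ⟨K, hK⟩ := exists_markov_eq_sum t (symbEval N q)
  rw [hK (max K (d + 1)) (le_max_left _ _)]
  have h : ∀ n, ((t : ℂ) ^ n / (n.factorial : ℂ)) • (genOp N ^ n) (symbEval N q) =
      symbEval N ((t ^ n / (n.factorial : ℝ)) • (symbGen ^ n) q) := fun n => by
    rw [genOp_pow_symbEval, symbEval_smul]
    push_cast
    rfl
  simp only [h]
  symm
  refine Finset.sum_subset (Finset.range_subset_range.2 (le_max_right _ _)) fun n _ hn => ?_
  rw [Finset.mem_range] at hn
  rw [eq_zero_of_mem_filt (by omega) (symbGen_pow_mem_filt hq n), smul_zero, map_zero]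

theorem cov_eq (N : ℕ) (t : ℝ) (X Y : Ugl N) :
    cov N t X Y = state N t (X * Y) - state N t X * state N t Y := by
  rw [cov, sub_mul, mul_sub, mul_sub, map_sub, map_sub, map_sub, ← Algebra.commutes, ← map_mul,
    ← Algebra.smul_def, ← Algebra.smul_def, Algebra.algebraMap_eq_smul_one, map_smul, map_smul,
    map_smul, (isStateRec_state t).1]
  simp only [smul_eq_mul]
  ring

theorem cov_symbEval (N : ℕ) (t : ℝ) (x y : Symb) :
    cov N t (symbEval N x) (symbEval N y) = timeVal N t (symbCov x y) := by
  rw [cov_eq, ← map_mul, state_symbEval, state_symbEval, state_symbEval, symbCov, map_sub, map_mul]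
  push_cast
  rfl

theorem symbEval_X_of_pos (N : ℕ) {k : ℕ} (hk : k ≠ 0) :
    symbEval N (MvPolynomial.X k) = psi N k := by
  rw [symbEval_X, psiExt, if_neg hk]

/-- The symbol of `Ψ_ρ`. -/
def partSymb {n : ℕ} (ρ : n.Partition) : Symb := (ρ.parts.map MvPolynomial.X).prod

theorem symbEval_partSymb (N : ℕ) {n : ℕ} (ρ : n.Partition) :
    symbEval N (partSymb ρ) = psiPart N ρ := by
  rw [partSymb, psiPart, ← Multiset.sort_eq ρ.parts (· ≥ ·), Multiset.map_coe, Multiset.prod_coe,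
    map_list_prod, List.map_map, Multiset.sort_eq]
  refine congrArg List.prod (List.map_congr_left fun k hk => ?_)
  exact symbEval_X_of_pos N (ρ.parts_pos ((Multiset.mem_sort _).1 hk)).ne'

theorem multiset_prod_X_mem_filt (s : Multiset ℕ) :
    (s.map MvPolynomial.X).prod ∈ filt (s.sum + s.card) := by
  induction s using Multiset.induction_on with
  | empty => simpa using C_mem_filt 1 le_rfl
  | cons k s ih =>
    rw [Multiset.map_cons, Multiset.prod_cons, Multiset.sum_cons, Multiset.card_cons]
    refine filt_mono ?_ (mul_mem_filt (X_mem_filt k) ih)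
    push_cast
    omega

end Evaluation

/-! ### Limits of normalized expectations -/

section Limits

open Filter Topology

theorem tendsto_floor_pow {η : ℝ} (hη : 0 ≤ η) {j d : ℕ} (h : j ≤ d) :
    ∃ ℓ : ℝ, Tendsto (fun L : ℝ => (⌊η * L⌋₊ : ℝ) ^ j / L ^ d) atTop (𝓝 ℓ) := by
  have h1 : Tendsto (fun L : ℝ => (⌊η * L⌋₊ / L : ℝ) ^ j * (L⁻¹) ^ (d - j)) atTop
      (𝓝 (η ^ j * 0 ^ (d - j))) :=
    ((tendsto_nat_floor_mul_div_atTop hη).pow j).mul (tendsto_inv_atTop_zero.pow _)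
  refine ⟨_, h1.congr' ?_⟩
  filter_upwards [eventually_gt_atTop 0] with L hL
  rw [div_pow, inv_pow, ← div_eq_mul_inv, div_div, ← pow_add, Nat.add_sub_cancel' h]

/-- The normalized power sums converge, by the Bernoulli formula. -/
theorem tendsto_powSum {η : ℝ} (hη : 0 ≤ η) (k : ℕ) :
    ∃ ℓ : ℝ, Tendsto (fun L : ℝ => powSum ⌊η * L⌋₊ k / L ^ (k + 1)) atTop (𝓝 ℓ) := by
  choose ℓ hℓ using fun i : ℕ => tendsto_floor_pow hη (Nat.sub_le (k + 1) i)
  refine ⟨_, (tendsto_finsetSum (Finset.range (k + 1)) fun i _ => (hℓ i).const_mul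
    ((-1) ^ k * ((bernoulli i : ℝ) * ((k + 1).choose i : ℝ) / (k + 1)))).congr fun L => ?_⟩
  have h := congrArg (fun q : ℚ => (q : ℝ)) (sum_range_pow ⌊η * L⌋₊ k)
  push_cast at h
  have h1 : powSum ⌊η * L⌋₊ k = (-1) ^ k * ∑ m ∈ Finset.range ⌊η * L⌋₊, (m : ℝ) ^ k := by
    rw [powSum, Finset.mul_sum]
    exact Finset.sum_congr rfl fun m _ => neg_pow _ _
  rw [h1, h, Finset.mul_sum, Finset.sum_div]
  refine Finset.sum_congr rfl fun i _ => ?_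
  ring

theorem tendsto_symbVal {η : ℝ} (hη : 0 ≤ η) {d : ℤ} {q : Symb} (hq : q ∈ filt d) :
    ∃ ℓ : ℝ, Tendsto (fun L : ℝ => symbVal ⌊η * L⌋₊ q / L ^ d) atTop (𝓝 ℓ) := by
  refine filt_induction (P := fun d q => ∃ ℓ : ℝ,
    Tendsto (fun L : ℝ => symbVal ⌊η * L⌋₊ q / L ^ d) atTop (𝓝 ℓ)) (fun d => ?_) ?_ ?_ ?_ hq
  · exact ⟨0, by simp⟩
  · rintro d p q ⟨a, ha⟩ ⟨b, hb⟩
    refine ⟨a + b, (ha.add hb).congr fun L => ?_⟩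
    rw [map_add, add_div]
  · intro d a hd
    lift d to ℕ using hd
    refine ⟨a * 0 ^ d, ((tendsto_inv_atTop_zero.pow d).const_mul a).congr fun L => ?_⟩
    rw [symbVal, MvPolynomial.aeval_C, zpow_natCast, inv_pow]
    rfl
  · rintro d p n - - ⟨a, ha⟩
    obtain ⟨b, hb⟩ := tendsto_powSum hη n
    refine ⟨a * b, (ha.mul hb).congr' ?_⟩
    filter_upwards [eventually_gt_atTop 0] with L hL
    rw [map_mul, zpow_add₀ hL.ne', div_mul_div_comm, symbVal, MvPolynomial.aeval_X]
    norm_cast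

/-- Values of polynomials of weight at most `d` are of order at most `L ^ d`, with a limit. -/
theorem tendsto_timeVal {η : ℝ} (hη : 0 ≤ η) (τ : ℝ) {d : ℤ} {s : Polynomial Symb}
    (hs : s ∈ polyFilt d) :
    ∃ ℓ : ℝ, Tendsto (fun L : ℝ => timeVal ⌊η * L⌋₊ (τ * L) s / L ^ d) atTop (𝓝 ℓ) := by
  choose ℓ hℓ using fun n : ℕ => tendsto_symbVal hη (hs n)
  refine ⟨_, (tendsto_finsetSum (Finset.range (s.natDegree + 1)) fun n _ =>
    (hℓ n).mul_const (τ ^ n)).congr' ?_⟩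
  filter_upwards [eventually_gt_atTop 0] with L hL
  rw [timeVal_eq_sum _ _ _ (Nat.lt_succ_self _), Finset.sum_div]
  refine Finset.sum_congr rfl fun n _ => ?_
  rw [zpow_sub₀ hL.ne', zpow_natCast, mul_pow]
  have := zpow_ne_zero d hL.ne'
  field_simp

theorem tendsto_timeVal_zero {η : ℝ} (hη : 0 ≤ η) (τ : ℝ) {d d' : ℤ} {s : Polynomial Symb}
    (hs : s ∈ polyFilt d) (h : d < d') :
    Tendsto (fun L : ℝ => timeVal ⌊η * L⌋₊ (τ * L) s / L ^ d') atTop (𝓝 0) := by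
  obtain ⟨ℓ, hℓ⟩ := tendsto_timeVal hη τ (polyFilt_mono (Int.le_sub_one_of_lt h) hs)
  have := hℓ.mul tendsto_inv_atTop_zero
  rw [mul_zero] at this
  refine this.congr' ?_
  filter_upwards [eventually_gt_atTop 0] with L hL
  rw [zpow_sub₀ hL.ne', zpow_one]
  field_simp

/-- The limit of `⟨Ψ_k⟩_{xL} / L ^ (k + 1)` for `N = ⌊L⌋`. -/
def profile (k : ℕ) (x : ℝ) : ℝ :=
  (tendsto_timeVal zero_le_one x (symbExp_mem_polyFilt (X_mem_filt k))).choose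

theorem tendsto_profile (k : ℕ) (x : ℝ) : Tendsto (fun L : ℝ =>
    timeVal ⌊L⌋₊ (x * L) (symbExp (MvPolynomial.X k)) / L ^ (k + 1)) atTop (𝓝 (profile k x)) := by
  refine (tendsto_timeVal zero_le_one x (symbExp_mem_polyFilt (X_mem_filt k))).choose_spec.congr
    fun L => ?_
  rw [one_mul]
  norm_cast

/-- The general limit results from the case `N = ⌊L⌋` by rescaling `L`. -/
theorem tendsto_timeVal_X {η : ℝ} (hη : 0 < η) (τ : ℝ) (k : ℕ) : Tendsto (fun L : ℝ =>
    timeVal ⌊η * L⌋₊ (τ * L) (symbExp (MvPolynomial.X k)) / L ^ (k + 1)) atTop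
    (𝓝 (η ^ (k + 1) * profile k (τ / η))) := by
  have h := ((tendsto_profile k (τ / η)).comp
    (tendsto_id.const_mul_atTop hη)).const_mul (η ^ (k + 1))
  refine h.congr' ?_
  filter_upwards [eventually_gt_atTop 0] with L hL
  simp only [Function.comp_apply, id_eq]
  rw [show τ / η * (η * L) = τ * L by field_simp, mul_pow]
  have h1 := pow_ne_zero (k + 1) hη.ne'
  have h2 := pow_ne_zero (k + 1) hL.ne'
  field_simp

/-- Expectations are asymptotically multiplicative. -/
theorem tendsto_timeVal_prod {η : ℝ} (hη : 0 < η) (τ : ℝ) (s : Multiset ℕ) : Tendsto (fun L : ℝ =>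
    timeVal ⌊η * L⌋₊ (τ * L) (symbExp (s.map MvPolynomial.X).prod) / L ^ (s.sum + s.card)) atTop
    (𝓝 (s.map fun k => η ^ (k + 1) * profile k (τ / η)).prod) := by
  induction s using Multiset.induction_on with
  | empty =>
    have h : symbExp 1 = 1 := by
      rw [← MvPolynomial.C_1, symbExp_C, MvPolynomial.C_1, map_one]
    simp [h]
  | cons k s ih =>
    rw [Multiset.map_cons, Multiset.map_cons, Multiset.prod_cons, Multiset.prod_cons,
      Multiset.sum_cons, Multiset.card_cons]
    have h1 := tendsto_timeVal_zero hη.le τ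
      (symbCov_mem_polyFilt (X_mem_filt k) (multiset_prod_X_mem_filt s))
      (d' := ((k + s.sum + (s.card + 1) : ℕ) : ℤ)) (by push_cast; omega)
    have h2 := h1.add ((tendsto_timeVal_X hη τ k).mul ih)
    rw [zero_add] at h2
    refine h2.congr' ?_
    filter_upwards [eventually_gt_atTop 0] with L hL
    rw [symbCov, map_sub, map_mul, zpow_natCast, div_mul_div_comm, ← pow_add,
      show k + 1 + (s.sum + s.card) = k + s.sum + (s.card + 1) by ring, ← add_div, sub_add_cancel]

end Limits

/-! ### Positivity of the expectations -/

section Positivity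

variable {N : ℕ}

/-- The sums of products of generators. -/
inductive IsPos : Ugl N → Prop
  | zero : IsPos 0
  | one : IsPos 1
  | add {x y : Ugl N} : IsPos x → IsPos y → IsPos (x + y)
  | mul_gen {x : Ugl N} (i j : Fin N) : IsPos x → IsPos (x * gen N i j)

theorem IsPos.nsmul {x : Ugl N} (hx : IsPos x) (n : ℕ) : IsPos (n • x) := by
  induction n with
  | zero => rw [zero_smul]; exact IsPos.zero
  | succ n ih => rw [succ_nsmul]; exact ih.add hx

theorem IsPos.sum {ι : Type*} {s : Finset ι} {f : ι → Ugl N} (h : ∀ i ∈ s, IsPos (f i)) :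
    IsPos (∑ i ∈ s, f i) :=
  Finset.sum_induction f IsPos (fun _ _ => IsPos.add) IsPos.zero h

theorem traceOp_zero (x : Ugl N) : traceOp 0 x = 0 := by simp [traceOp_apply]

theorem IsPos.traceOp_single {x : Ugl N} (hx : IsPos x) (i j : Fin N) :
    IsPos (traceOp (Matrix.single i j 1) x) := by
  induction hx generalizing i j with
  | zero => rw [map_zero]; exact IsPos.zero
  | one =>
    rw [traceOp_one]
    by_cases h : i = j
    · rw [h, Matrix.trace_single_eq_same, map_one]; exact IsPos.one
    · rw [Matrix.trace_single_eq_of_ne _ _ _ h, map_zero]; exact IsPos.zero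
  | add _ _ hx hy => rw [map_add]; exact (hx i j).add (hy i j)
  | mul_gen k l _ ih =>
    rw [gen, traceOp_mul_toU]
    refine ((ih i j).mul_gen k l).add ?_
    by_cases h : l = i
    · rw [h, Matrix.single_mul_single_same, one_mul]; exact ih k j
    · rw [Matrix.single_mul_single_of_ne _ _ _ _ h, traceOp_zero]; exact IsPos.zero

theorem IsPos.genOp {x : Ugl N} (hx : IsPos x) : IsPos (genOp N x) := by
  induction hx with
  | zero => rw [map_zero]; exact IsPos.zero
  | one => rw [genOp_one]; exact IsPos.zero
  | add _ _ hx hy => rw [map_add]; exact hx.add hy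
  | mul_gen k l hx ih =>
    rw [gen, genOp_mul_toU]
    exact (ih.mul_gen k l).add (hx.traceOp_single k l)

theorem IsPos.genOp_pow {x : Ugl N} (hx : IsPos x) (n : ℕ) : IsPos ((GLWalk.genOp N ^ n) x) := by
  induction n with
  | zero => exact hx
  | succ n ih => rw [pow_succ', Module.End.mul_apply]; exact ih.genOp

theorem IsPos.counit {x : Ugl N} (hx : IsPos x) : ∃ n : ℕ, counit N x = n := by
  induction hx with
  | zero => exact ⟨0, by simp⟩
  | one => exact ⟨1, by simp⟩
  | add _ _ hx hy =>
    obtain ⟨a, ha⟩ := hx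
    obtain ⟨b, hb⟩ := hy
    exact ⟨a + b, by rw [map_add, ha, hb, Nat.cast_add]⟩
  | mul_gen k l _ _ => exact ⟨0, by rw [map_mul, gen, counit_toU, mul_zero, Nat.cast_zero]⟩

theorem isPos_transpose_pow_apply (n : ℕ) (i j : Fin N) :
    IsPos (((genMat N).transpose ^ n) i j) := by
  induction n generalizing i j with
  | zero =>
    rw [pow_zero, Matrix.one_apply]
    split_ifs
    exacts [IsPos.one, IsPos.zero]
  | succ n ih =>
    rw [pow_succ, Matrix.mul_apply]
    exact IsPos.sum fun l _ => (ih i l).mul_gen j l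

theorem exists_transpose_pow_apply_self (n : ℕ) (i : Fin N) :
    ∃ p, IsPos p ∧ ((genMat N).transpose ^ n) i i = gen N i i ^ n + p := by
  induction n with
  | zero => exact ⟨0, IsPos.zero, by simp⟩
  | succ n ih =>
    obtain ⟨p, hp, h⟩ := ih
    refine ⟨p * gen N i i + ∑ l ∈ Finset.univ.erase i,
      ((genMat N).transpose ^ n) i l * gen N i l, (hp.mul_gen i i).add
        (IsPos.sum fun l _ => (isPos_transpose_pow_apply n i l).mul_gen i l), ?_⟩
    rw [pow_succ, Matrix.mul_apply, ← Finset.add_sum_erase _ _ (Finset.mem_univ i), h, pow_succ,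
      ← add_assoc]
    congr 1
    rw [← add_mul]
    rfl

theorem exists_traceOp_gen_pow (n : ℕ) (i : Fin N) :
    ∃ p, IsPos p ∧ traceOp (Matrix.single i i 1) (gen N i i ^ n) = gen N i i ^ n + p := by
  induction n with
  | zero =>
    exact ⟨0, IsPos.zero, by
      rw [pow_zero, traceOp_one, Matrix.trace_single_eq_same, map_one, add_zero]⟩
  | succ n ih =>
    obtain ⟨p, hp, h⟩ := ih
    have hg : ∀ n, IsPos (gen N i i ^ n) := fun n => by
      induction n with
      | zero => rw [pow_zero]; exact IsPos.one
      | succ n ih => rw [pow_succ]; exact ih.mul_gen i i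
    refine ⟨p * gen N i i + (gen N i i ^ n + p), (hp.mul_gen i i).add ((hg n).add hp), ?_⟩
    have h1 := traceOp_mul_toU (Matrix.single i i 1) (Matrix.single i i 1) (gen N i i ^ n)
    rw [Matrix.single_mul_single_same, one_mul, h] at h1
    rw [pow_succ]
    refine h1.trans ?_
    rw [add_mul, add_assoc]
    rfl

theorem exists_counit_genOp_pow_gen_pow (n : ℕ) (i : Fin N) :
    ∃ a : ℕ, counit N ((genOp N ^ n) (gen N i i ^ n)) = n.factorial + a := by
  induction n with
  | zero => exact ⟨0, by simp⟩
  | succ n ih =>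
    obtain ⟨a, ha⟩ := ih
    obtain ⟨p, hp, h⟩ := exists_traceOp_gen_pow n i
    obtain ⟨b, hb⟩ := (hp.genOp_pow n).counit
    refine ⟨(n + 1) * (a + b), ?_⟩
    rw [pow_succ (gen N i i)]
    refine (counit_genOp_pow_mul_toU _ n _).trans ?_
    rw [h, map_add, map_add, ha, hb, Nat.factorial_succ]
    push_cast
    ring

theorem symbEval_symbGen_X (k : ℕ) : symbEval N (symbGen (MvPolynomial.X k)) =
    ∑ j ∈ Finset.range k, k.choose j • ((genMat N).transpose ^ j).trace := by
  rw [symbGen_apply, symbDiff_X, increment_eq, map_sum, map_sum]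
  refine Finset.sum_congr rfl fun j _ => ?_
  rw [symbTrace_monomial, map_mul, symbEval_powSymb, map_natCast, nsmul_eq_mul]

theorem isPos_trace_transpose_pow (n : ℕ) : IsPos ((genMat N).transpose ^ n).trace :=
  IsPos.sum fun i _ => isPos_transpose_pow_apply n i i

/-- The image of `Ψ_k` under the generator is a sum of products of generators, and this property is
preserved by the generator. -/
theorem symbVal_symbGen_pow_nonneg (N k n : ℕ) :
    0 ≤ symbVal N ((symbGen ^ (n + 1)) (MvPolynomial.X k)) := by
  have h : IsPos (symbEval N (symbGen (MvPolynomial.X k))) := by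
    rw [symbEval_symbGen_X]
    exact IsPos.sum fun j _ => (isPos_trace_transpose_pow j).nsmul _
  obtain ⟨a, ha⟩ := (h.genOp_pow n).counit
  rw [genOp_pow_symbEval, counit_symbEval, ← Module.End.mul_apply, ← pow_succ] at ha
  have : symbVal N ((symbGen ^ (n + 1)) (MvPolynomial.X k)) = a := by exact_mod_cast ha
  rw [this]
  exact Nat.cast_nonneg a

/-- The coefficient of `t ^ k` in `⟨Ψ_k⟩_t` is at least `N`, because of the summands `E_ii ^ (k - 1)`
of the trace of the `(k - 1)`-st power. -/
theorem le_symbVal_symbGen_pow (N : ℕ) {k : ℕ} (hk : k ≠ 0) :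
    (N : ℝ) * k.factorial ≤ symbVal N ((symbGen ^ k) (MvPolynomial.X k)) := by
  obtain ⟨n, rfl⟩ := Nat.exists_eq_succ_of_ne_zero hk
  rw [Nat.succ_eq_add_one]
  have h1 : IsPos (∑ j ∈ Finset.range n, (n + 1).choose j • ((genMat N).transpose ^ j).trace) :=
    IsPos.sum fun j _ => (isPos_trace_transpose_pow j).nsmul _
  choose p hp h2 using exists_transpose_pow_apply_self (N := N) n
  choose a ha using exists_counit_genOp_pow_gen_pow (N := N) n
  obtain ⟨b, hb⟩ := (h1.genOp_pow n).counit
  choose c hc using fun i => ((hp i).genOp_pow n).counit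
  have h3 : (symbVal N ((symbGen ^ (n + 1)) (MvPolynomial.X (n + 1))) : ℂ) =
      b + (n + 1) * ∑ i, ((n.factorial : ℂ) + a i + c i) := by
    rw [← counit_symbEval, pow_succ, Module.End.mul_apply, ← genOp_pow_symbEval,
      symbEval_symbGen_X, Finset.sum_range_succ, map_add, map_add, hb, map_nsmul, map_nsmul,
      Nat.choose_succ_self_right, nsmul_eq_mul, Matrix.trace, map_sum, map_sum]
    simp only [Matrix.diag_apply, h2, map_add, ha, hc]
    push_cast
    rfl
  have h4 : symbVal N ((symbGen ^ (n + 1)) (MvPolynomial.X (n + 1))) =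
      b + (n + 1) * ∑ i, ((n.factorial : ℝ) + a i + c i) := by exact_mod_cast h3
  rw [h4, Finset.sum_add_distrib, Finset.sum_add_distrib, Finset.sum_const, Finset.card_univ,
    Fintype.card_fin, nsmul_eq_mul, Nat.factorial_succ]
  push_cast
  have h5 : (0 : ℝ) ≤ ∑ i, (a i : ℝ) := Finset.sum_nonneg fun i _ => Nat.cast_nonneg _
  have h6 : (0 : ℝ) ≤ ∑ i, (c i : ℝ) := Finset.sum_nonneg fun i _ => Nat.cast_nonneg _
  have h7 : (0 : ℝ) ≤ b := Nat.cast_nonneg b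
  have h8 : (0 : ℝ) ≤ n := Nat.cast_nonneg n
  have h9 := mul_nonneg h8 h5
  have h10 := mul_nonneg h8 h6
  linarith

theorem mul_pow_sub_pow_le (N : ℕ) {k : ℕ} (hk : k ≠ 0) {t t' : ℝ} (ht : 0 ≤ t) (h : t ≤ t') :
    N * (t' ^ k - t ^ k) ≤ timeVal N t' (symbExp (MvPolynomial.X k)) -
      timeVal N t (symbExp (MvPolynomial.X k)) := by
  set s := symbExp (MvPolynomial.X k) with hs
  have hK : s.natDegree < max s.natDegree k + 1 := Nat.lt_succ_of_le (le_max_left _ _)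
  rw [timeVal_eq_sum N t' s hK, timeVal_eq_sum N t s hK, ← Finset.sum_sub_distrib]
  have hpow : ∀ n, 0 ≤ t' ^ n - t ^ n := fun n => sub_nonneg.2 (pow_le_pow_left₀ ht h n)
  refine le_trans ?_ (Finset.single_le_sum (fun n _ => ?_)
    (Finset.mem_range.2 (Nat.lt_succ_of_le (le_max_right s.natDegree k))))
  · rw [← mul_sub, hs, coeff_symbExp, map_smul, smul_eq_mul]
    refine mul_le_mul_of_nonneg_right ?_ (hpow k)
    have h1 := le_symbVal_symbGen_pow N hk
    rw [inv_mul_eq_div, le_div_iff₀ (Nat.cast_pos.2 k.factorial_pos)]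
    exact h1
  · rw [← mul_sub]
    cases n with
    | zero => simp
    | succ n =>
      refine mul_nonneg ?_ (hpow _)
      rw [hs, coeff_symbExp, map_smul, smul_eq_mul]
      exact mul_nonneg (inv_nonneg.2 (Nat.cast_nonneg _)) (symbVal_symbGen_pow_nonneg N k n)

end Positivity

/-! ### The profile of the expectations -/

section Profile

open Filter Topology

theorem pow_sub_pow_le_profile {k : ℕ} (hk : k ≠ 0) {x x' : ℝ} (hx : 0 ≤ x) (h : x ≤ x') :
    x' ^ k - x ^ k ≤ profile k x' - profile k x := by
  have h1 : Tendsto (fun L : ℝ => (⌊L⌋₊ / L : ℝ) * (x' ^ k - x ^ k)) atTop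
      (𝓝 (1 * (x' ^ k - x ^ k))) :=
    Tendsto.mul_const _ (tendsto_nat_floor_div_atTop)
  rw [one_mul] at h1
  refine le_of_tendsto_of_tendsto h1 ((tendsto_profile k x').sub (tendsto_profile k x)) ?_
  filter_upwards [eventually_gt_atTop 0] with L hL
  rw [← sub_div, le_div_iff₀ (pow_pos hL _)]
  refine le_trans (le_of_eq ?_) (mul_pow_sub_pow_le ⌊L⌋₊ hk (mul_nonneg hx hL.le)
    (mul_le_mul_of_nonneg_right h hL.le))
  rw [mul_pow, mul_pow, pow_succ]
  field_simp

theorem profile_zero_nonneg {k : ℕ} (hk : Even k) : 0 ≤ profile k 0 := by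
  refine ge_of_tendsto (tendsto_profile k 0) ?_
  filter_upwards [eventually_gt_atTop 0] with L hL
  refine div_nonneg ?_ (pow_nonneg hL.le _)
  have h : timeVal ⌊L⌋₊ 0 (symbExp (MvPolynomial.X k)) = symbVal ⌊L⌋₊ (MvPolynomial.X k) := by
    rw [← coeff_zero_symbExp (MvPolynomial.X k)]
    refine (Polynomial.eval₂_at_zero _).trans ?_
    rw [coeff_zero_symbExp]
    rfl
  rw [zero_mul, h, symbVal, MvPolynomial.aeval_X]
  exact Finset.sum_nonneg fun m _ => hk.pow_nonneg _

theorem profile_lt {k : ℕ} (hk : k ≠ 0) {x x' : ℝ} (hx : 0 ≤ x) (h : x < x') :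
    profile k x < profile k x' :=
  sub_pos.1 ((sub_pos.2 (pow_lt_pow_left₀ h hx hk)).trans_le (pow_sub_pow_le_profile hk hx h.le))

theorem profile_pos_of_even {k : ℕ} (hk : k ≠ 0) (he : Even k) {x : ℝ} (hx : 0 < x) :
    0 < profile k x :=
  (profile_zero_nonneg he).trans_lt (profile_lt hk le_rfl hx)

/-- The profile is strictly increasing, hence has at most one positive zero. -/
theorem exists_profile_ne_zero : ∃ r : ℕ → ℝ, ∀ k, k ≠ 0 → ∀ x, 0 < x → x ≠ r k →
    profile k x ≠ 0 := by
  have h : ∀ k : ℕ, ∃ r : ℝ, k ≠ 0 → ∀ x, 0 < x → x ≠ r → profile k x ≠ 0 := fun k => by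
    by_cases h : ∃ r, 0 < r ∧ profile k r = 0
    · obtain ⟨r, hr, h0⟩ := h
      refine ⟨r, fun hk x hx hxr hx0 => ?_⟩
      rcases lt_or_gt_of_ne hxr with h1 | h1
      · exact absurd (profile_lt hk hx.le h1) (by rw [hx0, h0]; exact lt_irrefl 0)
      · exact absurd (profile_lt hk hr.le h1) (by rw [hx0, h0]; exact lt_irrefl 0)
    · exact ⟨0, fun _ x hx _ hx0 => h ⟨x, hx, hx0⟩⟩
  choose r hr using h
  exact ⟨r, hr⟩

/-- Expectations of the `Ψ_ρ` are of the order of their weight, unless the profile of an odd part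
vanishes. -/
theorem exists_isTheta_state : ∃ r : ℕ → ℝ, ∀ (n : ℕ) (ρ : n.Partition) (η τ : ℝ), 0 < η → 0 < τ →
    ((fun L : ℝ => state ⌊η * L⌋₊ (τ * L) (psiPart ⌊η * L⌋₊ ρ)) =O[atTop] fun L : ℝ => L ^ wt ρ) ∧
    ((∀ k ∈ ρ.parts, Odd k → τ / η ≠ r k) →
      (fun L : ℝ => state ⌊η * L⌋₊ (τ * L) (psiPart ⌊η * L⌋₊ ρ)) =Θ[atTop]
        fun L : ℝ => L ^ wt ρ) := by
  obtain ⟨r, hr⟩ := exists_profile_ne_zero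
  refine ⟨r, fun n ρ η τ hη hτ => ?_⟩
  have h1 : (fun L : ℝ => state ⌊η * L⌋₊ (τ * L) (psiPart ⌊η * L⌋₊ ρ)) =Θ[atTop]
      fun L : ℝ => timeVal ⌊η * L⌋₊ (τ * L) (symbExp (partSymb ρ)) := by
    refine Asymptotics.IsTheta.of_norm_eventuallyEq_norm (Eventually.of_forall fun L => ?_)
    simp only
    rw [← symbEval_partSymb, state_symbEval, Complex.norm_real]
  have h2 := tendsto_timeVal_prod hη τ ρ.parts
  have h3 : ρ.parts.sum + ρ.parts.card = wt ρ := by rw [ρ.parts_sum, wt]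
  rw [h3] at h2
  constructor
  · refine h1.1.trans (Asymptotics.isBigO_of_div_tendsto_nhds ?_ _ h2)
    filter_upwards [eventually_gt_atTop 0] with L hL h0
    exact absurd h0 (pow_pos hL _).ne'
  · intro h
    refine h1.trans (Asymptotics.isTheta_of_div_tendsto_nhds_ne_zero h2 ?_).symm
    refine Multiset.prod_ne_zero fun h0 => ?_
    obtain ⟨k, hk, h0⟩ := Multiset.mem_map.1 h0
    have hk0 : k ≠ 0 := (ρ.parts_pos hk).ne'
    refine absurd h0 (mul_ne_zero (pow_pos hη _).ne' ?_)
    rcases Nat.even_or_odd k with he | ho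
    · exact (profile_pos_of_even hk0 he (div_pos hτ hη)).ne'
    · exact hr k hk0 _ (div_pos hτ hη) (h k hk ho)

end Profile

/-! ### The expansion of the Markov operators -/

section Expansion

open Filter Topology

/-- The families of elements of `U(gl_N)`, `N = ⌊η L⌋`, which are combinations of the `Ψ_ρ` with
coefficients of the order of `L ^ (k + 1 - wt ρ)`, with a limit. -/
def HasExpansion (η : ℝ) (k : ℕ) (Y : (L : ℝ) → Ugl ⌊η * L⌋₊) : Prop :=
  ∃ (c : (n : ℕ) → n.Partition → ℝ) (f : (n : ℕ) → n.Partition → ℝ → ℝ),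
    (∀ (n : ℕ) (ρ : n.Partition), Tendsto (f n ρ) atTop (𝓝 (c n ρ))) ∧
    ∀ L : ℝ, 0 < L → Y L = ∑ n ∈ Finset.range (k + 2),
      ∑ ρ ∈ (Finset.univ : Finset n.Partition).filter (fun ρ => wt ρ ≤ k + 1),
        ((f n ρ L * L ^ (k + 1 - wt ρ) : ℝ) : ℂ) • psiPart ⌊η * L⌋₊ ρ

variable {η : ℝ} {k : ℕ}

theorem HasExpansion.zero : HasExpansion η k fun _ => 0 :=
  ⟨0, 0, fun _ _ => tendsto_const_nhds, fun L _ => by simp⟩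

theorem HasExpansion.add {Y Z : (L : ℝ) → Ugl ⌊η * L⌋₊} (hY : HasExpansion η k Y)
    (hZ : HasExpansion η k Z) : HasExpansion η k fun L => Y L + Z L := by
  obtain ⟨c, f, h1, h2⟩ := hY
  obtain ⟨c', f', h1', h2'⟩ := hZ
  refine ⟨c + c', f + f', fun n ρ => (h1 n ρ).add (h1' n ρ), fun L hL => ?_⟩
  simp only
  rw [h2 L hL, h2' L hL, ← Finset.sum_add_distrib]
  refine Finset.sum_congr rfl fun n _ => ?_
  rw [← Finset.sum_add_distrib]
  refine Finset.sum_congr rfl fun ρ _ => ?_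
  rw [← add_smul, ← Complex.ofReal_add, ← add_mul]
  rfl

theorem HasExpansion.sum {ι : Type*} (s : Finset ι) {Y : ι → (L : ℝ) → Ugl ⌊η * L⌋₊}
    (h : ∀ i ∈ s, HasExpansion η k (Y i)) : HasExpansion η k fun L => ∑ i ∈ s, Y i L := by
  classical
  induction s using Finset.induction_on with
  | empty => simpa using HasExpansion.zero
  | insert i s hi ih =>
    simp only [Finset.sum_insert hi]
    exact (h i (Finset.mem_insert_self i s)).add
      (ih fun j hj => h j (Finset.mem_insert_of_mem hj))

/-- The factors `X 0` of a monomial contribute powers of `N` to the coefficient. -/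
theorem symbEval_multiset_prod (N : ℕ) (s : Multiset ℕ) :
    symbEval N (s.map MvPolynomial.X).prod =
      ((N : ℂ) ^ s.count 0) • psiPart N (Nat.Partition.ofMultiset s) := by
  rw [← symbEval_partSymb, partSymb]
  have h : (Nat.Partition.ofMultiset s).parts = s.filter (· ≠ 0) := rfl
  rw [h]
  induction s using Multiset.induction_on with
  | empty => simp
  | cons n s ih =>
    rw [Multiset.map_cons, Multiset.prod_cons, map_mul, ih rfl]
    by_cases hn : n = 0
    · subst hn
      rw [Multiset.filter_cons_of_neg s (by simp), Multiset.count_cons_self, symbEval_X, psiExt,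
        if_pos rfl, pow_succ', mul_smul, ← map_natCast (algebraMap ℂ (Ugl N)), ← Algebra.smul_def]
    · rw [Multiset.filter_cons_of_pos s hn, Multiset.count_cons_of_ne (Ne.symm hn),
        Multiset.map_cons, Multiset.prod_cons, map_mul, mul_smul_comm]

theorem wt_ofMultiset (s : Multiset ℕ) :
    wt (Nat.Partition.ofMultiset s) + s.count 0 = s.sum + s.card := by
  have h : (Nat.Partition.ofMultiset s).parts = s.filter (· ≠ 0) := rfl
  have h1 := congrArg Multiset.card (Multiset.filter_add_not (· ≠ 0) s)
  rw [Multiset.card_add] at h1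
  have h2 : (s.filter fun a => ¬ a ≠ 0).card = s.count 0 := by
    rw [Multiset.count, Multiset.countP_eq_card_filter]
    congr 1
    exact Multiset.filter_congr fun x _ => by rw [not_not]; exact eq_comm
  rw [wt, h, ← h1, h2]
  ring

theorem hasExpansion_monomial (hη : 0 ≤ η) (a : ℝ) (s : Multiset ℕ) {j : ℕ}
    (h : s.sum + s.card + j ≤ k + 1) : HasExpansion η k fun L =>
      symbEval ⌊η * L⌋₊ ((L ^ j * a) • (s.map MvPolynomial.X).prod) := by
  classical
  set ρ₀ := Nat.Partition.ofMultiset s with hρ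
  have hw := wt_ofMultiset s
  rw [← hρ] at hw
  obtain ⟨ℓ, hℓ⟩ := tendsto_floor_pow hη (j := s.count 0) (d := k + 1 - wt ρ₀ - j) (by omega)
  have hlim : Tendsto (fun L : ℝ => L ^ j * a * (⌊η * L⌋₊ : ℝ) ^ s.count 0 / L ^ (k + 1 - wt ρ₀))
      atTop (𝓝 (a * ℓ)) := by
    refine (hℓ.const_mul a).congr' ?_
    filter_upwards [eventually_gt_atTop 0] with L hL
    rw [show k + 1 - wt ρ₀ = j + (k + 1 - wt ρ₀ - j) by omega, pow_add, Nat.add_sub_cancel_left]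
    have h1 := pow_ne_zero j hL.ne'
    field_simp
  let P : (n : ℕ) → n.Partition → Prop := fun n ρ =>
    (⟨n, ρ⟩ : Σ n : ℕ, n.Partition) = ⟨s.sum, ρ₀⟩
  have hP : P s.sum ρ₀ := rfl
  -- Only the partition `ρ₀` occurs; the quotient of powers makes the formula exact for each `L > 0`.
  refine ⟨fun n ρ => if P n ρ then a * ℓ else 0, fun n ρ L => if P n ρ then
    L ^ j * a * (⌊η * L⌋₊ : ℝ) ^ s.count 0 / L ^ (k + 1 - wt ρ₀) else 0, fun n ρ => ?_,
    fun L hL => ?_⟩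
  · beta_reduce
    split_ifs
    exacts [hlim, tendsto_const_nhds]
  · beta_reduce
    rw [Finset.sum_eq_single s.sum, Finset.sum_eq_single ρ₀, if_pos hP,
      div_mul_cancel₀ _ (pow_ne_zero _ hL.ne'), symbEval_smul, symbEval_multiset_prod, smul_smul]
    · push_cast
      rfl
    · intro ρ _ hne
      rw [if_neg fun h => hne (by simpa [P] using h), zero_mul, Complex.ofReal_zero, zero_smul]
    · intro h1
      exact absurd (Finset.mem_filter.2 ⟨Finset.mem_univ _, by omega⟩) h1
    · intro n _ hne
      refine Finset.sum_eq_zero fun ρ _ => ?_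
      rw [if_neg fun h => hne (congrArg Sigma.fst h), zero_mul, Complex.ofReal_zero, zero_smul]
    · intro h1
      exact absurd (Finset.mem_range.2 (by omega)) h1

theorem hasExpansion_of_mem_filt (hη : 0 ≤ η) {d : ℤ} {q : Symb} (hq : q ∈ filt d) {j : ℕ}
    (h : d + j ≤ k + 1) : HasExpansion η k fun L => symbEval ⌊η * L⌋₊ ((L ^ j) • q) := by
  have key := filt_induction (P := fun d q => ∀ s : Multiset ℕ,
      d + (s.sum + s.card : ℕ) + j ≤ k + 1 → HasExpansion η k fun L =>
        symbEval ⌊η * L⌋₊ ((L ^ j) • (q * (s.map MvPolynomial.X).prod)))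
    (fun d s _ => by simpa using HasExpansion.zero)
    (fun d p q hp hq s hs => by simpa [add_mul] using (hp s hs).add (hq s hs))
    (fun d a hd s hs => by
      simp only [MvPolynomial.C_mul', smul_smul]
      exact hasExpansion_monomial hη a s (by omega))
    (fun d p n _ _ ih s hs => by
      have := ih (n ::ₘ s) (by
        rw [Multiset.sum_cons, Multiset.card_cons]; push_cast at hs ⊢; omega)
      simpa only [Multiset.map_cons, Multiset.prod_cons, mul_assoc] using this) hq 0 (by simpa using h)
  simpa using key

/-- The Markov operators preserve the span of the `Ψ_ρ`, with coefficients of the order given by the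
weight. -/
theorem exists_markov_psi_eq_sum (η τ : ℝ) (hη : 0 < η) (k : ℕ) (hk : 1 ≤ k) :
    ∃ (c' : (n : ℕ) → n.Partition → ℝ) (ε : (n : ℕ) → n.Partition → ℝ → ℝ),
      (∀ (n : ℕ) (ρ : n.Partition), Tendsto (ε n ρ) atTop (𝓝 0)) ∧
      ∀ L : ℝ, 0 < L → markov ⌊η * L⌋₊ (τ * L) (psi ⌊η * L⌋₊ k) =
        ∑ n ∈ Finset.range (k + 2),
          ∑ ρ ∈ (Finset.univ : Finset n.Partition).filter (fun ρ => wt ρ ≤ k + 1),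
            (((c' n ρ + ε n ρ L) * L ^ (k + 1 - wt ρ) : ℝ) : ℂ) • psiPart ⌊η * L⌋₊ ρ := by
  have hX : (MvPolynomial.X k : Symb) ∈ filt (k + 1 : ℕ) := by exact_mod_cast X_mem_filt k
  have h : HasExpansion η k fun L => markov ⌊η * L⌋₊ (τ * L) (psi ⌊η * L⌋₊ k) := by
    have h1 : ∀ L : ℝ, markov ⌊η * L⌋₊ (τ * L) (psi ⌊η * L⌋₊ k) =
        ∑ n ∈ Finset.range (k + 1 + 1), symbEval ⌊η * L⌋₊
          ((L ^ n) • ((τ ^ n / (n.factorial : ℝ)) • (symbGen ^ n) (MvPolynomial.X k))) := fun L => by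
      rw [← symbEval_X_of_pos _ (by omega : k ≠ 0), markov_symbEval _ _ hX]
      refine Finset.sum_congr rfl fun n _ => ?_
      rw [smul_smul, mul_pow]
      congr 2
      ring
    simp only [h1]
    refine HasExpansion.sum _ fun n _ => hasExpansion_of_mem_filt hη.le
      (Submodule.smul_mem _ _ (symbGen_pow_mem_filt hX n)) ?_
    push_cast
    omega
  obtain ⟨c, f, h1, h2⟩ := h
  refine ⟨c, fun n ρ L => f n ρ L - c n ρ, fun n ρ => ?_, fun L hL => ?_⟩
  · simpa using (h1 n ρ).sub_const (c n ρ)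
  · simp only [add_sub_cancel]
    exact h2 L hL

end Expansion

/-! ### Limits of covariances -/

section Covariance

open Filter Topology

theorem symbExp_smul (a : ℝ) (q : Symb) : symbExp (a • q) = a • symbExp q := by
  ext1 n
  rw [Polynomial.coeff_smul, coeff_symbExp, coeff_symbExp, map_smul, smul_comm]

theorem symbCov_smul (x : Symb) (a : ℝ) (y : Symb) : symbCov x (a • y) = a • symbCov x y := by
  rw [symbCov, symbCov, mul_smul_comm, symbExp_smul, symbExp_smul, mul_smul_comm, smul_sub]

theorem symbCov_sum {ι : Type*} (x : Symb) (s : Finset ι) (y : ι → Symb) :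
    symbCov x (∑ i ∈ s, y i) = ∑ i ∈ s, symbCov x (y i) :=
  map_sum (AddMonoidHom.mk' (symbCov x) (symbCov_add x)) y s

theorem timeVal_smul (N : ℕ) (t a : ℝ) (s : Polynomial Symb) :
    timeVal N t (a • s) = a * timeVal N t s := by
  have h : a • s = Polynomial.C (MvPolynomial.C a) * s := Algebra.smul_def a s
  rw [h, map_mul]
  congr 1
  refine (Polynomial.eval₂_C _ _).trans ?_
  exact MvPolynomial.aeval_C _ a

/-- To leading order, the covariances with an element of weight at most `k + 1` are combinations of
those with `Ψ_1, …, Ψ_k`, since the covariance is asymptotically a derivation. -/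
theorem exists_tendsto_symbCov {η : ℝ} (hη : 0 ≤ η) (τ : ℝ) {k : ℕ} {d : ℤ} {q : Symb}
    (hq : q ∈ filt d) (hd : d ≤ k + 1) : ∃ a : ℕ → ℝ, ∀ (m : ℕ) (K : ℕ → ℝ),
      (∀ j ∈ Finset.Icc 1 k, Tendsto (fun L : ℝ => timeVal ⌊η * L⌋₊ (τ * L)
        (symbCov (MvPolynomial.X m) (MvPolynomial.X j)) / L ^ ((m + j : ℕ) : ℤ)) atTop
          (𝓝 (K j))) →
      Tendsto (fun L : ℝ => timeVal ⌊η * L⌋₊ (τ * L) (symbCov (MvPolynomial.X m) q) /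
        L ^ (m + d - 1)) atTop (𝓝 (∑ j ∈ Finset.Icc 1 k, a j * K j)) := by
  have hC : ∀ (b : ℝ) (d : ℤ), ∃ a : ℕ → ℝ, ∀ (m : ℕ) (K : ℕ → ℝ), Tendsto (fun L : ℝ =>
      timeVal ⌊η * L⌋₊ (τ * L) (symbCov (MvPolynomial.X m) (MvPolynomial.C b)) / L ^ (m + d - 1))
      atTop (𝓝 (∑ j ∈ Finset.Icc 1 k, a j * K j)) := fun b d =>
    ⟨0, fun m K => by simp [symbCov_C]⟩
  revert hd
  refine filt_induction (P := fun d q => d ≤ k + 1 → ∃ a : ℕ → ℝ, ∀ (m : ℕ) (K : ℕ → ℝ),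
    (∀ j ∈ Finset.Icc 1 k, Tendsto (fun L : ℝ => timeVal ⌊η * L⌋₊ (τ * L)
      (symbCov (MvPolynomial.X m) (MvPolynomial.X j)) / L ^ ((m + j : ℕ) : ℤ)) atTop (𝓝 (K j))) →
    Tendsto (fun L : ℝ => timeVal ⌊η * L⌋₊ (τ * L) (symbCov (MvPolynomial.X m) q) /
      L ^ (m + d - 1)) atTop (𝓝 (∑ j ∈ Finset.Icc 1 k, a j * K j)))
    (fun d _ => ?_) (fun d p q hp hq hd => ?_) (fun d b _ _ => ?_) (fun d p n hd hp ih hdk => ?_) hq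
  · obtain ⟨a, ha⟩ := hC 0 d
    rw [map_zero] at ha
    exact ⟨a, fun m K _ => ha m K⟩
  · obtain ⟨a, ha⟩ := hp hd
    obtain ⟨b, hb⟩ := hq hd
    refine ⟨a + b, fun m K hK => ?_⟩
    have := (ha m K hK).add (hb m K hK)
    simp only [Pi.add_apply, add_mul, Finset.sum_add_distrib]
    refine this.congr fun L => ?_
    rw [symbCov_add, map_add, add_div]
  · obtain ⟨a, ha⟩ := hC b d
    exact ⟨a, fun m K _ => ha m K⟩
  · obtain ⟨a, ha⟩ := ih (by omega)
    obtain ⟨u, hu⟩ := tendsto_timeVal hη τ (symbExp_mem_polyFilt hp)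
    obtain ⟨v, hv⟩ := tendsto_timeVal hη τ (symbExp_mem_polyFilt (X_mem_filt n))
    -- The covariance is a derivation up to `symbCum`; here `u` and `v` are the limits of the
    -- expectations of the two factors. The symbol `X 0` has covariance zero with everything.
    refine ⟨fun j => (if n = j then u else 0) + v * a j, fun m K hK => ?_⟩
    have h0 : Tendsto (fun L : ℝ => timeVal ⌊η * L⌋₊ (τ * L)
        (symbCov (MvPolynomial.X m) (MvPolynomial.X n)) / L ^ ((m + n : ℕ) : ℤ)) atTop
          (𝓝 (if n ∈ Finset.Icc 1 k then K n else 0)) := by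
      split_ifs with hn
      · exact hK n hn
      · have hn0 : n = 0 := by
          rw [Finset.mem_Icc] at hn
          omega
        simp [hn0, symbCov_X_zero]
    have h1 := tendsto_timeVal_zero hη τ (symbCum_mem_polyFilt (X_mem_filt m) hp (X_mem_filt n))
      (d' := m + (d + (n + 1)) - 1) (by omega)
    have h2 := (h1.add (hu.mul h0)).add (hv.mul (ha m K hK))
    have hsum : ∑ j ∈ Finset.Icc 1 k, ((if n = j then u else 0) + v * a j) * K j =
        0 + u * (if n ∈ Finset.Icc 1 k then K n else 0) +
          v * ∑ j ∈ Finset.Icc 1 k, a j * K j := by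
      simp only [add_mul, Finset.sum_add_distrib, ite_mul, zero_mul, Finset.sum_ite_eq, mul_ite,
        mul_zero, zero_add, Finset.mul_sum, mul_assoc]
    rw [hsum]
    refine h2.congr' ?_
    filter_upwards [eventually_gt_atTop 0] with L hL
    rw [div_mul_div_comm, div_mul_div_comm, ← zpow_add₀ hL.ne', ← zpow_add₀ hL.ne',
      show d + ((m + n : ℕ) : ℤ) = m + (d + (n + 1)) - 1 by push_cast; ring,
      show (n : ℤ) + 1 + (m + d - 1) = m + (d + (n + 1)) - 1 by ring, ← add_div, ← add_div,
      ← map_mul, ← map_mul, ← map_add, ← map_add]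
    congr 2
    rw [symbCum]
    ring

/-- Covariances with `P_t Ψ_k` are asymptotically combinations of those with the `Ψ_j`, `j ≤ k`, with
coefficients not depending on the other argument. -/
theorem exists_tendsto_cov (η τ₀ τ₁ : ℝ) (hη : 0 < η) (k : ℕ) (hk : 1 ≤ k) :
    ∃ c : ℕ → ℝ, ∀ m : ℕ, 1 ≤ m → ∃ K : ℕ → ℂ,
      (∀ j ∈ Finset.Icc 1 k, Tendsto (fun L : ℝ => cov ⌊η * L⌋₊ (τ₀ * L)
        (psi ⌊η * L⌋₊ m) (psi ⌊η * L⌋₊ j) / (L : ℂ) ^ (m + j)) atTop (𝓝 (K j))) ∧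
      Tendsto (fun L : ℝ => cov ⌊η * L⌋₊ (τ₀ * L) (psi ⌊η * L⌋₊ m)
        (markov ⌊η * L⌋₊ ((τ₁ - τ₀) * L) (psi ⌊η * L⌋₊ k)) / (L : ℂ) ^ (m + k))
        atTop (𝓝 (∑ j ∈ Finset.Icc 1 k, (c j : ℂ) * K j)) := by
  have hX : (MvPolynomial.X k : Symb) ∈ filt (k + 1 : ℕ) := by exact_mod_cast X_mem_filt k
  choose a ha using fun n : ℕ => exists_tendsto_symbCov hη.le τ₀ (k := k)
    (symbGen_pow_mem_filt hX n) (by push_cast; omega)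
  refine ⟨fun j => ∑ n ∈ Finset.range (k + 1 + 1), (τ₁ - τ₀) ^ n / (n.factorial : ℝ) * a n j,
    fun m hm => ?_⟩
  choose K hK using fun j : ℕ => tendsto_timeVal hη.le τ₀
    (polyFilt_mono (d' := ((m + j : ℕ) : ℤ)) (by push_cast; omega)
      (symbCov_mem_polyFilt (X_mem_filt m) (X_mem_filt j)))
  refine ⟨fun j => K j, fun j hj => ?_, ?_⟩
  · refine ((Complex.continuous_ofReal.tendsto _).comp (hK j)).congr fun L => ?_
    rw [← symbEval_X_of_pos _ (by omega : m ≠ 0),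
      ← symbEval_X_of_pos _ (Nat.one_le_iff_ne_zero.1 (Finset.mem_Icc.1 hj).1), cov_symbEval,
      Function.comp_apply, zpow_natCast]
    push_cast
    rfl
  · have h1 := tendsto_finsetSum (Finset.range (k + 1 + 1)) fun n _ =>
      (ha n m K fun j _ => hK j).const_mul ((τ₁ - τ₀) ^ n / (n.factorial : ℝ))
    have hsum : ∑ n ∈ Finset.range (k + 1 + 1), (τ₁ - τ₀) ^ n / (n.factorial : ℝ) *
          ∑ j ∈ Finset.Icc 1 k, a n j * K j =
        ∑ j ∈ Finset.Icc 1 k, (∑ n ∈ Finset.range (k + 1 + 1),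
          (τ₁ - τ₀) ^ n / (n.factorial : ℝ) * a n j) * K j := by
      simp only [Finset.mul_sum, Finset.sum_mul]
      rw [Finset.sum_comm]
      simp only [mul_assoc]
    rw [hsum] at h1
    have h2 := (Complex.continuous_ofReal.tendsto _).comp h1
    push_cast at h2
    push_cast
    refine h2.congr' ?_
    filter_upwards [eventually_gt_atTop 0] with L hL
    rw [← symbEval_X_of_pos _ (by omega : m ≠ 0), ← symbEval_X_of_pos _ (by omega : k ≠ 0),
      markov_symbEval _ _ hX, ← map_sum, cov_symbEval, symbCov_sum, map_sum,
      ← Complex.ofReal_pow, ← Complex.ofReal_div, Function.comp_apply, Complex.ofReal_inj,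
      Finset.sum_div]
    refine Finset.sum_congr rfl fun n _ => ?_
    rw [symbCov_smul, timeVal_smul, mul_pow,
      show ((m : ℤ) + ((k : ℤ) + 1 - n) - 1) = ((m + k : ℕ) : ℤ) - n by push_cast; ring,
      zpow_sub₀ hL.ne', zpow_natCast, zpow_natCast]
    have h3 := pow_ne_zero n hL.ne'
    have h4 := pow_ne_zero (m + k) hL.ne'
    field_simp

end Covariance

end GLWalk

end

theorem mainTheorem7 :
    (∃ r : ℕ → ℝ, ∀ (n : ℕ) (ρ : n.Partition) (η τ : ℝ), 0 < η → 0 < τ →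
      ((fun L : ℝ => GLWalk.state ⌊η * L⌋₊ (τ * L) (GLWalk.psiPart ⌊η * L⌋₊ ρ))
        =O[Filter.atTop] fun L : ℝ => L ^ GLWalk.wt ρ) ∧
      ((∀ k ∈ ρ.parts, Odd k → τ / η ≠ r k) →
        (fun L : ℝ => GLWalk.state ⌊η * L⌋₊ (τ * L) (GLWalk.psiPart ⌊η * L⌋₊ ρ))
          =Θ[Filter.atTop] fun L : ℝ => L ^ GLWalk.wt ρ)) ∧
    (∀ (η τ : ℝ), 0 < η → 0 < τ → ∀ k : ℕ, 1 ≤ k →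
      ∃ (c' : (n : ℕ) → n.Partition → ℝ) (ε : (n : ℕ) → n.Partition → ℝ → ℝ),
        (∀ (n : ℕ) (ρ : n.Partition), Filter.Tendsto (ε n ρ) Filter.atTop (nhds 0)) ∧
        ∀ L : ℝ, 0 < L →
          GLWalk.markov ⌊η * L⌋₊ (τ * L) (GLWalk.psi ⌊η * L⌋₊ k) =
            ∑ n ∈ Finset.range (k + 2),
              ∑ ρ ∈ (Finset.univ : Finset n.Partition).filter
                  (fun ρ => GLWalk.wt ρ ≤ k + 1),
                (((c' n ρ + ε n ρ L) * L ^ (k + 1 - GLWalk.wt ρ) : ℝ) : ℂ) •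
                  GLWalk.psiPart ⌊η * L⌋₊ ρ) ∧
    (∀ (η τ₀ τ₁ : ℝ), 0 < η → 0 ≤ τ₀ → τ₀ < τ₁ → ∀ k : ℕ, 1 ≤ k →
      ∃ c : ℕ → ℝ, ∀ m : ℕ, 1 ≤ m → ∃ K : ℕ → ℂ,
        (∀ j ∈ Finset.Icc 1 k,
          Filter.Tendsto
            (fun L : ℝ => GLWalk.cov ⌊η * L⌋₊ (τ₀ * L)
              (GLWalk.psi ⌊η * L⌋₊ m) (GLWalk.psi ⌊η * L⌋₊ j) / (L : ℂ) ^ (m + j))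
            Filter.atTop (nhds (K j))) ∧
        Filter.Tendsto
          (fun L : ℝ => GLWalk.cov ⌊η * L⌋₊ (τ₀ * L) (GLWalk.psi ⌊η * L⌋₊ m)
            (GLWalk.markov ⌊η * L⌋₊ ((τ₁ - τ₀) * L) (GLWalk.psi ⌊η * L⌋₊ k)) /
              (L : ℂ) ^ (m + k))
          Filter.atTop (nhds (∑ j ∈ Finset.Icc 1 k, (c j : ℂ) * K j))) := by
  refine ⟨GLWalk.exists_isTheta_state, fun η τ hη _ k hk => ?_, fun η τ₀ τ₁ hη _ _ k hk => ?_⟩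
  · exact GLWalk.exists_markov_psi_eq_sum η τ hη k hk
  · exact GLWalk.exists_tendsto_cov η τ₀ τ₁ hη k hk
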